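/- Let $L^2(-\pi,\pi)$ carry its usual inner product. A system $\{v_n\}_{n\in\mathbb Z}$ in a Hilbert space is complete and minimal if its closed linear span is the whole space, while for every $m$ the closed span of $\{v_n\}_{n\ne m}$ is not; it then has a unique biorthogonal system $\{w_n\}$, $(v_n,w_m)=\delta_{nm}$. It is hereditarily complete if it is complete and minimal and, for every $A\subset\mathbb Z$, the system $\{v_n\}_{n\in A}\cup\{w_n\}_{n\notin A}$ is complete; it is nonhereditarily complete if it is complete and minimal but not hereditarily complete. Say that a function $G:\mathbb C\to\mathbb C$ and a real sequence $\Lambda=\{\lambda_n\}_{n\in\mathbb Z}$ satisfy $(*)$ if the following hold. 1. The system $\{e^{i\lambda_n t}\}_{n\in\mathbb Z}$ is complete and minimal in $L^2(-\pi,\pi)$, and $G$ is its generating function: $\lambda_n\neq 0$ for all $n$, $\{n:|\lambda_n|<R\}$ is finite for every $R$, and $G(z)=\lim_{R\to\infty}\prod_{|\lambda_n|<R}(1-z/\lambda_n)$ for all $z\in\mathbb C$. 2. (a) $G(\mathbb R)\subset\mathbb R$; (b) $\operatorname{dist}(\mathbb Z,\Lambda)>0$; (c) for some $C>0$ every closed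 interval of length at least $C$ contains a point of $\Lambda$; (d) $|G(iy)|=o(e^{\pi|y|})$ as $|y|\to\infty$. 3. There are $\rho_k>0$ and $d_k>0$ ($k=1,2,\dots$) with $2\rho_k\le\rho_{k+1}$, $d_k\le 0.1\,\rho_k$, $\operatorname{dist}(\rho_k,\mathbb Z)\ge\frac13$ and $G(\rho_k)\neq0$ for all $k$ such that, with $I_k=[\rho_k-d_k,\rho_k+d_k]$, $g_k=\sum_{n\in\mathbb Z\cap I_k}G(n)^2$, $s_k=\sqrt{d_kg_k\rho_k}$ and $J_k=[\rho_k-d_k-2s_k,\rho_k-d_k-s_k]\cup[\rho_k+d_k+s_k,\rho_k+d_k+2s_k]$: (i) $\sum_{n\in\mathbb Z\setminus\bigcup_kI_k}G(n)^2<\infty$; (ii) $\sum_k s_k\sum_{n\in\mathbb Z\cap J_k}G(n)^2<\infty$; (iii) $s_k\le0.1\,\rho_k$ for all $k$; (iv) $\sum_k d_k/\rho_k<\infty$. **Theorem.** For every $\delta>\frac12$ there exist $G$ and $\Lambda=\{\lambda_n\}_{n\in\mathbb Z}\subset\mathbb R$ that satisfy $(*)$, such that $\sup_{n\in\mathbb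 Z}|\lambda_n-n|\le\delta$, with equality if $\delta$ is not an integer, and such that $\{e^{i\lambda_nt}\}_{n\in\mathbb Z}$ is nonhereditarily complete. Consequently $\delta_{crit}\le\frac12$, where $\delta_{crit}$ is the infimum of all $\delta>0$ for which there is a nonhereditarily complete system $\{e^{i\lambda_nt}\}_{n\in\mathbb Z}$ in $L^2(-\pi,\pi)$ with $\lambda_n\in\mathbb R$ and $|\lambda_n-n|<\delta$ for all $n\in\mathbb Z$. -/

import Mathlib

namespace SpectralSynthesis

section Systems

variable {ι H : Type*} [NormedAddCommGroup H] [InnerProductSpace ℂ H]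

/-- The set `S` of vectors is complete: its closed linear span is the whole space. -/
def IsCompleteSet (S : Set H) : Prop :=
  (Submodule.span ℂ S).topologicalClosure = ⊤

/-- The system `v` is complete, and it becomes incomplete when any one vector is removed. -/
def IsCompleteMinimal (v : ι → H) : Prop :=
  IsCompleteSet (Set.range v) ∧ ∀ m, ¬ IsCompleteSet (v '' {n | n ≠ m})

/-- `w` is biorthogonal to `v`. For a complete and minimal `v` in a Hilbert space there is
exactly one such `w`. -/
def IsBiorthogonal (v w : ι → H) : Prop :=
  (∀ n, inner ℂ (v n) (w n) = 1) ∧ ∀ n m, n ≠ m → inner ℂ (v n) (w m) = 0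

/-- `v` is complete and minimal, and for its biorthogonal system `w` and every partition of the
index set into `A` and its complement, the mixed system `{v n : n ∈ A} ∪ {w n : n ∉ A}` is
complete. -/
def IsHereditarilyComplete (v : ι → H) : Prop :=
  IsCompleteMinimal v ∧
    ∀ w : ι → H, IsBiorthogonal v w → ∀ A : Set ι, IsCompleteSet (v '' A ∪ w '' Aᶜ)

/-- `v` is complete and minimal but not hereditarily complete. -/
def IsNonhereditarilyComplete (v : ι → H) : Prop :=
  IsCompleteMinimal v ∧ ¬ IsHereditarilyComplete v

end Systems

noncomputable section

/-- The Hilbert space `L²(-π, π)`. -/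
abbrev L2 : Type :=
  MeasureTheory.Lp ℂ 2 (MeasureTheory.volume.restrict (Set.Ioo (-Real.pi) Real.pi))

theorem memLp_exp (x : ℝ) :
    MeasureTheory.MemLp (fun t : ℝ => Complex.exp (Complex.I * x * t)) 2
      (MeasureTheory.volume.restrict (Set.Ioo (-Real.pi) Real.pi)) := by
  refine MeasureTheory.MemLp.of_bound (C := 1) ?_ ?_
  · exact Continuous.aestronglyMeasurable (by fun_prop)
  · refine Filter.Eventually.of_forall fun t => ?_
    simp [Complex.norm_exp]

/-- The exponential system `{e^{i λ_n t}}` in `L²(-π, π)` with real frequencies `λ_n = lam n`. -/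
def expSystem (lam : ℤ → ℝ) (n : ℤ) : L2 :=
  (memLp_exp (lam n)).toLp

/-- `G` is the generating function of the frequencies `lam`: the canonical product
`G(z) = lim_{R → ∞} ∏_{|λ_n| < R} (1 - z / λ_n)` in the sense of principal value. -/
def IsGeneratingFunction (G : ℂ → ℂ) (lam : ℤ → ℝ) : Prop :=
  (∀ n, lam n ≠ 0) ∧
  (∀ R : ℝ, {n : ℤ | |lam n| < R}.Finite) ∧
  ∀ z : ℂ, Filter.Tendsto
    (fun R : ℝ => ∏ᶠ n ∈ {n : ℤ | |lam n| < R}, (1 - z / (lam n : ℂ)))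
    Filter.atTop (nhds (G z))

/-- `∑ |G(n)|²` over the integers `n` in the real interval `[a, b]`. -/
def sumSq (G : ℂ → ℂ) (a b : ℝ) : ℝ :=
  ∑ n ∈ Finset.Icc ⌈a⌉ ⌊b⌋, ‖G (n : ℂ)‖ ^ 2

/-- `g_k`, for the interval `I_k = [ρ - d, ρ + d]`. -/
def gVal (G : ℂ → ℂ) (ρ d : ℝ) : ℝ := sumSq G (ρ - d) (ρ + d)

/-- `s_k = √(d_k g_k ρ_k)`. -/
def sVal (G : ℂ → ℂ) (ρ d : ℝ) : ℝ := Real.sqrt (d * gVal G ρ d * ρ)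

/-- `∑ |G(n)|²` over the integers `n` in
`J_k = [ρ - d - 2s, ρ - d - s] ∪ [ρ + d + s, ρ + d + 2s]`
(for `d > 0` the two intervals are disjoint). -/
def jVal (G : ℂ → ℂ) (ρ d : ℝ) : ℝ :=
  sumSq G (ρ - d - 2 * sVal G ρ d) (ρ - d - sVal G ρ d) +
    sumSq G (ρ + d + sVal G ρ d) (ρ + d + 2 * sVal G ρ d)

/-- The conditions on the lacunary intervals `I_k = [ρ_k - d_k, ρ_k + d_k]`. -/
structure IntervalConditions (G : ℂ → ℂ) (ρ d : ℕ → ℝ) : Prop where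
  rho_pos : ∀ k, 0 < ρ k
  lacunary : ∀ k, 2 * ρ k ≤ ρ (k + 1)
  d_pos : ∀ k, 0 < d k
  d_le : ∀ k, d k ≤ ρ k / 10
  dist_rho : ∀ k, ∀ m : ℤ, 1 / 3 ≤ |ρ k - m|
  G_rho_ne : ∀ k, G (ρ k : ℂ) ≠ 0
  summable_off : Summable
    (fun n : {n : ℤ // ∀ k, (n : ℝ) ∉ Set.Icc (ρ k - d k) (ρ k + d k)} => ‖G ((n : ℤ) : ℂ)‖ ^ 2)
  summable_J : Summable (fun k => sVal G (ρ k) (d k) * jVal G (ρ k) (d k))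
  s_le : ∀ k, sVal G (ρ k) (d k) ≤ ρ k / 10
  summable_log : Summable (fun k => d k / ρ k)

/-- The full list of hypotheses on a function `G` and a real sequence `lam`. -/
structure Hypotheses (G : ℂ → ℂ) (lam : ℤ → ℝ) : Prop where
  completeMinimal : IsCompleteMinimal (expSystem lam)
  generating : IsGeneratingFunction G lam
  real_on_real : ∀ x : ℝ, (G (x : ℂ)).im = 0
  dist_int : ∃ ε > 0, ∀ n m : ℤ, ε ≤ |lam n - m|
  locally_dense : ∃ C > 0, ∀ a b : ℝ, C ≤ b - a → ∃ n, lam n ∈ Set.Icc a b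
  imag_axis : (fun y : ℝ => G (Complex.I * y)) =o[Filter.cocompact ℝ]
    (fun y : ℝ => Real.exp (Real.pi * |y|))
  intervals : ∃ ρ d : ℕ → ℝ, IntervalConditions G ρ d

/-- The synthesis constant: the infimum (`⊤` for the empty set) of all `δ > 0` for which there is
a nonhereditarily complete system `{e^{i λ_n t}}` with real `λ_n` and `|λ_n - n| < δ`. -/
def deltaCrit : EReal :=
  sInf {x : EReal | ∃ δ : ℝ, x = (δ : EReal) ∧ 0 < δ ∧
    ∃ lam : ℤ → ℝ, (∀ n : ℤ, |lam n - n| < δ) ∧ IsNonhereditarilyComplete (expSystem lam)}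

end

end SpectralSynthesis

/-! ### Fourier coefficients of exponentials in an orthonormal basis of L². -/

namespace SpectralSynthesis

open MeasureTheory

/-! In the orthonormal basis `(-1)^j e^{ijt} / √(2π)` the function `e^{iλt}`, `λ ∉ ℤ`, has
coefficients proportional to `1 / (λ - j)`. So L² becomes ℓ²(ℤ), and orthogonality of `x` to
`e^{iλ_m t}` means that the Cauchy transform `∑ x_j / (z - j)` vanishes at `λ_m`. With `r_j = (-1)^j
G(j)`, the residues of `π G(z) / sin πz`, the sequences `u_m = (r_j / (j - λ_m))_j` are orthogonal
to `e^{iλ_n t}` for `n ≠ m`; up to scalars they are the biorthogonal system.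

Frequencies. `λ_0 = β` carries the deviation `δ` when `δ` is not an integer. All other deviations
are `±α` with `α = 1/2 + ε` and small `ε > 0`: they point away from 0, except on sparse blocks
`[c_k, 2c_k]`, where they point towards 0. Without the blocks `r_j` would decay like `|j|^{-2α}`.
The right end of a block contributes a factor like `(c_k / |j - 2c_k|)^{2α}`, which brings `r` back
to size at least `c₀` at the center `2c_k`. Around the center `r` decays like `|j - 2c_k|^{-2α}`, up
to a factor `x_k^ε`, where `c_k = x_k^4`.

Failure of hereditary completeness. The sequence `r` is formally orthogonal to all exponentials but
is not in ℓ², because of the centers. Let `v_j = r_j (1 + ∑_k γ_k / (j - λ_{idx k}))`, where `idx k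
= 2c_k + x_k²` and `γ_k = λ_{idx k} - 2c_k`. Near `2c_k` the bracket is `(j - 2c_k) / (j - λ_{idx
k})` up to a small error, so the peak of `r` is removed; the new peak at `idx k` has squared norm of
order `x_k^{-2ε}`. Since `ε > 0`, `v` is in ℓ². Formally `v = r + ∑ γ_k u_{idx k}`, so `v` is
orthogonal to the exponentials outside `idx`. It is not in the closed span of the `u_{idx k}`: the
values at the centers bound the coefficients of an approximation by diagonal dominance, and then the
error at `j = 0` cannot be small. The component of `v` orthogonal to that span is a nonzero vector
orthogonal to the mixed system.

Completeness. If `x ∈ ℓ²` is orthogonal to all exponentials, the divided differences of `x / r` of a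
fixed order vanish, so `x / r` is a polynomial; it tends to 0 along the centers and hence is 0.

All identities for `G` are limits of partial fraction identities for `∏ (1 - z/λ_n) / (z ∏ (1 -
z/n))` over finite windows, with the majorant `W` of the residues. The main lemmas are
`ResidueData.not_hereditary`, `notMem_closure_of_diagonally_dominant`,
`eq_zero_of_cauchyTransform_eq_zero`, `Params.abs_res_le_W`, `Params.le_abs_res_center` and
`Params.summable_r_mul_V_sq`. -/

theorem inner_expSystem (lam mu : ℤ → ℝ) (n m : ℤ) :
    inner ℂ (expSystem lam n) (expSystem mu m) =
      ∫ t in (-Real.pi)..Real.pi, Complex.exp ((Complex.I * (mu m - lam n)) * t) := by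
  rw [L2.inner_def, intervalIntegral.integral_of_le (by linarith [Real.pi_pos]),
    ← integral_Ioc_eq_integral_Ioo.symm]
  refine integral_congr_ae ?_
  filter_upwards [(memLp_exp (lam n)).coeFn_toLp, (memLp_exp (mu m)).coeFn_toLp] with t h1 h2
  simp only [expSystem, h1, h2, RCLike.inner_apply, ← Complex.exp_conj, ← Complex.exp_add]
  congr 1
  simp
  ring

theorem inner_expSystem_of_ne (lam mu : ℤ → ℝ) (n m : ℤ) (h : mu m ≠ lam n) :
    inner ℂ (expSystem lam n) (expSystem mu m) =
      ((2 * Real.sin (Real.pi * (mu m - lam n)) / (mu m - lam n) : ℝ) : ℂ) := by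
  have hne : (Complex.I * ((mu m : ℂ) - lam n)) ≠ 0 := by
    refine mul_ne_zero Complex.I_ne_zero ?_
    rw [sub_ne_zero]
    exact_mod_cast h
  have hne' : ((mu m : ℂ) - lam n) ≠ 0 := right_ne_zero_of_mul hne
  rw [inner_expSystem, integral_exp_mul_complex hne]
  push_cast
  rw [Complex.sin]
  have e1 : Complex.I * ((mu m : ℂ) - lam n) * Real.pi = Real.pi * (mu m - lam n) * Complex.I := by
    ring
  have e2 : Complex.I * ((mu m : ℂ) - lam n) * (-Real.pi) =
      -(Real.pi * (mu m - lam n)) * Complex.I := by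
    ring
  rw [e1, e2]
  field_simp
  rw [Complex.I_sq]
  ring

theorem inner_expSystem_self (lam mu : ℤ → ℝ) (n m : ℤ) (h : mu m = lam n) :
    inner ℂ (expSystem lam n) (expSystem mu m) = ((2 * Real.pi : ℝ) : ℂ) := by
  rw [inner_expSystem, h]
  simp
  ring

/-- The alternating exponentials `(-1)^n e^{int} / √(2π)`. -/
noncomputable def altExp (n : ℤ) : L2 :=
  (((-1 : ℝ) ^ n / Real.sqrt (2 * Real.pi) : ℝ) : ℂ) • expSystem (fun k : ℤ => (k : ℝ)) n

theorem orthonormal_altExp : Orthonormal ℂ altExp := by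
  have hpi : 0 < Real.sqrt (2 * Real.pi) := Real.sqrt_pos.2 (by positivity)
  have hsq : Real.sqrt (2 * Real.pi) ^ 2 = 2 * Real.pi := Real.sq_sqrt (by positivity)
  rw [orthonormal_iff_ite]
  intro i j
  rw [altExp, altExp, inner_smul_left, inner_smul_right, Complex.conj_ofReal]
  split_ifs with h
  · subst h
    rw [inner_expSystem_self _ _ _ _ rfl, ← Complex.ofReal_mul, ← Complex.ofReal_mul,
      ← Complex.ofReal_one]
    congr 1
    have h1 : ((-1 : ℝ) ^ i) * (-1) ^ i = 1 := by
      rw [← mul_zpow]; simp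
    field_simp
    rw [hsq, pow_two, h1, one_mul]
  · have hne : ((j : ℤ) : ℝ) ≠ (i : ℝ) := by
      intro e
      exact h (by exact_mod_cast e.symm)
    rw [inner_expSystem_of_ne _ _ _ _ hne]
    have : Real.sin (Real.pi * ((j : ℝ) - i)) = 0 := by
      have := Real.sin_int_mul_pi (j - i)
      rw [mul_comm]
      exact_mod_cast this
    simp only [this]
    simp

/-- Parseval's identity: all Fourier coefficients vanish, so the norm does. -/
theorem eq_zero_of_inner_exp_eq_zero (f : L2)
    (hf : ∀ n, inner ℂ (expSystem (fun k : ℤ => (k : ℝ)) n) f = 0) : f = 0 := by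
  have hpi : -Real.pi < Real.pi := by linarith [Real.pi_pos]
  have hmem : MemLp f 2 (volume.restrict (Set.Ioc (-Real.pi) Real.pi)) := by
    rw [← Measure.restrict_congr_set Ioo_ae_eq_Ioc]
    exact Lp.memLp f
  have hc : ∀ n, fourierCoeffOn hpi f n = 0 := by
    intro n
    rw [fourierCoeffOn_eq_integral, intervalIntegral.integral_of_le hpi.le,
      integral_Ioc_eq_integral_Ioo]
    have h := hf n
    rw [L2.inner_def] at h
    rw [smul_eq_zero]
    right
    rw [← h]
    refine integral_congr_ae ?_
    filter_upwards [(memLp_exp (n : ℝ)).coeFn_toLp] with t h1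
    simp only [expSystem, h1, RCLike.inner_apply, ← Complex.exp_conj]
    rw [fourier_coe_apply, smul_eq_mul, mul_comm]
    congr 2
    have : (Real.pi : ℂ) ≠ 0 := by exact_mod_cast Real.pi_ne_zero
    simp
    field_simp
    ring
  have h2 := tsum_sq_fourierCoeffOn hpi hmem
  simp only [hc] at h2
  rw [intervalIntegral.integral_of_le hpi.le, integral_Ioc_eq_integral_Ioo] at h2
  have h3 : ∫ x in Set.Ioo (-Real.pi) Real.pi, ‖f x‖ ^ 2 = 0 := by
    have : (Real.pi - -Real.pi)⁻¹ ≠ 0 := inv_ne_zero (by linarith [Real.pi_pos])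
    simpa [this, eq_comm] using h2
  have h4 : (inner ℂ f f : ℂ) = 0 := by
    rw [L2.inner_def]
    have : ∀ x, (inner ℂ (f x) (f x) : ℂ) = ((‖f x‖ ^ 2 : ℝ) : ℂ) := fun x => by
      rw [inner_self_eq_norm_sq_to_K]; simp
    simp only [this]
    rw [integral_complex_ofReal, h3]; simp
  exact inner_self_eq_zero.1 h4

/-- The Hilbert basis of alternating exponentials. -/
noncomputable def altBasis : HilbertBasis ℤ ℂ L2 :=
  HilbertBasis.mkOfOrthogonalEqBot orthonormal_altExp <| by
    have hpi : 0 < Real.sqrt (2 * Real.pi) := Real.sqrt_pos.2 (by positivity)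
    rw [Submodule.eq_bot_iff]
    intro f hf
    refine eq_zero_of_inner_exp_eq_zero f fun n => ?_
    have h := (Submodule.mem_orthogonal _ _).1 hf (altExp n) (Submodule.subset_span ⟨n, rfl⟩)
    rw [altExp, inner_smul_left, mul_eq_zero] at h
    refine h.resolve_left ?_
    rw [Complex.conj_ofReal]
    refine Complex.ofReal_ne_zero.2 ?_
    exact div_ne_zero (zpow_ne_zero _ (by norm_num)) hpi.ne'

theorem altBasis_apply (n : ℤ) : altBasis n = altExp n := by
  rw [altBasis, HilbertBasis.coe_mkOfOrthogonalEqBot]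

/-- The sign in the basis cancels the one in `sin (π (λ - j)) = (-1)^j sin πλ`, so `κ` does not
depend on `j`; it is nonzero because `λ` is not an integer. -/
theorem inner_altBasis_expSystem (lam : ℤ → ℝ) (m : ℤ) (hm : ∀ j : ℤ, lam m ≠ j) :
    ∃ κ : ℝ, κ ≠ 0 ∧ ∀ j : ℤ,
      inner ℂ (altBasis j) (expSystem lam m) = ((κ / (lam m - j) : ℝ) : ℂ) := by
  have hpi : 0 < Real.sqrt (2 * Real.pi) := Real.sqrt_pos.2 (by positivity)
  refine ⟨2 * Real.sin (Real.pi * lam m) / Real.sqrt (2 * Real.pi), ?_, fun j => ?_⟩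
  · refine div_ne_zero (mul_ne_zero two_ne_zero ?_) hpi.ne'
    rw [Real.sin_ne_zero_iff]
    intro n hn
    refine hm n ?_
    rw [mul_comm] at hn
    exact (mul_left_cancel₀ Real.pi_ne_zero hn).symm
  · have hne : lam m - j ≠ 0 := sub_ne_zero.2 (hm j)
    rw [altBasis_apply, altExp, inner_smul_left, Complex.conj_ofReal,
      inner_expSystem_of_ne _ _ _ _ (hm j), ← Complex.ofReal_mul]
    congr 1
    have h1 : Real.sin (Real.pi * (lam m - j)) = (-1) ^ j * Real.sin (Real.pi * lam m) := by
      rw [← Real.sin_sub_int_mul_pi]; congr 1; ring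
    have h2 : ((-1 : ℝ) ^ j) * (-1) ^ j = 1 := by
      rw [← mul_zpow]; simp
    rw [h1]
    field_simp
    rw [pow_two]
    linear_combination (Real.sin (Real.pi * lam m)) * h2

end SpectralSynthesis

/-! ### Cauchy transforms, dual systems and a criterion for nonhereditary completeness. -/

namespace SpectralSynthesis

theorem isCompleteSet_iff {H : Type*} [NormedAddCommGroup H] [InnerProductSpace ℂ H]
    [CompleteSpace H] (S : Set H) :
    IsCompleteSet S ↔ ∀ x : H, (∀ s ∈ S, inner ℂ s x = 0) → x = 0 := by
  rw [IsCompleteSet, Submodule.topologicalClosure_eq_top_iff, Submodule.eq_bot_iff]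
  refine forall_congr' fun x => ?_
  refine imp_congr_left ?_
  rw [Submodule.mem_orthogonal]
  constructor
  · exact fun h s hs => h s (Submodule.subset_span hs)
  · intro h u hu
    induction hu using Submodule.span_induction with
    | mem y hy => exact h y hy
    | zero => simp
    | add y z _ _ hy hz => rw [inner_add_left, hy, hz, add_zero]
    | smul c y _ hy => rw [inner_smul_left, hy, mul_zero]

theorem exists_L2_of_summable_sq (a : ℤ → ℝ) (ha : Summable fun j => a j ^ 2) :
    ∃ x : L2, ∀ j, inner ℂ (altBasis j) x = (a j : ℂ) := by
  have h : Memℓp (fun j : ℤ => (a j : ℂ)) 2 := by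
    refine memℓp_gen ?_
    simpa using ha
  refine ⟨altBasis.repr.symm ⟨_, h⟩, fun j => ?_⟩
  rw [← HilbertBasis.repr_apply_apply, LinearIsometryEquiv.apply_symm_apply]

theorem summable_sq_inner_altBasis (x : L2) :
    Summable fun j => ‖(inner ℂ (altBasis j) x : ℂ)‖ ^ 2 := by
  have := altBasis.orthonormal.inner_products_summable x
  exact this

theorem L2_eq_zero_of_coeff (x : L2) (h : ∀ j, inner ℂ (altBasis j) x = 0) : x = 0 := by
  apply altBasis.repr.injective
  ext j
  rw [HilbertBasis.repr_apply_apply, h j]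
  simp

section Orthogonality

variable {lam : ℤ → ℝ}

theorem inner_expSystem_eq_zero_iff (hlam : ∀ n j : ℤ, lam n ≠ j) (m : ℤ) (x : L2) :
    inner ℂ (expSystem lam m) x = 0 ↔
      ∑' j : ℤ, (inner ℂ (altBasis j) x : ℂ) / (lam m - j) = 0 := by
  obtain ⟨κ, hκ, h⟩ := inner_altBasis_expSystem lam m (hlam m)
  have h1 := (altBasis.hasSum_inner_mul_inner (expSystem lam m) x).tsum_eq
  have h2 : ∀ j : ℤ, inner ℂ (expSystem lam m) (altBasis j) * inner ℂ (altBasis j) x =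
      (κ : ℂ) * ((inner ℂ (altBasis j) x : ℂ) / (lam m - j)) := by
    intro j
    rw [← inner_conj_symm, h j, Complex.conj_ofReal]
    push_cast
    ring
  simp only [h2] at h1
  rw [tsum_mul_left] at h1
  rw [← h1, mul_eq_zero]
  have : (κ : ℂ) ≠ 0 := Complex.ofReal_ne_zero.2 hκ
  tauto

theorem inner_expSystem_eq_zero_of_real (hlam : ∀ n j : ℤ, lam n ≠ j) (m : ℤ) (x : L2)
    (a : ℤ → ℝ) (hx : ∀ j, inner ℂ (altBasis j) x = (a j : ℂ))
    (h : ∑' j : ℤ, a j / (lam m - j) = 0) : inner ℂ (expSystem lam m) x = 0 := by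
  rw [inner_expSystem_eq_zero_iff hlam]
  have : ∀ j : ℤ, (inner ℂ (altBasis j) x : ℂ) / (lam m - j) = ((a j / (lam m - j) : ℝ) : ℂ) := by
    intro j
    rw [hx]
    push_cast
    rfl
  simp only [this]
  rw [← Complex.ofReal_tsum, h, Complex.ofReal_zero]

/-- The data of a system that is complete because of `unique`, with biorthogonal elements
proportional to the sequences `r j / (j - lam m)`. -/
structure ResidueData (lam : ℤ → ℝ) (r : ℤ → ℝ) : Prop where
  notInt : ∀ n j : ℤ, lam n ≠ j
  r_zero : r 0 = 1
  sq_summable : ∀ m, Summable fun j : ℤ => (r j / (j - lam m)) ^ 2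
  orth : ∀ m n, n ≠ m → ∑' j : ℤ, r j / (j - lam m) / (lam n - j) = 0
  unique : ∀ x : ℤ → ℂ, (Summable fun j => ‖x j‖ ^ 2) →
    (∀ m : ℤ, ∑' j : ℤ, x j / (lam m - j) = 0) → ∀ j, x j = 0

namespace ResidueData

variable {r : ℤ → ℝ}

theorem eq_zero_of_orthogonal (D : ResidueData lam r) (x : L2)
    (hx : ∀ m, inner ℂ (expSystem lam m) x = 0) : x = 0 := by
  refine L2_eq_zero_of_coeff x (D.unique _ (summable_sq_inner_altBasis x) fun m => ?_)
  exact (inner_expSystem_eq_zero_iff D.notInt m x).1 (hx m)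

/-- The diagonal products are nonzero by completeness: otherwise `u m` would be orthogonal to every
exponential, hence zero, although its coefficient at 0 is `-1 / lam m`. -/
theorem exists_dual (D : ResidueData lam r) :
    ∃ u : ℤ → L2, (∀ m j : ℤ, inner ℂ (altBasis j) (u m) = ((r j / (j - lam m) : ℝ) : ℂ)) ∧
      (∀ m n, n ≠ m → inner ℂ (expSystem lam n) (u m) = 0) ∧
      ∀ m, inner ℂ (expSystem lam m) (u m) ≠ 0 := by
  choose u hu using fun m => exists_L2_of_summable_sq _ (D.sq_summable m)
  have horth : ∀ m n, n ≠ m → inner ℂ (expSystem lam n) (u m) = 0 := fun m n hnm =>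
    inner_expSystem_eq_zero_of_real D.notInt n _ _ (hu m) (D.orth m n hnm)
  refine ⟨u, hu, horth, fun m hm => ?_⟩
  have h0 : u m = 0 := by
    refine D.eq_zero_of_orthogonal _ fun n => ?_
    by_cases hnm : n = m
    · rw [hnm, hm]
    · exact horth m n hnm
  have h1 := hu m 0
  rw [h0, inner_zero_right, D.r_zero] at h1
  have h2 : (1 / (((0 : ℤ) : ℝ) - lam m)) = 0 := by exact_mod_cast h1.symm
  have h3 := D.notInt m 0
  rw [one_div, inv_eq_zero, sub_eq_zero] at h2
  exact h3 h2.symm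

theorem isCompleteMinimal (D : ResidueData lam r) : IsCompleteMinimal (expSystem lam) := by
  refine ⟨(isCompleteSet_iff _).2 fun x hx =>
    D.eq_zero_of_orthogonal x fun m => hx _ ⟨m, rfl⟩, fun m h => ?_⟩
  obtain ⟨u, -, hu1, hu2⟩ := D.exists_dual
  refine hu2 m ?_
  rw [(isCompleteSet_iff _).1 h (u m), inner_zero_right]
  rintro _ ⟨n, hn, rfl⟩
  exact hu1 m n hn

/-- If the span of the duals `u (idx k)` does not contain some vector that is orthogonal to all
the remaining exponentials in its closure, the system is not hereditarily complete. -/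
theorem not_hereditary (D : ResidueData lam r) (idx : ℕ → ℤ) (v : L2)
    (hv : ∀ n, n ∉ Set.range idx → inner ℂ (expSystem lam n) v = 0)
    (hnot : ∀ u : ℤ → L2,
      (∀ m j : ℤ, inner ℂ (altBasis j) (u m) = ((r j / (j - lam m) : ℝ) : ℂ)) →
      v ∉ (Submodule.span ℂ (Set.range fun k => u (idx k))).topologicalClosure) :
    IsNonhereditarilyComplete (expSystem lam) := by
  refine ⟨D.isCompleteMinimal, fun h => ?_⟩
  obtain ⟨u, hu0, hu1, hu2⟩ := D.exists_dual
  set w : ℤ → L2 := fun m => (inner ℂ (expSystem lam m) (u m))⁻¹ • u m with hw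
  have hbi : IsBiorthogonal (expSystem lam) w := by
    refine ⟨fun n => ?_, fun n m hnm => ?_⟩
    · rw [hw, inner_smul_right, inv_mul_cancel₀ (hu2 n)]
    · rw [hw, inner_smul_right, hu1 m n hnm, mul_zero]
  -- The mixed system keeps the exponentials off `idx` and the duals on `idx`. With `K` the closed
  -- span of these duals, `v` minus its projection to `K` is orthogonal to both families, since `K`
  -- itself is orthogonal to the exponentials that are kept.
  have hcomp := h.2 w hbi (Set.range idx)ᶜ
  rw [compl_compl, isCompleteSet_iff] at hcomp
  set K := (Submodule.span ℂ (Set.range fun k => u (idx k))).topologicalClosure with hK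
  have hKclosed : IsClosed (K : Set L2) := Submodule.isClosed_topologicalClosure _
  have : CompleteSpace K := hKclosed.completeSpace_coe
  have hKn : ∀ n, n ∉ Set.range idx → ∀ y ∈ K, inner ℂ (expSystem lam n) y = 0 := by
    intro n hn y hy
    have hle : K ≤ (Submodule.span ℂ {expSystem lam n})ᗮ := by
      refine Submodule.topologicalClosure_minimal _ ?_ (Submodule.isClosed_orthogonal _)
      rw [Submodule.span_le]
      rintro _ ⟨k, rfl⟩
      rw [SetLike.mem_coe, Submodule.mem_orthogonal_singleton_iff_inner_right]
      exact hu1 _ _ fun e => hn ⟨k, e.symm⟩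
    exact Submodule.mem_orthogonal_singleton_iff_inner_right.1 (hle hy)
  have hx := hcomp (v - K.starProjection v) ?_
  · refine hnot u hu0 ?_
    rw [sub_eq_zero] at hx
    rw [← hK, hx]
    exact Submodule.starProjection_apply_mem _ _
  · rintro s (⟨n, hn, rfl⟩ | ⟨_, ⟨k, rfl⟩, rfl⟩)
    · rw [inner_sub_right, hv n hn, hKn n hn _ (Submodule.starProjection_apply_mem _ _), sub_zero]
    · have hmem : w (idx k) ∈ K :=
        Submodule.smul_mem _ _ (Submodule.le_topologicalClosure _ (Submodule.subset_span ⟨k, rfl⟩))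
      exact (Submodule.mem_orthogonal _ _).1 (Submodule.sub_starProjection_mem_orthogonal v) _ hmem

end ResidueData

end Orthogonality

end SpectralSynthesis

/-! ### Separation of a vector from the span of the duals. -/

namespace SpectralSynthesis

/-- Diagonal dominance: a vector `v` with coefficients `r j * (1 + ∑ γ k / (j - lam (idx k)))`
stays away from the closed span of the sequences `r j / (j - lam (idx k))`. -/
theorem notMem_closure_of_diagonally_dominant {lam r : ℤ → ℝ} (idx b : ℕ → ℤ) (γ : ℕ → ℝ)
    (hγ : ∀ k, 0 < γ k) (hb : ∀ k, γ k = lam (idx k) - b k) {c₀ : ℝ} (hc₀ : 0 < c₀)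
    (hrb : ∀ k, c₀ ≤ |r (b k)|) (hr0 : r 0 = 1)
    (hsum : ∀ j : ℤ, Summable fun k => |γ k / (j - lam (idx k))|)
    (hoff : ∀ i, ∑' k, (if k = i then 0 else |γ k / (b i - lam (idx k))|) ≤ 1 / 2)
    (hzero : ∑' k, |γ k / (((0 : ℤ) : ℝ) - lam (idx k))| ≤ 1 / 8)
    (v : L2) (hv : ∀ j : ℤ, inner ℂ (altBasis j) v =
      ((r j * (1 + ∑' k, γ k / (j - lam (idx k))) : ℝ) : ℂ))
    (u : ℤ → L2)
    (hu : ∀ m j : ℤ, inner ℂ (altBasis j) (u m) = ((r j / (j - lam m) : ℝ) : ℂ)) :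
    v ∉ (Submodule.span ℂ (Set.range fun k => u (idx k))).topologicalClosure := by
  intro hmem
  -- An error below `c₀` is used at the points `b i`, where `|r| ≥ c₀`; an error of at most `1 / 4`
  -- is used at 0, where `r = 1`.
  set η : ℝ := min c₀ (1 / 4) with hη
  have hη0 : 0 < η := lt_min hc₀ (by norm_num)
  have hmem' : v ∈ closure
      ((Submodule.span ℂ (Set.range fun k => u (idx k)) : Submodule ℂ L2) : Set L2) := hmem
  obtain ⟨p, hp, hdist⟩ := Metric.mem_closure_iff.1 hmem' η hη0
  obtain ⟨c, rfl⟩ := Finsupp.mem_span_range_iff_exists_finsupp.1 hp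
  -- With these `y` the approximation error has the same form as `v`, each `γ k` being multiplied by
  -- `y k`. All but finitely many `y k` are 1, so `y` is bounded.
  set y : ℕ → ℂ := fun k => 1 - c k / γ k with hy
  have hγ' : ∀ k, (γ k : ℂ) ≠ 0 := fun k => Complex.ofReal_ne_zero.2 (hγ k).ne'
  have hsumC : ∀ j : ℤ, Summable fun k => ((γ k / (j - lam (idx k)) : ℝ) : ℂ) := fun j =>
    Complex.ofRealCLM.summable (hsum j).of_abs
  have hcfin : ∀ j : ℤ, ∀ k ∉ c.support, c k * (((1 / (j - lam (idx k)) : ℝ)) : ℂ) = 0 := by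
    intro j k hk
    rw [Finsupp.notMem_support_iff.1 hk, zero_mul]
  have hcoef : ∀ j : ℤ, inner ℂ (altBasis j) (v - c.sum fun i a => a • u (idx i)) =
      (r j : ℂ) * (1 + ∑' k, y k * ((γ k / (j - lam (idx k)) : ℝ) : ℂ)) := by
    intro j
    have hsplit : ∀ k, y k * ((γ k / (j - lam (idx k)) : ℝ) : ℂ) =
        ((γ k / (j - lam (idx k)) : ℝ) : ℂ) - c k * (((1 / (j - lam (idx k)) : ℝ)) : ℂ) := by
      intro k
      simp only [hy]
      push_cast
      have := hγ' k
      field_simp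
    simp only [hsplit]
    rw [(hsumC j).tsum_sub (summable_of_ne_finset_zero (hcfin j)),
      tsum_eq_sum (hcfin j), inner_sub_right, hv, Finsupp.sum, inner_sum]
    push_cast
    simp only [inner_smul_right, hu]
    have : ∀ k, c k * (((r j / (j - lam (idx k)) : ℝ)) : ℂ) =
        (r j : ℂ) * (c k * (1 / ((j : ℂ) - lam (idx k)))) := by
      intro k
      push_cast
      ring
    simp only [this]
    rw [← Finset.mul_sum]
    ring
  have hbound : ∀ j : ℤ, ‖(r j : ℂ) * (1 + ∑' k, y k * ((γ k / (j - lam (idx k)) : ℝ) : ℂ))‖ ≤ η := by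
    intro j
    rw [← hcoef j]
    refine (norm_inner_le_norm _ _).trans ?_
    rw [altBasis.orthonormal.1 j, one_mul, ← dist_eq_norm]
    exact hdist.le
  have hybdd : BddAbove (Set.range fun k => ‖y k‖) := by
    refine ⟨1 + ∑ k ∈ c.support, ‖c k / γ k‖, ?_⟩
    rintro _ ⟨k, rfl⟩
    refine (norm_sub_le _ _).trans ?_
    rw [norm_one]
    gcongr
    by_cases hk : k ∈ c.support
    · exact Finset.single_le_sum (f := fun k => ‖c k / (γ k : ℂ)‖)
        (fun i _ => norm_nonneg _) hk
    · rw [Finsupp.notMem_support_iff.1 hk, zero_div, norm_zero]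
      exact Finset.sum_nonneg fun i _ => norm_nonneg _
  set Y : ℝ := ⨆ k, ‖y k‖ with hY
  have hyY : ∀ k, ‖y k‖ ≤ Y := fun k => le_ciSup hybdd k
  have hY0 : 0 ≤ Y := (norm_nonneg _).trans (hyY 0)
  have hterm : ∀ j : ℤ, ∀ k, ‖y k * ((γ k / (j - lam (idx k)) : ℝ) : ℂ)‖ ≤
      Y * |γ k / (j - lam (idx k))| := by
    intro j k
    rw [norm_mul, Complex.norm_real, Real.norm_eq_abs]
    exact mul_le_mul_of_nonneg_right (hyY k) (abs_nonneg _)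
  have hsumy : ∀ j : ℤ, Summable fun k => y k * ((γ k / (j - lam (idx k)) : ℝ) : ℂ) := fun j =>
    Summable.of_norm_bounded ((hsum j).mul_left Y) (hterm j)
  -- At `b i` the `i`-th term is exactly `-y i` and the others add up to at most `Y / 2`, so `|y i|
  -- ≤ 1 + 1 + Y / 2`.
  have hYle : Y ≤ 4 := by
    have hstep : ∀ i, ‖y i‖ ≤ 2 + Y / 2 := by
      intro i
      have h1 : ‖1 + ∑' k, y k * ((γ k / (b i - lam (idx k)) : ℝ) : ℂ)‖ ≤ 1 := by
        have h := hbound (b i)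
        rw [norm_mul, Complex.norm_real, Real.norm_eq_abs] at h
        have h2 : c₀ * ‖1 + ∑' k, y k * ((γ k / (b i - lam (idx k)) : ℝ) : ℂ)‖ ≤ c₀ * 1 := by
          rw [mul_one]
          exact (mul_le_mul_of_nonneg_right (hrb i) (norm_nonneg _)).trans
            (h.trans (min_le_left _ _))
        exact le_of_mul_le_mul_left h2 hc₀
      rw [(hsumy (b i)).tsum_eq_add_tsum_ite i] at h1
      have hdiag : y i * ((γ i / (b i - lam (idx i)) : ℝ) : ℂ) = -y i := by
        have : γ i / (b i - lam (idx i)) = -1 := by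
          rw [div_eq_iff (by linarith [hb i, hγ i])]
          linarith [hb i]
        rw [this]
        simp
      rw [hdiag] at h1
      have h3 : ‖∑' k, (if k = i then 0 else y k * ((γ k / (b i - lam (idx k)) : ℝ) : ℂ))‖ ≤
          Y / 2 := by
        have hs : Summable fun k => Y * (if k = i then 0 else |γ k / (b i - lam (idx k))|) := by
          refine Summable.mul_left Y ((hsum (b i)).of_nonneg_of_le ?_ ?_)
          · intro k; split_ifs <;> positivity
          · intro k; split_ifs
            exacts [abs_nonneg _, le_rfl]
        refine (tsum_of_norm_bounded hs.hasSum fun k => ?_).trans ?_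
        · split_ifs
          · simp
          · exact hterm (b i) k
        · rw [tsum_mul_left]
          nlinarith [hoff i]
      have h4 : y i = 1 + (∑' k, (if k = i then 0 else
          y k * ((γ k / (b i - lam (idx k)) : ℝ) : ℂ))) - (1 + (-y i + ∑' k,
          (if k = i then 0 else y k * ((γ k / (b i - lam (idx k)) : ℝ) : ℂ)))) := by ring
      rw [h4]
      refine (norm_sub_le _ _).trans ?_
      have h5 := norm_add_le (1 : ℂ) (∑' k, (if k = i then 0 else
          y k * ((γ k / (b i - lam (idx k)) : ℝ) : ℂ)))
      rw [norm_one] at h5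
      linarith
    have := ciSup_le hstep
    linarith
  -- At 0 the sum is at most `4 * (1 / 8)`, which leaves an error of at least `1 / 2 > η`.
  have h0 := hbound 0
  rw [hr0, Complex.ofReal_one, one_mul] at h0
  have h1 : ‖∑' k, y k * ((γ k / (((0 : ℤ) : ℝ) - lam (idx k)) : ℝ) : ℂ)‖ ≤ 1 / 2 := by
    refine (tsum_of_norm_bounded ((hsum 0).mul_left Y).hasSum (hterm 0)).trans ?_
    rw [tsum_mul_left]
    have : 0 ≤ ∑' k, |γ k / (((0 : ℤ) : ℝ) - lam (idx k))| := tsum_nonneg fun k => abs_nonneg _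
    nlinarith
  have h2 := norm_sub_le (1 + ∑' k, y k * ((γ k / (((0 : ℤ) : ℝ) - lam (idx k)) : ℝ) : ℂ))
    (∑' k, y k * ((γ k / (((0 : ℤ) : ℝ) - lam (idx k)) : ℝ) : ℂ))
  rw [add_sub_cancel_right, norm_one] at h2
  have h3 : η ≤ 1 / 4 := min_le_right _ _
  linarith

end SpectralSynthesis

/-! ### Partial fractions of the truncated quotient and their limits. -/

namespace SpectralSynthesis

open Filter Topology

section PartialFractions

variable {F ι κ : Type*} [Field F] [DecidableEq ι]

/-- Partial fractions, since the numerator has lower degree and so equals its Lagrange interpolation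
at the poles. The poles are the integers in the residue identities and the frequencies in the
completeness proof. -/
theorem sum_nodalWeight_prod_eq {s : Finset ι} {v : ι → F} (hvs : Set.InjOn v s) (t : Finset κ)
    (a : κ → F) (ht : t.card < s.card) {z : F} (hz : ∀ i ∈ s, z ≠ v i) :
    ∑ j ∈ s, (∏ n ∈ t, (v j - a n)) * (∏ i ∈ s.erase j, (v j - v i)⁻¹) * (z - v j)⁻¹ =
      (∏ n ∈ t, (z - a n)) * (∏ i ∈ s, (z - v i))⁻¹ := by
  have hdeg : (Lagrange.nodal t a).degree < s.card := by
    rw [Lagrange.degree_nodal]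
    exact_mod_cast ht
  have h := Lagrange.eval_interpolate_not_at_node
    (fun j => (Lagrange.nodal t a).eval (v j)) hz
  rw [← Lagrange.eq_interpolate hvs hdeg, Lagrange.eval_nodal, Lagrange.eval_nodal] at h
  have hne : ∏ i ∈ s, (z - v i) ≠ 0 := Finset.prod_ne_zero_iff.2 fun i hi => sub_ne_zero.2 (hz i hi)
  rw [h, mul_comm (∏ i ∈ s, (z - v i)), mul_assoc, mul_inv_cancel₀ hne, mul_one]
  refine Finset.sum_congr rfl fun j _ => ?_
  rw [Lagrange.eval_nodal, Lagrange.nodalWeight]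
  ring

/-- Comparison of the top coefficients of a monic polynomial and its interpolation: the coefficient
of `1 / z` at infinity. -/
theorem sum_nodalWeight_prod_eq_one {s : Finset ι} {v : ι → F} (hvs : Set.InjOn v s)
    (t : Finset κ) (a : κ → F) (ht : t.card + 1 = s.card) :
    ∑ j ∈ s, (∏ n ∈ t, (v j - a n)) * (∏ i ∈ s.erase j, (v j - v i)⁻¹) = 1 := by
  have hdeg : (Lagrange.nodal t a).degree < s.card := by
    rw [Lagrange.degree_nodal]
    exact_mod_cast (by omega : t.card < s.card)
  have h := Lagrange.coeff_eq_sum hvs hdeg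
  have h1 : (Lagrange.nodal t a).coeff (s.card - 1) = 1 := by
    have := (Lagrange.nodal_monic (s := t) (v := a)).coeff_natDegree
    rwa [Lagrange.natDegree_nodal, (by omega : t.card = s.card - 1)] at this
  rw [h1] at h
  rw [h]
  refine Finset.sum_congr rfl fun j _ => ?_
  rw [Lagrange.eval_nodal, div_eq_mul_inv, Finset.prod_inv_distrib]

end PartialFractions

/-- The integers of modulus at most `N`. -/
noncomputable def win (N : ℕ) : Finset ℤ := Finset.Icc (-(N : ℤ)) N

theorem mem_win {N : ℕ} {n : ℤ} : n ∈ win N ↔ |n| ≤ N := by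
  rw [win, Finset.mem_Icc, abs_le]

theorem zero_mem_win (N : ℕ) : (0 : ℤ) ∈ win N := by
  rw [mem_win]; simp

noncomputable section

/-- The leading coefficient of the rational function `∏ (1 - z / lam n) / (z ∏ (1 - z / n))`. -/
def leadCoeff (lam : ℤ → ℝ) (N : ℕ) : ℝ :=
  (-1 / lam 0) * ∏ n ∈ (win N).erase 0, ((n : ℝ) / lam n)

/-- The residue at `j` of the rational function `∏ (1 - z / lam n) / (z ∏ (1 - z / n))`. -/
def res (lam : ℤ → ℝ) (N : ℕ) (j : ℤ) : ℝ :=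
  leadCoeff lam N * (∏ n ∈ win N, ((j : ℝ) - lam n)) * ∏ n ∈ (win N).erase j, ((j : ℝ) - n)⁻¹

end

variable {lam : ℤ → ℝ}

theorem res_div (hlam : ∀ n j : ℤ, lam n ≠ j) {N : ℕ} {m : ℤ} (hm : m ∈ win N) (j : ℤ) :
    res lam N j / (j - lam m) = leadCoeff lam N *
      ((∏ n ∈ (win N).erase m, ((j : ℝ) - lam n)) * ∏ n ∈ (win N).erase j, ((j : ℝ) - n)⁻¹) := by
  rw [res, ← Finset.mul_prod_erase _ _ hm]
  have : (j : ℝ) - lam m ≠ 0 := sub_ne_zero.2 (hlam m j).symm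
  field_simp

/-- The truncated quotient tends to `leadCoeff` at infinity, so after division by `z - lam m` its
residues add up to `leadCoeff`. -/
theorem sum_res_div_eq_leadCoeff (hlam : ∀ n j : ℤ, lam n ≠ j) {N : ℕ} {m : ℤ} (hm : m ∈ win N) :
    ∑ j ∈ win N, res lam N j / (j - lam m) = leadCoeff lam N := by
  simp only [res_div hlam hm]
  rw [← Finset.mul_sum, sum_nodalWeight_prod_eq_one (v := fun j : ℤ => (j : ℝ))
    (Int.cast_injective.injOn), mul_one]
  rw [Finset.card_erase_of_mem hm]
  have := Finset.card_pos.2 ⟨m, hm⟩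
  omega

theorem sum_res_div_sub (hlam : ∀ n j : ℤ, lam n ≠ j) {N : ℕ} {m : ℤ} (hm : m ∈ win N) {z : ℂ}
    (hz : ∀ j : ℤ, z ≠ j) :
    ∑ j ∈ win N, ((res lam N j / (j - lam m) : ℝ) : ℂ) / (z - j) = leadCoeff lam N *
      ((∏ n ∈ (win N).erase m, (z - lam n)) * (∏ n ∈ win N, (z - n))⁻¹) := by
  rw [← sum_nodalWeight_prod_eq (v := fun j : ℤ => (j : ℂ)) (Int.cast_injective.injOn)
    ((win N).erase m) (fun n => (lam n : ℂ)) (Finset.card_erase_lt_of_mem hm) (fun i _ => hz i),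
    Finset.mul_sum]
  refine Finset.sum_congr rfl fun j _ => ?_
  rw [res_div hlam hm]
  push_cast
  rw [div_eq_mul_inv]
  ring

theorem sum_res_div_sub_eq_zero (hlam : ∀ n j : ℤ, lam n ≠ j) {N : ℕ} {m n : ℤ} (hm : m ∈ win N)
    (hn : n ∈ win N) (hnm : n ≠ m) :
    ∑ j ∈ win N, res lam N j / (j - lam m) / (lam n - j) = 0 := by
  have hz : ∀ j : ℤ, (lam n : ℂ) ≠ j := fun j => by exact_mod_cast hlam n j
  have h := sum_res_div_sub hlam hm hz
  have h0 : ∏ k ∈ (win N).erase m, ((lam n : ℂ) - lam k) = 0 :=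
    Finset.prod_eq_zero (Finset.mem_erase.2 ⟨hnm, hn⟩) (sub_self _)
  rw [h0, zero_mul, mul_zero] at h
  exact_mod_cast h

theorem abs_int_add_one_le_mul (lam : ℝ) (h : ∀ j : ℤ, lam ≠ j) :
    ∃ C > 0, ∀ j : ℤ, |(j : ℝ)| + 1 ≤ C * |(j : ℝ) - lam| := by
  obtain ⟨d, hd, hdist⟩ : ∃ d > 0, ∀ j : ℤ, d ≤ |(j : ℝ) - lam| := by
    refine ⟨min (Int.fract lam) (1 - Int.fract lam), lt_min ?_ ?_, fun j => ?_⟩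
    · refine lt_of_le_of_ne (Int.fract_nonneg _) fun e => ?_
      refine h ⌊lam⌋ ?_
      have := Int.floor_add_fract lam
      rw [← e, add_zero] at this
      exact this.symm
    · linarith [Int.fract_lt_one lam]
    · have h1 := Int.floor_add_fract lam
      rcases le_or_gt j ⌊lam⌋ with hj | hj
      · have h2 : (j : ℝ) ≤ ⌊lam⌋ := by exact_mod_cast hj
        refine (min_le_left _ _).trans ?_
        rw [abs_sub_comm]
        exact le_trans (by linarith) (le_abs_self _)
      · have h2 : (⌊lam⌋ : ℝ) + 1 ≤ j := by exact_mod_cast hj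
        refine (min_le_right _ _).trans ?_
        exact le_trans (by linarith) (le_abs_self _)
  refine ⟨1 + (|lam| + 1) / d, by positivity, fun j => ?_⟩
  have h1 : |(j : ℝ)| ≤ |(j : ℝ) - lam| + |lam| := by
    have := abs_add_le ((j : ℝ) - lam) lam
    rwa [sub_add_cancel] at this
  have h2 : |lam| + 1 ≤ (|lam| + 1) / d * |(j : ℝ) - lam| := by
    rw [div_mul_eq_mul_div, le_div_iff₀ hd]
    exact mul_le_mul_of_nonneg_left (hdist j) (by positivity)
  linarith

theorem inv_sub_le (lam : ℝ) (h : ∀ j : ℤ, lam ≠ j) :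
    ∃ C > 0, ∀ j : ℤ, |(j : ℝ) - lam|⁻¹ ≤ C * (|(j : ℝ)| + 1)⁻¹ := by
  obtain ⟨C, hC, hj⟩ := abs_int_add_one_le_mul lam h
  refine ⟨C, hC, fun j => ?_⟩
  have h0 : 0 < |(j : ℝ) - lam| := abs_pos.2 (sub_ne_zero.2 (h j).symm)
  rw [inv_le_iff_one_le_mul₀ h0, ← div_eq_mul_inv, div_mul_eq_mul_div,
    one_le_div (by positivity)]
  exact hj j

section Limits

variable {r W : ℤ → ℝ} {N : ℕ → ℕ}

theorem eventually_mem_win (hN : Tendsto N atTop atTop) (j : ℤ) : ∀ᶠ K in atTop, j ∈ win (N K) := by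
  filter_upwards [hN.eventually_ge_atTop j.natAbs] with K hK
  rw [mem_win, Int.abs_eq_natAbs]
  exact_mod_cast hK

/-- Passage to the limit in a sum over `win (N K)` of the residues against a weight of size
`O(1 / (|j| + 1))`. -/
theorem tendsto_sum_res (hN : Tendsto N atTop atTop)
    (hres : ∀ j, Tendsto (fun K => res lam (N K) j) atTop (𝓝 (r j)))
    (hW : ∀ K, ∀ j ∈ win (N K), |res lam (N K) j| ≤ W j)
    (hWs : Summable fun j : ℤ => W j * (|(j : ℝ)| + 1)⁻¹) (f : ℤ → ℂ) {C : ℝ}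
    (hf : ∀ j, ‖f j‖ ≤ C * (|(j : ℝ)| + 1)⁻¹) :
    Tendsto (fun K => ∑ j ∈ win (N K), (res lam (N K) j : ℂ) * f j) atTop
      (𝓝 (∑' j, (r j : ℂ) * f j)) := by
  have hW0 : ∀ j, 0 ≤ W j := fun j => by
    obtain ⟨K, hK⟩ := (eventually_mem_win hN j).exists
    exact (abs_nonneg _).trans (hW K j hK)
  have hC : 0 ≤ C := by
    have := (norm_nonneg _).trans (hf 0)
    simpa using this
  have h1 : ∀ K, ∑ j ∈ win (N K), (res lam (N K) j : ℂ) * f j =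
      ∑' j, if j ∈ win (N K) then (res lam (N K) j : ℂ) * f j else 0 := by
    intro K
    rw [tsum_eq_sum (s := win (N K)) fun j hj => if_neg hj]
    exact Finset.sum_congr rfl fun j hj => (if_pos hj).symm
  simp only [h1]
  refine tendsto_tsum_of_dominated_convergence
    (bound := fun j : ℤ => C * (W j * (|(j : ℝ)| + 1)⁻¹)) (hWs.mul_left C) ?_ ?_
  · intro j
    refine (((Complex.continuous_ofReal.tendsto _).comp (hres j)).mul_const (f j)).congr' ?_
    filter_upwards [eventually_mem_win hN j] with K hK
    simp [hK]
  · refine Eventually.of_forall fun K j => ?_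
    split_ifs with hj
    · rw [norm_mul, Complex.norm_real, Real.norm_eq_abs]
      calc _ ≤ W j * (C * (|(j : ℝ)| + 1)⁻¹) :=
            mul_le_mul (hW K j hj) (hf j) (norm_nonneg _) (hW0 j)
        _ = _ := by ring
    · rw [norm_zero]
      have := hW0 j
      positivity

theorem tsum_res_orth (hlam : ∀ n j : ℤ, lam n ≠ j) (hN : Tendsto N atTop atTop)
    (hres : ∀ j, Tendsto (fun K => res lam (N K) j) atTop (𝓝 (r j)))
    (hW : ∀ K, ∀ j ∈ win (N K), |res lam (N K) j| ≤ W j)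
    (hWs : Summable fun j : ℤ => W j * (|(j : ℝ)| + 1)⁻¹) (m n : ℤ) (hnm : n ≠ m) :
    ∑' j : ℤ, r j / (j - lam m) / (lam n - j) = 0 := by
  obtain ⟨C, hC, hCm⟩ := inv_sub_le (lam m) (hlam m)
  obtain ⟨C', hC', hCn⟩ := inv_sub_le (lam n) (hlam n)
  have h := tendsto_sum_res hN hres hW hWs
    (fun j => (((j - lam m)⁻¹ * (lam n - j)⁻¹ : ℝ) : ℂ)) (C := C * C') ?_
  · have h0 : Tendsto (fun K => ∑ j ∈ win (N K), (res lam (N K) j : ℂ) *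
        (((j - lam m)⁻¹ * (lam n - j)⁻¹ : ℝ) : ℂ)) atTop (𝓝 0) := by
      refine tendsto_const_nhds.congr' ?_
      filter_upwards [eventually_mem_win hN m, eventually_mem_win hN n] with K hm hn
      have := sum_res_div_sub_eq_zero hlam hm hn hnm
      rw [← Complex.ofReal_zero, ← this]
      push_cast
      refine Finset.sum_congr rfl fun j _ => ?_
      rw [div_eq_mul_inv, div_eq_mul_inv, mul_assoc]
    have h1 := tendsto_nhds_unique h h0
    rw [← Complex.ofReal_inj, Complex.ofReal_tsum, Complex.ofReal_zero, ← h1]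
    refine tsum_congr fun j => ?_
    push_cast
    rw [div_eq_mul_inv, div_eq_mul_inv, mul_assoc]
  · intro j
    rw [Complex.norm_real, Real.norm_eq_abs, abs_mul, abs_inv, abs_inv, abs_sub_comm (lam n)]
    calc _ ≤ (C * (|(j : ℝ)| + 1)⁻¹) * (C' * (|(j : ℝ)| + 1)⁻¹) :=
          mul_le_mul (hCm j) (hCn j) (by positivity) (by positivity)
      _ ≤ (C * (|(j : ℝ)| + 1)⁻¹) * (C' * 1) := by
          gcongr
          exact inv_le_one_of_one_le₀ (by linarith [abs_nonneg (j : ℝ)])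
      _ = _ := by ring

/-- The sum is the limit of the leading coefficients. Its vanishing makes `r` itself formally
orthogonal to all exponentials, and gives the decay of `G` relative to the sine on the imaginary
axis. -/
theorem tsum_res_div (hlam : ∀ n j : ℤ, lam n ≠ j) (hN : Tendsto N atTop atTop)
    (hres : ∀ j, Tendsto (fun K => res lam (N K) j) atTop (𝓝 (r j)))
    (hW : ∀ K, ∀ j ∈ win (N K), |res lam (N K) j| ≤ W j)
    (hWs : Summable fun j : ℤ => W j * (|(j : ℝ)| + 1)⁻¹)
    (hc : Tendsto (fun K => leadCoeff lam (N K)) atTop (𝓝 0)) (m : ℤ) :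
    ∑' j : ℤ, r j / (j - lam m) = 0 := by
  obtain ⟨C, hC, hCm⟩ := inv_sub_le (lam m) (hlam m)
  have h := tendsto_sum_res hN hres hW hWs (fun j => (((j - lam m)⁻¹ : ℝ) : ℂ)) (C := C) ?_
  · have h0 : Tendsto (fun K => ∑ j ∈ win (N K), (res lam (N K) j : ℂ) *
        (((j - lam m)⁻¹ : ℝ) : ℂ)) atTop (𝓝 ((0 : ℝ) : ℂ)) := by
      refine ((Complex.continuous_ofReal.tendsto _).comp hc).congr' ?_
      filter_upwards [eventually_mem_win hN m] with K hm
      rw [Function.comp_apply, ← sum_res_div_eq_leadCoeff hlam hm]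
      push_cast
      simp only [div_eq_mul_inv]
    have h1 := tendsto_nhds_unique h h0
    rw [← Complex.ofReal_inj, Complex.ofReal_tsum, ← h1]
    refine tsum_congr fun j => ?_
    push_cast
    rw [div_eq_mul_inv]
  · intro j
    rw [Complex.norm_real, Real.norm_eq_abs, abs_inv]
    exact hCm j

end Limits

end SpectralSynthesis

/-! ### Completeness by divided differences. -/

namespace SpectralSynthesis

open Filter Topology

variable {lam : ℤ → ℝ}

theorem summable_inv_abs_add_one_sq : Summable fun j : ℤ => ((|(j : ℝ)| + 1)⁻¹) ^ 2 := by
  have h : Summable fun j : ℤ => 1 / (j : ℝ) ^ 2 := Real.summable_one_div_int_pow.2 (by norm_num)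
  refine Summable.of_norm_bounded_eventually h ?_
  rw [eventually_cofinite]
  refine (Set.finite_singleton (0 : ℤ)).subset fun j hj => ?_
  by_contra hj0
  refine hj ?_
  have hj0' : (j : ℝ) ≠ 0 := by exact_mod_cast hj0
  rw [Real.norm_of_nonneg (by positivity), inv_pow, ← one_div]
  refine one_div_le_one_div_of_le (by positivity) ?_
  rw [← sq_abs (j : ℝ)]
  gcongr
  linarith

theorem summable_div_sub (hlam : ∀ n j : ℤ, lam n ≠ j) {x : ℤ → ℂ}
    (hx : Summable fun j => ‖x j‖ ^ 2) (m : ℤ) : Summable fun j : ℤ => x j * ((j : ℂ) - lam m)⁻¹ := by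
  obtain ⟨C, hC, hCm⟩ := inv_sub_le (lam m) (hlam m)
  refine Summable.of_norm_bounded
    (hx.add ((summable_inv_abs_add_one_sq).mul_left (C ^ 2))) fun j => ?_
  rw [norm_mul, norm_inv]
  have h1 : ‖(j : ℂ) - lam m‖ = |(j : ℝ) - lam m| := by
    rw [← Real.norm_eq_abs, ← Complex.norm_real]; push_cast; rfl
  rw [h1]
  have h2 := hCm j
  have h3 : 0 ≤ |(j : ℝ) - lam m|⁻¹ := by positivity
  have h4 := norm_nonneg (x j)
  have h5 : (|(j : ℝ) - lam m|⁻¹) ^ 2 ≤ (C * (|(j : ℝ)| + 1)⁻¹) ^ 2 := by gcongr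
  rw [mul_pow] at h5
  nlinarith [sq_nonneg (‖x j‖ - |(j : ℝ) - lam m|⁻¹)]

/-- Factor by factor: `|n| ≤ |n - f| + |f|` and `|n - f| ≥ 1` for `n ≠ f`; for `n = f` the inverse
is 0. -/
theorem abs_pow_mul_prod_le (F : Finset ℤ) (n : ℤ) :
    |(n : ℝ)| ^ F.card * ∏ f ∈ F, |(n : ℝ) - f|⁻¹ ≤ ∏ f ∈ F, (1 + |(f : ℝ)|) := by
  rw [← Finset.prod_const, ← Finset.prod_mul_distrib]
  refine Finset.prod_le_prod (fun f _ => by positivity) fun f _ => ?_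
  by_cases hnf : n = f
  · subst hnf
    simp
    positivity
  · have h1 : (1 : ℝ) ≤ |(n : ℝ) - f| := by
      exact_mod_cast Int.one_le_abs (sub_ne_zero.2 hnf)
    rw [← div_eq_mul_inv, div_le_iff₀ (by linarith)]
    have h2 : |(n : ℝ)| ≤ |(n : ℝ) - f| + |(f : ℝ)| := by
      have := abs_add_le ((n : ℝ) - f) f
      rwa [sub_add_cancel] at this
    nlinarith [abs_nonneg (f : ℝ)]

/-- A square summable sequence whose Cauchy transform vanishes on `lam` is `r` times a polynomial:
the divided differences of `x / r` vanish. -/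
theorem dividedDifference_eq_zero (hlam : ∀ n j : ℤ, lam n ≠ j) (hinj : Function.Injective lam)
    {r : ℤ → ℝ} {N : ℕ → ℕ} (hN : Tendsto N atTop atTop)
    (hres : ∀ j, Tendsto (fun K => res lam (N K) j) atTop (𝓝 (r j))) (hr : ∀ j, r j ≠ 0)
    {B : ℝ} {q : ℕ}
    (hB : ∀ K, ∀ n ∉ win (N K), |(leadCoeff lam (N K))⁻¹| *
      ∏ i ∈ win (N K), (|(n : ℝ) - i| / |(n : ℝ) - lam i|) ≤ B * |(n : ℝ)| ^ q)
    {x : ℤ → ℂ} (hx : Summable fun j => ‖x j‖ ^ 2)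
    (hx0 : ∀ m : ℤ, ∑' j : ℤ, x j / (lam m - j) = 0)
    (F : Finset ℤ) (hF : F.card = q + 2) :
    ∑ f ∈ F, x f * (((r f)⁻¹ * ∏ g ∈ F.erase f, ((f : ℝ) - g)⁻¹ : ℝ) : ℂ) = 0 := by
  -- The reciprocal of the truncated quotient, with its zeros in `F` removed. It is a combination of
  -- the functions `1 / (n - lam m)`, so it is annihilated by `x`; it vanishes on the window off
  -- `F`, and on `F` it yields the weights of the divided difference of `x / r`.
  set V : ℕ → ℤ → ℝ := fun K n => (leadCoeff lam (N K))⁻¹ *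
    ((∏ i ∈ win (N K) \ F, ((n : ℝ) - i)) * (∏ i ∈ win (N K), ((n : ℝ) - lam i))⁻¹) with hV
  have hFne : F.Nonempty := Finset.card_pos.1 (by omega)
  have hFwin : ∀ᶠ K in atTop, F ⊆ win (N K) := by
    have : ∀ᶠ K in atTop, ∀ f ∈ F, f ∈ win (N K) :=
      (Filter.eventually_all_finset F).2 fun f _ => eventually_mem_win hN f
    exact this
  have hsum0 : ∀ m : ℤ, ∑' n : ℤ, x n * ((n : ℂ) - lam m)⁻¹ = 0 := by
    intro m
    have h := hx0 m
    rw [← neg_eq_zero, ← tsum_neg, ← h]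
    refine tsum_congr fun n => ?_
    rw [div_eq_mul_inv, ← mul_neg, ← inv_neg, neg_sub]
  have hexp : ∀ K, F ⊆ win (N K) → ∃ ω : ℤ → ℝ, ∀ n : ℤ,
      V K n = ∑ m ∈ win (N K), ω m * ((n : ℝ) - lam m)⁻¹ := by
    intro K hK
    have hcard : (win (N K) \ F).card < (win (N K)).card :=
      Finset.card_lt_card (Finset.sdiff_ssubset hK hFne)
    refine ⟨fun m => (leadCoeff lam (N K))⁻¹ * ((∏ i ∈ win (N K) \ F, (lam m - i)) *
      ∏ i ∈ (win (N K)).erase m, (lam m - lam i)⁻¹), fun n => ?_⟩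
    simp only [hV]
    rw [← sum_nodalWeight_prod_eq (v := lam) hinj.injOn (win (N K) \ F) (fun i : ℤ => (i : ℝ))
      hcard (fun i _ => (hlam i n).symm), Finset.mul_sum]
    refine Finset.sum_congr rfl fun m _ => ?_
    ring
  have hVsum : ∀ K, F ⊆ win (N K) → HasSum (fun n => x n * (V K n : ℂ)) 0 := by
    intro K hK
    obtain ⟨ω, hω⟩ := hexp K hK
    have h1 : ∀ n, x n * (V K n : ℂ) =
        ∑ m ∈ win (N K), (ω m : ℂ) * (x n * ((n : ℂ) - lam m)⁻¹) := by
      intro n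
      rw [hω n]
      push_cast
      rw [Finset.mul_sum]
      refine Finset.sum_congr rfl fun m _ => ?_
      ring
    simp only [h1]
    have h2 : (0 : ℂ) = ∑ m ∈ win (N K), (ω m : ℂ) * 0 := by simp
    rw [h2]
    refine hasSum_sum fun m _ => HasSum.mul_left _ ?_
    rw [← hsum0 m]
    exact (summable_div_sub hlam hx m).hasSum
  have hVF : ∀ K, F ⊆ win (N K) → ∀ f ∈ F,
      V K f = (res lam (N K) f)⁻¹ * ∏ g ∈ F.erase f, ((f : ℝ) - g)⁻¹ := by
    intro K hK f hf
    have hsplit : (win (N K)).erase f = (win (N K) \ F) ∪ F.erase f := by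
      ext i
      simp only [Finset.mem_erase, Finset.mem_union, Finset.mem_sdiff]
      constructor
      · rintro ⟨h1, h2⟩
        by_cases h3 : i ∈ F
        · exact Or.inr ⟨h1, h3⟩
        · exact Or.inl ⟨h2, h3⟩
      · rintro (⟨h1, h2⟩ | ⟨h1, h2⟩)
        · exact ⟨fun e => h2 (e ▸ hf), h1⟩
        · exact ⟨h1, hK h2⟩
    have hdisj : Disjoint (win (N K) \ F) (F.erase f) := by
      rw [Finset.disjoint_left]
      intro i hi hi'
      exact (Finset.mem_sdiff.1 hi).2 (Finset.mem_of_mem_erase hi')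
    simp only [hV]
    rw [res, hsplit, Finset.prod_union hdisj, mul_inv, mul_inv, mul_inv]
    simp only [Finset.prod_inv_distrib, inv_inv]
    have hne : ∏ g ∈ F.erase f, ((f : ℝ) - g) ≠ 0 :=
      Finset.prod_ne_zero_iff.2 fun g hg => sub_ne_zero.2 <| by
        exact_mod_cast (Finset.mem_erase.1 hg).1.symm
    field_simp
  have hVzero : ∀ K, ∀ n ∈ win (N K), n ∉ F → V K n = 0 := by
    intro K n hn hnF
    simp only [hV]
    have h0 : ∏ i ∈ win (N K) \ F, ((n : ℝ) - i) = 0 :=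
      Finset.prod_eq_zero (Finset.mem_sdiff.2 ⟨hn, hnF⟩) (sub_self _)
    rw [h0, zero_mul, mul_zero]
  -- Removing `q + 2` factors turns the growth `|n| ^ q` into the decay `|n| ^ (-2)`.
  have hVout : ∀ K, F ⊆ win (N K) → ∀ n ∉ win (N K),
      |V K n| ≤ B * (∏ f ∈ F, (1 + |(f : ℝ)|)) * ((|(n : ℝ)|)⁻¹) ^ 2 := by
    intro K hK n hn
    have hn0 : n ≠ 0 := fun e => hn (e ▸ zero_mem_win _)
    have hn1 : 0 < |(n : ℝ)| := abs_pos.2 (by exact_mod_cast hn0)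
    have h1 : |V K n| = (|(leadCoeff lam (N K))⁻¹| *
        ∏ i ∈ win (N K), (|(n : ℝ) - i| / |(n : ℝ) - lam i|)) * ∏ f ∈ F, |(n : ℝ) - f|⁻¹ := by
      have hsd : ∏ i ∈ win (N K), |(n : ℝ) - i| =
          (∏ i ∈ win (N K) \ F, |(n : ℝ) - i|) * ∏ i ∈ F, |(n : ℝ) - i| :=
        (Finset.prod_sdiff hK).symm
      simp only [hV]
      rw [abs_mul, abs_mul, abs_inv (∏ i ∈ win (N K), ((n : ℝ) - lam i)), Finset.abs_prod,
        Finset.abs_prod, Finset.prod_div_distrib, hsd, Finset.prod_inv_distrib]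
      have hne : ∏ f ∈ F, |(n : ℝ) - f| ≠ 0 :=
        Finset.prod_ne_zero_iff.2 fun f hf => abs_ne_zero.2 <| sub_ne_zero.2 <| by
          intro e
          have : n = f := by exact_mod_cast e
          exact hn (this ▸ hK hf)
      field_simp
    rw [h1]
    have hprod0 : 0 ≤ ∏ f ∈ F, |(n : ℝ) - f|⁻¹ := Finset.prod_nonneg fun _ _ => by positivity
    have hB0 : 0 ≤ B := by
      have h2 := hB K n hn
      have h3 : 0 ≤ |(leadCoeff lam (N K))⁻¹| *
        ∏ i ∈ win (N K), (|(n : ℝ) - i| / |(n : ℝ) - lam i|) := by positivity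
      exact nonneg_of_mul_nonneg_left (h3.trans h2) (by positivity)
    refine (mul_le_mul_of_nonneg_right (hB K n hn) hprod0).trans ?_
    have h4 := abs_pow_mul_prod_le F n
    rw [hF] at h4
    have h5 : |(n : ℝ)| ^ q * ∏ f ∈ F, |(n : ℝ) - f|⁻¹ =
        (|(n : ℝ)| ^ (q + 2) * ∏ f ∈ F, |(n : ℝ) - f|⁻¹) * ((|(n : ℝ)|)⁻¹) ^ 2 := by
      rw [pow_add]
      field_simp
    rw [mul_assoc, h5, mul_assoc B]
    exact mul_le_mul_of_nonneg_left (mul_le_mul_of_nonneg_right h4 (by positivity)) hB0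
  set P : ℝ := B * ∏ f ∈ F, (1 + |(f : ℝ)|) with hP
  have hlim1 : Tendsto (fun K => ∑ f ∈ F, x f * (V K f : ℂ)) atTop
      (𝓝 (∑ f ∈ F, x f * (((r f)⁻¹ * ∏ g ∈ F.erase f, ((f : ℝ) - g)⁻¹ : ℝ) : ℂ))) := by
    refine tendsto_finsetSum _ fun f hf => Tendsto.const_mul _ ?_
    refine (Complex.continuous_ofReal.tendsto _).comp ?_
    refine (((hres f).inv₀ (hr f)).mul_const _).congr' ?_
    filter_upwards [hFwin] with K hK
    rw [hVF K hK f hf]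
  -- Dominated convergence: outside the window the terms are at most `‖x n‖ ^ 2 + P ^ 2 / n ^ 2`,
  -- uniformly in `K`.
  have hlim2 : Tendsto (fun K => ∑' n, if n ∈ win (N K) then 0 else x n * (V K n : ℂ)) atTop
      (𝓝 (∑' _ : ℤ, (0 : ℂ))) := by
    have hbs : Summable fun n : ℤ => ‖x n‖ ^ 2 + P ^ 2 * (1 / (n : ℝ) ^ 2) :=
      hx.add (Summable.mul_left _ (Real.summable_one_div_int_pow.2 (by norm_num)))
    refine tendsto_tsum_of_dominated_convergence hbs ?_ ?_
    · intro n
      refine tendsto_const_nhds.congr' ?_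
      filter_upwards [eventually_mem_win hN n] with K hK
      simp [hK]
    · filter_upwards [hFwin] with K hK n
      split_ifs with hn
      · rw [norm_zero]; positivity
      · rw [norm_mul, Complex.norm_real, Real.norm_eq_abs]
        have h1 := hVout K hK n hn
        have hn0 : n ≠ 0 := fun e => hn (e ▸ zero_mem_win _)
        have hn1 : 1 ≤ |(n : ℝ)| := by exact_mod_cast Int.one_le_abs hn0
        have h2 : (1 : ℝ) / (n : ℝ) ^ 2 = ((|(n : ℝ)|)⁻¹) ^ 2 := by
          rw [← sq_abs, inv_pow, one_div]
        have h3 : ((|(n : ℝ)|)⁻¹) ≤ 1 := inv_le_one_of_one_le₀ hn1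
        have h4 : 0 ≤ ((|(n : ℝ)|)⁻¹) := by positivity
        have h5 : |V K n| ^ 2 ≤ (P * ((|(n : ℝ)|)⁻¹)) ^ 2 := by
          refine pow_le_pow_left₀ (abs_nonneg _) (h1.trans ?_) 2
          have hP0 : 0 ≤ P * ((|(n : ℝ)|)⁻¹) ^ 2 := (abs_nonneg _).trans h1
          have hP1 : 0 ≤ P := nonneg_of_mul_nonneg_left hP0 (by positivity)
          exact mul_le_mul_of_nonneg_left (by nlinarith) hP1
        rw [h2]
        rw [mul_pow] at h5
        nlinarith [sq_nonneg (‖x n‖ - |V K n|), norm_nonneg (x n), abs_nonneg (V K n)]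
  rw [tsum_zero] at hlim2
  have hadd := hlim1.add hlim2
  have hzero : Tendsto (fun K => ∑ f ∈ F, x f * (V K f : ℂ) +
      ∑' n, if n ∈ win (N K) then 0 else x n * (V K n : ℂ)) atTop (𝓝 0) := by
    refine tendsto_const_nhds.congr' ?_
    filter_upwards [hFwin] with K hK
    have hs := hVsum K hK
    have h1 : Summable fun n => if n ∈ win (N K) then x n * (V K n : ℂ) else 0 :=
      summable_of_ne_finset_zero (s := win (N K)) fun n hn => if_neg hn
    have h2 : Summable fun n => if n ∈ win (N K) then 0 else x n * (V K n : ℂ) := by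
      refine (hs.summable.sub h1).congr fun n => ?_
      by_cases hn : n ∈ win (N K) <;> simp [hn]
    have h3 := h1.tsum_add h2
    have h4 : ∀ n, ((if n ∈ win (N K) then x n * (V K n : ℂ) else 0) +
        if n ∈ win (N K) then 0 else x n * (V K n : ℂ)) = x n * (V K n : ℂ) := by
      intro n
      by_cases hn : n ∈ win (N K) <;> simp [hn]
    simp only [h4] at h3
    rw [hs.tsum_eq] at h3
    refine h3.trans ?_
    congr 1
    rw [tsum_eq_sum (s := F)]
    · exact Finset.sum_congr rfl fun f hf => if_pos (hK hf)
    · intro n hn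
      split_ifs with hw
      · rw [hVzero K n hw hn]; simp
      · rfl
  have := tendsto_nhds_unique hadd hzero
  rwa [add_zero] at this

/-- The quotient `x / r` is a polynomial of degree at most `q`, and it tends to 0 along the points
`b k`, since `x` is square summable and `|r (b k)| ≥ c₀`. The proof makes this quantitative: the
value at `j` is extrapolated from `b k, ..., b (k + q)` and `k` tends to infinity. -/
theorem eq_zero_of_cauchyTransform_eq_zero (hlam : ∀ n j : ℤ, lam n ≠ j)
    (hinj : Function.Injective lam) {r : ℤ → ℝ} {N : ℕ → ℕ} (hN : Tendsto N atTop atTop)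
    (hres : ∀ j, Tendsto (fun K => res lam (N K) j) atTop (𝓝 (r j))) (hr : ∀ j, r j ≠ 0)
    {B : ℝ} {q : ℕ}
    (hB : ∀ K, ∀ n ∉ win (N K), |(leadCoeff lam (N K))⁻¹| *
      ∏ i ∈ win (N K), (|(n : ℝ) - i| / |(n : ℝ) - lam i|) ≤ B * |(n : ℝ)| ^ q)
    (b : ℕ → ℤ) (hb0 : ∀ k, 0 < b k) (hb : ∀ k, 2 * b k ≤ b (k + 1)) {c₀ : ℝ} (hc₀ : 0 < c₀)
    (hrb : ∀ k, c₀ ≤ |r (b k)|)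
    {x : ℤ → ℂ} (hx : Summable fun j => ‖x j‖ ^ 2)
    (hx0 : ∀ m : ℤ, ∑' j : ℤ, x j / (lam m - j) = 0) (j : ℤ) : x j = 0 := by
  have hmono : StrictMono b := strictMono_nat_of_lt_succ fun k => by linarith [hb k, hb0 k]
  have hdouble : ∀ k l, k < l → 2 * b k ≤ b l := fun k l hkl =>
    (hb k).trans (hmono.monotone hkl)
  have hbtop : Tendsto b atTop atTop := by
    refine tendsto_atTop_mono (f := fun k : ℕ => (k : ℤ)) (fun k => ?_) tendsto_natCast_atTop_atTop
    induction k with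
    | zero => exact (hb0 0).le
    | succ k ih => push_cast; linarith [hb k, hb0 k]
  have hxb : Tendsto (fun k => ‖x (b k)‖) atTop (𝓝 0) := by
    have h1 := hx.tendsto_cofinite_zero.comp
      ((hmono.injective.tendsto_cofinite).mono_left Nat.cofinite_eq_atTop.ge)
    have h2 := (Real.continuous_sqrt.tendsto _).comp h1
    simpa [Function.comp_def, Real.sqrt_sq] using h2
  have hbd : ∀ᶠ k in atTop, ‖x j * ((r j)⁻¹ : ℂ)‖ ≤
      ∑ i ∈ Finset.range (q + 1), ‖x (b (i + k))‖ * (c₀⁻¹ * 4 ^ (q + 1)) := by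
    filter_upwards [hbtop.eventually_gt_atTop |j|] with k hk
    have hinjk : Function.Injective fun i => b (i + k) := fun i i' h => by
      have := hmono.injective h
      omega
    set T : Finset ℤ := (Finset.range (q + 1)).image fun i => b (i + k) with hT
    have hTj : ∀ t ∈ T, |j| < t := by
      intro t ht
      obtain ⟨i, -, rfl⟩ := Finset.mem_image.1 ht
      exact hk.trans_le (hmono.monotone (by omega))
    have hjT : j ∉ T := fun h => by
      have := hTj j h
      exact absurd (le_abs_self j) (by omega)
    have hcardT : T.card = q + 1 := by
      rw [hT, Finset.card_image_of_injective _ hinjk, Finset.card_range]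
    have hd := dividedDifference_eq_zero hlam hinj hN hres hr hB hx hx0 (insert j T)
      (by rw [Finset.card_insert_of_notMem hjT, hcardT])
    rw [Finset.sum_insert hjT, Finset.erase_insert hjT] at hd
    have hTne : ∀ t ∈ T, ((j : ℝ) - t) ≠ 0 := fun t ht => sub_ne_zero.2 <| by
      intro e
      have : j = t := by exact_mod_cast e
      exact hjT (this ▸ ht)
    have hQ : ((∏ t ∈ T, ((j : ℝ) - t) : ℝ) : ℂ) ≠ 0 :=
      Complex.ofReal_ne_zero.2 (Finset.prod_ne_zero_iff.2 hTne)
    -- Lagrange extrapolation from the `q + 1` nodes in `T`, obtained by solving the divided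
    -- difference on `insert j T` for its term at `j`.
    have hmain : x j * ((r j)⁻¹ : ℂ) = ∑ t ∈ T, x t * (((r t)⁻¹ *
        ∏ s ∈ T.erase t, (((j : ℝ) - s) * ((t : ℝ) - s)⁻¹) : ℝ) : ℂ) := by
      have h1 : x j * ((r j)⁻¹ : ℂ) = ((∏ t ∈ T, ((j : ℝ) - t) : ℝ) : ℂ) *
          (x j * (((r j)⁻¹ * ∏ g ∈ T, ((j : ℝ) - g)⁻¹ : ℝ) : ℂ)) := by
        rw [Finset.prod_inv_distrib]
        push_cast at hQ ⊢
        field_simp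
      rw [h1, eq_neg_of_add_eq_zero_left hd, mul_neg, Finset.mul_sum, ← Finset.sum_neg_distrib]
      refine Finset.sum_congr rfl fun t ht => ?_
      have hjt : j ≠ t := fun e => hjT (e ▸ ht)
      rw [Finset.erase_insert_of_ne hjt, Finset.prod_insert (fun h => hjT (Finset.mem_of_mem_erase h)),
        Finset.prod_mul_distrib, ← Finset.mul_prod_erase _ _ ht]
      have h2 : ((t : ℝ) - j)⁻¹ = -((j : ℝ) - t)⁻¹ := by rw [← inv_neg, neg_sub]
      rw [h2]
      have h3 := hTne t ht
      have h4 : ((j : ℝ) - t) * (∏ s ∈ T.erase t, ((j : ℝ) - s)) * ((r t)⁻¹ *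
          (-((j : ℝ) - t)⁻¹ * ∏ s ∈ T.erase t, ((t : ℝ) - s)⁻¹)) =
          -((r t)⁻¹ * ((∏ s ∈ T.erase t, ((j : ℝ) - s)) * ∏ s ∈ T.erase t, ((t : ℝ) - s)⁻¹)) := by
        field_simp
      rw [mul_left_comm, ← Complex.ofReal_mul, h4, Complex.ofReal_neg, mul_neg, neg_neg]
    rw [hmain]
    refine (norm_sum_le _ _).trans ?_
    rw [hT, Finset.sum_image hinjk.injOn, ← hT]
    refine Finset.sum_le_sum fun i hi => ?_
    have hti : b (i + k) ∈ T := Finset.mem_image_of_mem _ hi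
    rw [norm_mul, Complex.norm_real, Real.norm_eq_abs, abs_mul, abs_inv, Finset.abs_prod]
    refine mul_le_mul_of_nonneg_left ?_ (norm_nonneg _)
    refine mul_le_mul (inv_anti₀ hc₀ (hrb _)) ?_ (by positivity) (by positivity)
    -- Here `|j - s| ≤ 2 * s`, and lacunarity gives `s ≤ 2 * |t - s|` for two different nodes. So
    -- the extrapolation weights are bounded uniformly in `k`.
    have hle4 : ∀ s ∈ T.erase (b (i + k)),
        |((j : ℝ) - s) * (((b (i + k) : ℤ) : ℝ) - s)⁻¹| ≤ 4 := by
      intro s hs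
      obtain ⟨hne, hsT⟩ := Finset.mem_erase.1 hs
      obtain ⟨i', -, rfl⟩ := Finset.mem_image.1 hsT
      have hj := hTj _ hsT
      have hpos := hb0 (i' + k)
      have h1 : |(j : ℝ) - (b (i' + k) : ℤ)| ≤ 2 * (b (i' + k) : ℤ) := by
        have h3 := (abs_lt.1 hj)
        have : |j - b (i' + k)| ≤ 2 * b (i' + k) := abs_le.2 ⟨by linarith, by linarith⟩
        exact_mod_cast this
      have h2 : ((b (i' + k) : ℤ) : ℝ) ≤ 2 * |((b (i + k) : ℤ) : ℝ) - (b (i' + k) : ℤ)| := by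
        have : b (i' + k) ≤ 2 * |b (i + k) - b (i' + k)| := by
          have hii : i ≠ i' := fun e => hne (by rw [e])
          rcases lt_or_gt_of_ne hii with h | h
          · have h4 := hdouble (i + k) (i' + k) (by omega)
            have h5 := neg_le_abs (b (i + k) - b (i' + k))
            linarith
          · have h4 := hdouble (i' + k) (i + k) (by omega)
            have h5 := le_abs_self (b (i + k) - b (i' + k))
            linarith
        exact_mod_cast this
      have hposR : (0 : ℝ) < (b (i' + k) : ℤ) := by exact_mod_cast hpos
      rw [abs_mul, abs_inv, ← div_eq_mul_inv, div_le_iff₀ (by linarith)]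
      linarith
    refine (Finset.prod_le_prod (fun _ _ => abs_nonneg _) hle4).trans ?_
    rw [Finset.prod_const]
    refine pow_le_pow_right₀ (by norm_num) ?_
    rw [← hcardT]
    exact Finset.card_le_card (Finset.erase_subset _ _)
  have hlim : Tendsto (fun k => ∑ i ∈ Finset.range (q + 1),
      ‖x (b (i + k))‖ * (c₀⁻¹ * 4 ^ (q + 1))) atTop (𝓝 0) := by
    have : (0 : ℝ) = ∑ i ∈ Finset.range (q + 1), 0 * (c₀⁻¹ * 4 ^ (q + 1)) := by simp
    rw [this]
    refine tendsto_finsetSum _ fun i _ => Tendsto.mul_const _ ?_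
    exact hxb.comp (tendsto_atTop_mono (fun k => Nat.le_add_left k i) tendsto_id)
  have h0 := le_of_tendsto_of_tendsto tendsto_const_nhds hlim hbd
  have h1 := norm_le_zero_iff.1 h0
  refine (mul_eq_zero.1 h1).resolve_right (inv_ne_zero ?_)
  exact Complex.ofReal_ne_zero.2 (hr j)

end SpectralSynthesis

/-! ### The canonical product and the limits of the residues. -/

namespace SpectralSynthesis

open Filter Topology

variable {lam : ℤ → ℝ}

theorem prod_win_eq {M : Type*} [CommMonoid M] (f : ℤ → M) (N : ℕ) :
    ∏ n ∈ (win N).erase 0, f n = ∏ n ∈ Finset.range N, (f (n + 1) * f (-(n + 1))) := by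
  induction N with
  | zero => simp [win]
  | succ N ih =>
    rw [Finset.prod_range_succ, ← ih]
    have h : (win (N + 1)).erase 0 =
        insert ((N : ℤ) + 1) (insert (-((N : ℤ) + 1)) ((win N).erase 0)) := by
      ext i
      simp only [win, Finset.mem_erase, Finset.mem_insert, Finset.mem_Icc]
      push_cast
      omega
    rw [h, Finset.prod_insert, Finset.prod_insert]
    · rw [mul_comm, mul_comm (f (-(N + 1))), mul_assoc, mul_comm (f (-(N + 1)))]
    · simp only [win, Finset.mem_erase, Finset.mem_Icc]
      omega
    · simp only [win, Finset.mem_insert, Finset.mem_erase, Finset.mem_Icc]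
      omega

theorem card_win (N : ℕ) : (win N).card = 2 * N + 1 := by
  rw [win, Int.card_Icc]
  omega

theorem win_subset {N M : ℕ} (h : N ≤ M) : win N ⊆ win M := by
  intro n
  rw [mem_win, mem_win]
  intro hn
  exact hn.trans (by exact_mod_cast h)

/-- The canonical product of `lam`, with the factors `n` and `-n` taken together. -/
noncomputable def canonicalProduct (lam : ℤ → ℝ) (z : ℂ) : ℂ :=
  (1 - z / lam 0) * ∏' n : ℕ, (1 - z / lam (n + 1)) * (1 - z / lam (-(n + 1)))

section Product

variable {δ ε : ℝ}

theorem exists_abs_add_one_le (hδ : ∀ n : ℤ, |lam n - n| ≤ δ) (hε : 0 < ε)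
    (hdist : ∀ n m : ℤ, ε ≤ |lam n - m|) :
    ∃ C > 0, ∀ n : ℤ, |(n : ℝ)| + 1 ≤ C * |lam n| := by
  have hδ0 : 0 ≤ δ := (abs_nonneg _).trans (hδ 0)
  refine ⟨1 + (δ + 1) / ε, by positivity, fun n => ?_⟩
  have h1 : |(n : ℝ)| ≤ |lam n| + δ := by
    have h2 := abs_add_le (lam n) ((n : ℝ) - lam n)
    rw [add_sub_cancel, abs_sub_comm] at h2
    linarith [hδ n]
  have h2 : ε ≤ |lam n| := by simpa using hdist n 0
  have h3 : δ + 1 ≤ (δ + 1) / ε * |lam n| := by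
    rw [div_mul_eq_mul_div, le_div_iff₀ hε]
    exact mul_le_mul_of_nonneg_left h2 (by positivity)
  linarith

/-- Pairing gives absolute convergence: the coefficient of `z` is `-(lam n + lam (-n))` over the
product of the two frequencies, where the sum is at most `2 * δ` and the product grows like `n ^ 2`.
-/
theorem summable_pair (hδ : ∀ n : ℤ, |lam n - n| ≤ δ) (hε : 0 < ε)
    (hdist : ∀ n m : ℤ, ε ≤ |lam n - m|) (z : ℂ) :
    Summable fun n : ℕ => ‖(1 - z / lam (n + 1)) * (1 - z / lam (-(n + 1))) - 1‖ := by
  obtain ⟨C, hC, hle⟩ := exists_abs_add_one_le hδ hε hdist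
  have hδ0 : 0 ≤ δ := (abs_nonneg _).trans (hδ 0)
  have h0 : ∀ n, lam n ≠ 0 := fun n e => by
    have := hdist n 0
    rw [e] at this
    simp at this
    linarith
  have hs : Summable fun n : ℕ => (‖z‖ * (2 * δ) + ‖z‖ ^ 2) * C ^ 2 * (1 / ((n + 1 : ℕ) : ℝ) ^ 2) :=
    Summable.mul_left _ ((summable_nat_add_iff 1).2 (Real.summable_one_div_nat_pow.2 one_lt_two))
  refine Summable.of_nonneg_of_le (fun n => norm_nonneg _) (fun n => ?_) hs
  set a := lam (n + 1) with ha
  set b := lam (-(n + 1)) with hb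
  have ha0 : (a : ℂ) ≠ 0 := Complex.ofReal_ne_zero.2 (h0 _)
  have hb0 : (b : ℂ) ≠ 0 := Complex.ofReal_ne_zero.2 (h0 _)
  have h1 : (1 - z / a) * (1 - z / b) - 1 = (-z * ((a + b : ℝ) : ℂ) + z ^ 2) / ((a : ℂ) * b) := by
    push_cast
    field_simp
    ring
  have hab : |a + b| ≤ 2 * δ := by
    have h2 := hδ (n + 1)
    have h3 := hδ (-(n + 1))
    rw [← ha] at h2
    rw [← hb] at h3
    push_cast at h2 h3
    have h4 := abs_add_le (a - (n + 1)) (b - -(n + 1))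
    have h5 : a - (n + 1) + (b - -((n : ℝ) + 1)) = a + b := by ring
    rw [h5] at h4
    linarith
  have hn : (0 : ℝ) < ((n + 1 : ℕ) : ℝ) := by positivity
  have hA : ((n + 1 : ℕ) : ℝ) ≤ C * |a| := by
    have h2 := hle (n + 1)
    rw [← ha] at h2
    push_cast at h2 ⊢
    linarith [le_abs_self ((n : ℝ) + 1)]
  have hB : ((n + 1 : ℕ) : ℝ) ≤ C * |b| := by
    have h2 := hle (-(n + 1))
    rw [← hb] at h2
    push_cast at h2 ⊢
    rw [abs_neg] at h2
    linarith [le_abs_self ((n : ℝ) + 1)]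
  rw [h1, norm_div, norm_mul, Complex.norm_real, Complex.norm_real, Real.norm_eq_abs,
    Real.norm_eq_abs]
  have ha1 : 0 < |a| := abs_pos.2 (h0 _)
  have hb1 : 0 < |b| := abs_pos.2 (h0 _)
  have hnum : ‖-z * ((a + b : ℝ) : ℂ) + z ^ 2‖ ≤ ‖z‖ * (2 * δ) + ‖z‖ ^ 2 := by
    refine (norm_add_le _ _).trans ?_
    rw [norm_mul, norm_neg, norm_pow, Complex.norm_real, Real.norm_eq_abs]
    gcongr
  rw [div_le_iff₀ (by positivity)]
  refine hnum.trans ?_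
  have hprod : ((n + 1 : ℕ) : ℝ) ^ 2 ≤ C ^ 2 * (|a| * |b|) := by
    calc ((n + 1 : ℕ) : ℝ) ^ 2 = ((n + 1 : ℕ) : ℝ) * ((n + 1 : ℕ) : ℝ) := by ring
      _ ≤ (C * |a|) * (C * |b|) := by gcongr
      _ = _ := by ring
  have h6 : 1 ≤ C ^ 2 * (|a| * |b|) * (1 / ((n + 1 : ℕ) : ℝ) ^ 2) := by
    rw [mul_one_div, one_le_div (by positivity)]
    exact hprod
  calc ‖z‖ * (2 * δ) + ‖z‖ ^ 2 = (‖z‖ * (2 * δ) + ‖z‖ ^ 2) * 1 := by ring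
    _ ≤ (‖z‖ * (2 * δ) + ‖z‖ ^ 2) * (C ^ 2 * (|a| * |b|) * (1 / ((n + 1 : ℕ) : ℝ) ^ 2)) := by
        gcongr
    _ = _ := by ring

theorem tendsto_prod_win (hδ : ∀ n : ℤ, |lam n - n| ≤ δ) (hε : 0 < ε)
    (hdist : ∀ n m : ℤ, ε ≤ |lam n - m|) (z : ℂ) :
    Tendsto (fun N => ∏ n ∈ win N, (1 - z / lam n)) atTop (𝓝 (canonicalProduct lam z)) := by
  have hs := summable_pair hδ hε hdist z
  have hm : Multipliable fun n : ℕ => (1 - z / lam (n + 1)) * (1 - z / lam (-(n + 1))) := by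
    have := multipliable_one_add_of_summable hs
    simpa using this
  have h1 := hm.hasProd.tendsto_prod_nat.const_mul (1 - z / lam 0)
  refine h1.congr fun N => ?_
  rw [← Finset.mul_prod_erase _ _ (zero_mem_win N), prod_win_eq (fun n => 1 - z / (lam n : ℂ))]

theorem canonicalProduct_ne_zero (hδ : ∀ n : ℤ, |lam n - n| ≤ δ) (hε : 0 < ε)
    (hdist : ∀ n m : ℤ, ε ≤ |lam n - m|) (z : ℂ) (hz : ∀ n, z ≠ lam n) :
    canonicalProduct lam z ≠ 0 := by
  have h0 : ∀ n, 1 - z / (lam n : ℂ) ≠ 0 := fun n e => by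
    have hl : (lam n : ℂ) ≠ 0 := by
      rw [Complex.ofReal_ne_zero]
      intro e
      have := hdist n 0
      rw [e] at this
      simp at this
      linarith
    rw [sub_eq_zero, eq_div_iff hl, one_mul] at e
    exact hz n e.symm
  refine mul_ne_zero (h0 0) ?_
  have := tprod_one_add_ne_zero_of_summable
    (f := fun n : ℕ => (1 - z / lam (n + 1)) * (1 - z / lam (-(n + 1))) - 1)
    (fun n => by
      rw [add_sub_cancel]
      exact mul_ne_zero (h0 _) (h0 _)) (summable_pair hδ hε hdist z)
  simpa using this

theorem canonicalProduct_im (hδ : ∀ n : ℤ, |lam n - n| ≤ δ) (hε : 0 < ε)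
    (hdist : ∀ n m : ℤ, ε ≤ |lam n - m|) (x : ℝ) : (canonicalProduct lam x).im = 0 := by
  have h := (Complex.continuous_im.tendsto _).comp (tendsto_prod_win hδ hε hdist (x : ℂ))
  refine tendsto_nhds_unique h (tendsto_const_nhds.congr fun N => ?_)
  have : ∏ n ∈ win N, (1 - (x : ℂ) / lam n) = ((∏ n ∈ win N, (1 - x / lam n) : ℝ) : ℂ) := by
    push_cast; rfl
  rw [Function.comp_apply, this, Complex.ofReal_im]

/-- Cutting off by `|lam n| < R` or by `|n| ≤ N` differs by a bounded number of factors, each of the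
form `1 + O(1 / N)`. -/
theorem isGeneratingFunction_canonicalProduct (hδ : ∀ n : ℤ, |lam n - n| ≤ δ) (hε : 0 < ε)
    (hdist : ∀ n m : ℤ, ε ≤ |lam n - m|) : IsGeneratingFunction (canonicalProduct lam) lam := by
  obtain ⟨C, hC, hle⟩ := exists_abs_add_one_le hδ hε hdist
  have hδ0 : 0 ≤ δ := (abs_nonneg _).trans (hδ 0)
  have hsub : ∀ R : ℝ, ∀ n : ℤ, |lam n| < R → |(n : ℝ)| < R + δ := by
    intro R n hn
    have h2 := abs_add_le (lam n) ((n : ℝ) - lam n)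
    rw [add_sub_cancel, abs_sub_comm] at h2
    linarith [hδ n]
  have hfin : ∀ R : ℝ, {n : ℤ | |lam n| < R}.Finite := by
    intro R
    refine (win ⌈R + δ⌉₊).finite_toSet.subset fun n hn => ?_
    rw [Finset.mem_coe, mem_win]
    have h1 := (hsub R n hn).le.trans (Nat.le_ceil (R + δ))
    exact_mod_cast h1
  refine ⟨fun n e => ?_, hfin, fun z => ?_⟩
  · have := hdist n 0
    rw [e] at this
    simp at this
    linarith
  -- For large `R` the set `|lam n| < R` lies between `win (N R)` and `win (N R + M)`.
  set N : ℝ → ℕ := fun R => ⌊R - δ - 1⌋₊ with hNdef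
  set M : ℕ := ⌈2 * δ⌉₊ + 3 with hM
  have hN : Tendsto N atTop atTop :=
    tendsto_nat_floor_atTop.comp (tendsto_atTop_add_const_right _ _
      (tendsto_atTop_add_const_right _ _ tendsto_id))
  have hwin : ∀ᶠ R in atTop, win (N R) ⊆ (hfin R).toFinset := by
    filter_upwards [eventually_ge_atTop (δ + 1)] with R hR n hn
    rw [Set.Finite.mem_toFinset, Set.mem_ofPred_eq]
    rw [mem_win] at hn
    have h1 : |(n : ℝ)| ≤ N R := by exact_mod_cast hn
    have h2 : (N R : ℝ) ≤ R - δ - 1 := Nat.floor_le (by linarith)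
    have h3 := abs_add_le ((n : ℝ)) (lam n - n)
    rw [add_sub_cancel] at h3
    linarith [hδ n]
  have hupper : ∀ R, (hfin R).toFinset ⊆ win (N R + M) := by
    intro R n hn
    rw [Set.Finite.mem_toFinset, Set.mem_ofPred_eq] at hn
    rw [mem_win]
    have h1 := hsub R n hn
    have h2 : R - δ - 1 < N R + 1 := Nat.lt_floor_add_one _
    have h3 := Nat.le_ceil (2 * δ)
    have h4 : |(n : ℝ)| ≤ ((N R + M : ℕ) : ℝ) := by
      rw [hM]
      push_cast
      linarith
    exact_mod_cast h4
  have hX : Tendsto (fun R => ∏ n ∈ (hfin R).toFinset \ win (N R), (1 - z / (lam n : ℂ))) atTop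
      (𝓝 1) := by
    rw [tendsto_iff_norm_sub_tendsto_zero]
    have hb : ∀ R, ‖∏ n ∈ (hfin R).toFinset \ win (N R), (1 - z / (lam n : ℂ)) - 1‖ ≤
        Real.exp ((2 * M : ℕ) * (‖z‖ * C * (1 / ((N R : ℝ) + 1)))) - 1 := by
      intro R
      have h1 := Finset.norm_prod_one_add_sub_one_le ((hfin R).toFinset \ win (N R))
        (fun n => -(z / (lam n : ℂ)))
      simp only [← sub_eq_add_neg, norm_neg] at h1
      refine h1.trans ?_
      gcongr
      have hcard : ((hfin R).toFinset \ win (N R)).card ≤ 2 * M := by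
        refine (Finset.card_le_card (Finset.sdiff_subset_sdiff (hupper R) le_rfl)).trans ?_
        rw [Finset.card_sdiff_of_subset (win_subset (by omega)), card_win, card_win]
        omega
      have hterm : ∀ n ∈ (hfin R).toFinset \ win (N R),
          ‖z / (lam n : ℂ)‖ ≤ ‖z‖ * C * (1 / ((N R : ℝ) + 1)) := by
        intro n hn
        have hn2 := (Finset.mem_sdiff.1 hn).2
        rw [mem_win, not_le] at hn2
        have hn3 : ((N R : ℕ) : ℝ) < |(n : ℝ)| := by exact_mod_cast hn2
        have h3 := hle n
        have h4 : 0 < |lam n| := by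
          by_contra h
          have : |lam n| ≤ 0 := not_lt.1 h
          nlinarith [abs_nonneg (n : ℝ)]
        rw [norm_div, Complex.norm_real, Real.norm_eq_abs, mul_one_div, div_le_div_iff₀ h4
          (by positivity)]
        rw [mul_assoc]
        refine mul_le_mul_of_nonneg_left ?_ (norm_nonneg _)
        linarith
      refine (Finset.sum_le_card_nsmul _ _ _ hterm).trans ?_
      rw [nsmul_eq_mul]
      refine mul_le_mul_of_nonneg_right ?_ (by positivity)
      exact_mod_cast hcard
    refine squeeze_zero (fun R => norm_nonneg _) hb ?_
    have hlim : Tendsto (fun R => Real.exp ((2 * M : ℕ) * (‖z‖ * C * (1 / ((N R : ℝ) + 1)))) - 1)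
        atTop (𝓝 (Real.exp ((2 * M : ℕ) * (‖z‖ * C * 0)) - 1)) := by
      refine Tendsto.sub_const ((Real.continuous_exp.tendsto _).comp ?_) 1
      exact ((tendsto_one_div_add_atTop_nhds_zero_nat.comp hN).const_mul _).const_mul _
    simpa using hlim
  have hG := ((tendsto_prod_win hδ hε hdist z).comp hN).mul hX
  rw [mul_one] at hG
  refine hG.congr' ?_
  filter_upwards [hwin] with R hR
  refine Eq.trans ?_
    (finprod_mem_eq_finite_toFinset_prod (fun n => 1 - z / (lam n : ℂ)) (hfin R)).symm
  rw [Function.comp_apply, mul_comm, Finset.prod_sdiff hR]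

end Product

section Residues

/-- Both sides are the product of `j - n` over the window enlarged by `-N - 1`, without `n = j`; the
shift of `n` by 1 carries one window into the other. -/
theorem prod_win_erase_succ (N : ℕ) (j : ℤ) (hj : j ∈ win N) (hj1 : j + 1 ∈ win N) :
    (∏ n ∈ (win N).erase (j + 1), (((j + 1 : ℤ) : ℝ) - n)) * (j - N) =
      (∏ n ∈ (win N).erase j, ((j : ℝ) - n)) * (j + 1 + N) := by
  simp only [win, Finset.mem_Icc] at hj hj1
  set big : Finset ℤ := (Finset.Icc (-(N : ℤ) - 1) N).erase j with hbig
  have h1 : big = insert (N : ℤ) ((Finset.Icc (-(N : ℤ) - 1) (N - 1)).erase j) := by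
    ext i
    simp only [hbig, Finset.mem_erase, Finset.mem_insert, Finset.mem_Icc]
    omega
  have h2 : big = insert (-(N : ℤ) - 1) ((win N).erase j) := by
    ext i
    simp only [hbig, win, Finset.mem_erase, Finset.mem_insert, Finset.mem_Icc]
    omega
  have e1 : ∏ n ∈ big, ((j : ℝ) - n) = (j - N) *
      ∏ n ∈ (win N).erase (j + 1), (((j + 1 : ℤ) : ℝ) - n) := by
    rw [h1, Finset.prod_insert (by simp)]
    congr 1
    refine Finset.prod_nbij' (· + 1) (· - 1) ?_ ?_ ?_ ?_ ?_
    · intro a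
      simp only [win, Finset.mem_erase, Finset.mem_Icc]
      omega
    · intro a
      simp only [win, Finset.mem_erase, Finset.mem_Icc]
      omega
    · intro a _
      ring
    · intro a _
      ring
    · intro a _
      push_cast
      ring
  have e2 : ∏ n ∈ big, ((j : ℝ) - n) = (j + 1 + N) * ∏ n ∈ (win N).erase j, ((j : ℝ) - n) := by
    rw [h2, Finset.prod_insert (by simp [win])]
    congr 1
    push_cast
    ring
  rw [mul_comm, ← e1, e2, mul_comm]

/-- The reciprocal of the derivative at `j` of `z ∏ (1 - z / n)`. -/
noncomputable def derivInv (N : ℕ) (j : ℤ) : ℝ :=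
  (∏ n ∈ (win N).erase 0, (-(n : ℝ))) * ∏ n ∈ (win N).erase j, ((j : ℝ) - n)⁻¹

theorem derivInv_zero (N : ℕ) : derivInv N 0 = 1 := by
  rw [derivInv, ← Finset.prod_mul_distrib]
  refine Finset.prod_eq_one fun n hn => ?_
  have : (n : ℝ) ≠ 0 := by exact_mod_cast (Finset.mem_erase.1 hn).1
  simp [this]

theorem derivInv_succ (N : ℕ) (j : ℤ) (hj : j ∈ win N) (hj1 : j + 1 ∈ win N) :
    derivInv N (j + 1) * (j + 1 + N) = derivInv N j * (j - N) := by
  have h := prod_win_erase_succ N j hj hj1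
  have hne : ∀ i : ℤ, ∏ n ∈ (win N).erase i, ((i : ℝ) - n) ≠ 0 := fun i =>
    Finset.prod_ne_zero_iff.2 fun n hn => sub_ne_zero.2 (by
      exact_mod_cast (Finset.mem_erase.1 hn).1.symm)
  rw [derivInv, derivInv, Finset.prod_inv_distrib, Finset.prod_inv_distrib]
  have h1 := hne j
  have h2 := hne (j + 1)
  field_simp
  rw [mul_assoc, mul_assoc, h]
  ring

theorem tendsto_ratio (j : ℤ) :
    Tendsto (fun N : ℕ => ((j : ℝ) - N) / (j + 1 + N)) atTop (𝓝 (-1)) := by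
  have h : Tendsto (fun N : ℕ => (2 * (j : ℝ) + 1) / (j + 1 + N) - 1) atTop (𝓝 (0 - 1)) := by
    refine Tendsto.sub_const ?_ 1
    exact tendsto_const_nhds.div_atTop (tendsto_atTop_add_const_left _ _
      tendsto_natCast_atTop_atTop)
  rw [zero_sub] at h
  refine h.congr' ?_
  filter_upwards [eventually_gt_atTop (j + 1).natAbs] with N hN
  have h1 : (j : ℝ) + 1 + N ≠ 0 := by
    have : j + 1 + N ≠ 0 := by omega
    exact_mod_cast this
  field_simp
  ring

/-- The limit is the reciprocal of the derivative of `sin (πz) / π` at `j`. It follows from the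
value 1 at 0 and from the ratio of neighbours, which tends to -1, by induction in both directions.
-/
theorem tendsto_derivInv (j : ℤ) :
    Tendsto (fun N => derivInv N j) atTop (𝓝 ((-1) ^ j)) := by
  have hev : ∀ j : ℤ, ∀ᶠ N : ℕ in atTop, derivInv N (j + 1) * (j + 1 + N) = derivInv N j * (j - N)
      ∧ (j : ℝ) + 1 + N ≠ 0 ∧ (j : ℝ) - N ≠ 0 := by
    intro j
    filter_upwards [eventually_mem_win tendsto_id j, eventually_mem_win tendsto_id (j + 1),
      eventually_gt_atTop (j.natAbs + 1)] with N h1 h2 h3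
    refine ⟨derivInv_succ N j h1 h2, ?_, ?_⟩
    · have : j + 1 + N ≠ 0 := by omega
      exact_mod_cast this
    · have : j - N ≠ 0 := by omega
      exact_mod_cast this
  have hup : ∀ j : ℤ, Tendsto (fun N => derivInv N j) atTop (𝓝 ((-1) ^ j)) →
      Tendsto (fun N => derivInv N (j + 1)) atTop (𝓝 ((-1) ^ (j + 1))) := by
    intro j hj
    have h := hj.mul (tendsto_ratio j)
    rw [zpow_add₀ (by norm_num), zpow_one]
    refine h.congr' ?_
    filter_upwards [hev j] with N hN
    rw [mul_div_assoc', ← hN.1, mul_div_assoc, div_self hN.2.1, mul_one]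
  have hdown : ∀ j : ℤ, Tendsto (fun N => derivInv N (j + 1)) atTop (𝓝 ((-1) ^ (j + 1))) →
      Tendsto (fun N => derivInv N j) atTop (𝓝 ((-1) ^ j)) := by
    intro j hj
    have h := hj.div (tendsto_ratio j) (by norm_num)
    have e : ((-1 : ℝ) ^ (j + 1)) / -1 = (-1) ^ j := by
      rw [zpow_add₀ (by norm_num), zpow_one]; simp
    rw [e] at h
    refine h.congr' ?_
    filter_upwards [hev j] with N hN
    have h2 := hN.2.1
    have h3 := hN.2.2
    rw [Pi.div_apply, div_div_eq_mul_div, hN.1, mul_div_assoc, div_self h3, mul_one]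
  induction j using Int.induction_on with
  | zero => simp [derivInv_zero]
  | succ i ih => exact hup _ ih
  | pred i ih => exact hdown _ (by simpa using ih)

theorem leadCoeff_mul_prod (h0 : ∀ n, lam n ≠ 0) (N : ℕ) :
    leadCoeff lam N * ∏ n ∈ win N, (-lam n) = ∏ n ∈ (win N).erase 0, (-(n : ℝ)) := by
  rw [leadCoeff, ← Finset.mul_prod_erase _ _ (zero_mem_win N)]
  have h1 := h0 0
  have h2 : (∏ n ∈ (win N).erase 0, ((n : ℝ) / lam n)) * ∏ n ∈ (win N).erase 0, (-lam n) =
      ∏ n ∈ (win N).erase 0, (-(n : ℝ)) := by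
    rw [← Finset.prod_mul_distrib]
    refine Finset.prod_congr rfl fun n _ => ?_
    have := h0 n
    field_simp
  rw [← h2]
  field_simp

/-- The residue at a simple pole: the numerator over the derivative of the denominator. -/
theorem res_eq (h0 : ∀ n, lam n ≠ 0) (N : ℕ) (j : ℤ) :
    res lam N j = (∏ n ∈ win N, (1 - (j : ℝ) / lam n)) * derivInv N j := by
  have h1 : ∏ n ∈ win N, ((j : ℝ) - lam n) =
      (∏ n ∈ win N, (-lam n)) * ∏ n ∈ win N, (1 - (j : ℝ) / lam n) := by
    rw [← Finset.prod_mul_distrib]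
    refine Finset.prod_congr rfl fun n _ => ?_
    have := h0 n
    field_simp
    ring
  rw [res, derivInv, h1, ← leadCoeff_mul_prod h0]
  ring

variable {δ ε : ℝ}

/-- The limits of the residues. -/
noncomputable def resLim (lam : ℤ → ℝ) (j : ℤ) : ℝ := (canonicalProduct lam j).re * (-1) ^ j

theorem tendsto_res (hδ : ∀ n : ℤ, |lam n - n| ≤ δ) (hε : 0 < ε)
    (hdist : ∀ n m : ℤ, ε ≤ |lam n - m|) (j : ℤ) :
    Tendsto (fun N => res lam N j) atTop (𝓝 (resLim lam j)) := by
  have h0 : ∀ n, lam n ≠ 0 := fun n e => by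
    have := hdist n 0
    rw [e] at this
    simp at this
    linarith
  have h := ((Complex.continuous_re.tendsto _).comp
    (tendsto_prod_win hδ hε hdist (j : ℂ))).mul (tendsto_derivInv j)
  refine h.congr fun N => ?_
  have : ∏ n ∈ win N, (1 - (j : ℂ) / lam n) = ((∏ n ∈ win N, (1 - (j : ℝ) / lam n) : ℝ) : ℂ) := by
    push_cast; rfl
  rw [Function.comp_apply, this, Complex.ofReal_re, res_eq h0]

theorem abs_resLim (hδ : ∀ n : ℤ, |lam n - n| ≤ δ) (hε : 0 < ε)
    (hdist : ∀ n m : ℤ, ε ≤ |lam n - m|) (j : ℤ) :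
    |resLim lam j| = ‖canonicalProduct lam (j : ℂ)‖ := by
  have him := canonicalProduct_im hδ hε hdist (j : ℝ)
  have h1 : canonicalProduct lam (j : ℂ) = ((canonicalProduct lam (j : ℂ)).re : ℂ) := by
    apply Complex.ext
    · simp
    · simpa using him
  rw [resLim, abs_mul, abs_zpow]
  nth_rewrite 2 [h1]
  rw [Complex.norm_real, Real.norm_eq_abs]
  simp

theorem resLim_zero : resLim lam 0 = 1 := by
  simp [resLim, canonicalProduct]

theorem resLim_ne_zero (hδ : ∀ n : ℤ, |lam n - n| ≤ δ) (hε : 0 < ε)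
    (hdist : ∀ n m : ℤ, ε ≤ |lam n - m|) (j : ℤ) : resLim lam j ≠ 0 := by
  rw [← abs_ne_zero, abs_resLim hδ hε hdist, norm_ne_zero_iff]
  refine canonicalProduct_ne_zero hδ hε hdist _ fun n e => ?_
  have h1 : (j : ℝ) = lam n := by exact_mod_cast e
  have := hdist n j
  rw [h1, sub_self, abs_zero] at this
  linarith

end Residues

end SpectralSynthesis

/-! ### Growth on the imaginary axis. -/

namespace SpectralSynthesis

open Filter Topology

variable {lam : ℤ → ℝ}

/-- The truncated product is the truncated sine times a Cauchy sum. Splitting off `z - lam 0` puts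
an additional `1 / (j - lam 0)` into the sum, which makes it converge in the limit. -/
theorem prod_win_eq_sin_prod_mul (hlam : ∀ n j : ℤ, lam n ≠ j) (N : ℕ) {z : ℂ}
    (hz : ∀ j : ℤ, z ≠ j) :
    ∏ n ∈ win N, (1 - z / lam n) = (z * ∏ n ∈ Finset.range N, (1 - z ^ 2 / ((n : ℂ) + 1) ^ 2)) *
      ((z - lam 0) * ∑ j ∈ win N, ((res lam N j / (j - lam 0) : ℝ) : ℂ) / (z - j)) := by
  have h0 : ∀ n, lam n ≠ 0 := fun n => by simpa using hlam n 0
  have h0C : ∀ n, (lam n : ℂ) ≠ 0 := fun n => Complex.ofReal_ne_zero.2 (h0 n)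
  have hz0 : z ≠ 0 := by simpa using hz 0
  rw [sum_res_div_sub hlam (zero_mem_win N) hz]
  have e1 : (z - lam 0) * (leadCoeff lam N * ((∏ n ∈ (win N).erase 0, (z - lam n)) *
      (∏ n ∈ win N, (z - n))⁻¹)) =
      leadCoeff lam N * (∏ n ∈ win N, (z - lam n)) * (∏ n ∈ win N, (z - n))⁻¹ := by
    rw [← Finset.mul_prod_erase _ (fun n => z - (lam n : ℂ)) (zero_mem_win N)]
    ring
  have e2 : ∏ n ∈ win N, (z - lam n) =
      ((∏ n ∈ win N, (-lam n) : ℝ) : ℂ) * ∏ n ∈ win N, (1 - z / lam n) := by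
    push_cast
    rw [← Finset.prod_mul_distrib]
    refine Finset.prod_congr rfl fun n _ => ?_
    have := h0C n
    field_simp
    ring
  have e3 : ∏ n ∈ Finset.range N, (1 - z ^ 2 / ((n : ℂ) + 1) ^ 2) =
      ∏ n ∈ (win N).erase 0, (1 - z / (n : ℂ)) := by
    rw [prod_win_eq]
    refine Finset.prod_congr rfl fun n _ => ?_
    have : (n : ℂ) + 1 ≠ 0 := by exact_mod_cast Nat.succ_ne_zero n
    push_cast
    field_simp
    ring
  have e4 : ∏ n ∈ win N, (z - n) = ((∏ n ∈ (win N).erase 0, (-(n : ℝ)) : ℝ) : ℂ) *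
      (z * ∏ n ∈ (win N).erase 0, (1 - z / (n : ℂ))) := by
    rw [← Finset.mul_prod_erase _ (fun n : ℤ => z - (n : ℂ)) (zero_mem_win N), Int.cast_zero,
      sub_zero]
    push_cast
    rw [mul_left_comm, ← Finset.prod_mul_distrib]
    congr 1
    refine Finset.prod_congr rfl fun n hn => ?_
    have : (n : ℂ) ≠ 0 := by exact_mod_cast (Finset.mem_erase.1 hn).1
    field_simp
    ring
  have hne : ∏ n ∈ win N, (z - n) ≠ 0 := Finset.prod_ne_zero_iff.2 fun n _ => sub_ne_zero.2 (hz n)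
  have e6 : (leadCoeff lam N : ℂ) * ((∏ n ∈ win N, (-lam n) : ℝ) : ℂ) =
      ((∏ n ∈ (win N).erase 0, (-(n : ℝ)) : ℝ) : ℂ) := by
    rw [← Complex.ofReal_mul, leadCoeff_mul_prod h0]
  rw [e1, e2, e3]
  calc ∏ n ∈ win N, (1 - z / lam n) = (∏ n ∈ win N, (1 - z / lam n)) *
        ((∏ n ∈ win N, (z - n)) * (∏ n ∈ win N, (z - n))⁻¹) := by
        rw [mul_inv_cancel₀ hne, mul_one]
    _ = (∏ n ∈ win N, (1 - z / lam n)) * ((((∏ n ∈ (win N).erase 0, (-(n : ℝ)) : ℝ) : ℂ) *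
        (z * ∏ n ∈ (win N).erase 0, (1 - z / (n : ℂ)))) * (∏ n ∈ win N, (z - n))⁻¹) := by
        rw [← e4]
    _ = _ := by
        rw [← e6]
        ring

section

variable {δ ε : ℝ} {W : ℤ → ℝ} {N : ℕ → ℕ}

theorem imaginary_ne_int {y : ℝ} (hy : y ≠ 0) (j : ℤ) : Complex.I * y ≠ (j : ℂ) := by
  intro e
  have := congrArg Complex.im e
  simp at this
  exact hy this

theorem abs_le_norm_imaginary_sub (y : ℝ) (j : ℤ) : |y| ≤ ‖Complex.I * y - (j : ℂ)‖ := by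
  have := Complex.abs_im_le_norm (Complex.I * y - (j : ℂ))
  simpa using this

theorem canonicalProduct_imaginary (hδ : ∀ n : ℤ, |lam n - n| ≤ δ) (hε : 0 < ε)
    (hdist : ∀ n m : ℤ, ε ≤ |lam n - m|) (hlam : ∀ n j : ℤ, lam n ≠ j)
    (hN : Tendsto N atTop atTop) (hW : ∀ K, ∀ j ∈ win (N K), |res lam (N K) j| ≤ W j)
    (hWs : Summable fun j : ℤ => W j * (|(j : ℝ)| + 1)⁻¹) {y : ℝ} (hy : 1 ≤ |y|) :
    canonicalProduct lam (Complex.I * y) =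
      (Complex.sin (Real.pi * (Complex.I * y)) / Real.pi) * ((Complex.I * y - lam 0) *
        ∑' j : ℤ, (resLim lam j : ℂ) *
          ((((j - lam 0)⁻¹ : ℝ) : ℂ) * (Complex.I * y - j)⁻¹)) := by
  have hy0 : y ≠ 0 := fun e => by rw [e, abs_zero] at hy; linarith
  set z : ℂ := Complex.I * y with hzdef
  have hz : ∀ j : ℤ, z ≠ j := imaginary_ne_int hy0
  obtain ⟨C, hC, hCm⟩ := inv_sub_le (lam 0) (hlam 0)
  have hpi : (Real.pi : ℂ) ≠ 0 := by exact_mod_cast Real.pi_ne_zero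
  have h1 := (tendsto_prod_win hδ hε hdist z).comp hN
  have h2 := tendsto_sum_res hN (fun j => (tendsto_res hδ hε hdist j).comp hN) hW hWs
    (fun j => ((((j - lam 0)⁻¹ : ℝ) : ℂ) * (z - j)⁻¹)) (C := C) (by
      intro j
      rw [norm_mul, Complex.norm_real, Real.norm_eq_abs, abs_inv, norm_inv]
      have h3 : ‖z - j‖⁻¹ ≤ 1 :=
        inv_le_one_of_one_le₀ (hy.trans (abs_le_norm_imaginary_sub y j))
      calc _ ≤ |(j : ℝ) - lam 0|⁻¹ * 1 := by gcongr
        _ ≤ _ := by rw [mul_one]; exact hCm j)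
  have h3 : Tendsto (fun K => z * ∏ n ∈ Finset.range (N K), (1 - z ^ 2 / ((n : ℂ) + 1) ^ 2)) atTop
      (𝓝 (Complex.sin (Real.pi * z) / Real.pi)) := by
    have h4 := ((Complex.tendsto_euler_sin_prod z).comp hN).div_const (Real.pi : ℂ)
    refine h4.congr fun K => ?_
    simp only [Function.comp_apply]
    field_simp
  refine tendsto_nhds_unique h1 ((h3.mul (h2.const_mul (z - lam 0))).congr fun K => ?_)
  rw [Function.comp_apply, prod_win_eq_sin_prod_mul hlam _ hz]
  congr 2
  refine Finset.sum_congr rfl fun j _ => ?_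
  push_cast
  rw [div_eq_mul_inv, div_eq_mul_inv, mul_assoc]

/-- The quotient `(iy - λ_0) / (iy - j)` is bounded by `1 + |λ_0|` and tends to 1, so the factor
beside the sine tends to `∑ r_j / (j - λ_0) = 0`. -/
theorem canonicalProduct_isLittleO (hδ : ∀ n : ℤ, |lam n - n| ≤ δ) (hε : 0 < ε)
    (hdist : ∀ n m : ℤ, ε ≤ |lam n - m|) (hlam : ∀ n j : ℤ, lam n ≠ j)
    (hN : Tendsto N atTop atTop) (hW : ∀ K, ∀ j ∈ win (N K), |res lam (N K) j| ≤ W j)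
    (hrW : ∀ j, |resLim lam j| ≤ W j)
    (hWs : Summable fun j : ℤ => W j * (|(j : ℝ)| + 1)⁻¹)
    (hsum : ∑' j : ℤ, resLim lam j / (j - lam 0) = 0) :
    (fun y : ℝ => canonicalProduct lam (Complex.I * y)) =o[cocompact ℝ]
      (fun y : ℝ => Real.exp (Real.pi * |y|)) := by
  obtain ⟨C, hC, hCm⟩ := inv_sub_le (lam 0) (hlam 0)
  have hnorm : Tendsto (fun y : ℝ => |y|) (cocompact ℝ) atTop :=
    tendsto_norm_cocompact_atTop (E := ℝ)
  have hbig : ∀ᶠ y in cocompact ℝ, 1 ≤ |y| := hnorm.eventually_ge_atTop 1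
  have hW0 : ∀ j, 0 ≤ W j := fun j => (abs_nonneg _).trans (hrW j)
  have hlim : Tendsto (fun y : ℝ => ∑' j : ℤ, (resLim lam j : ℂ) * (((j - lam 0)⁻¹ : ℝ) : ℂ) *
      ((Complex.I * y - lam 0) * (Complex.I * y - j)⁻¹)) (cocompact ℝ) (𝓝 0) := by
    have h0 : (0 : ℂ) = ∑' j : ℤ, (resLim lam j : ℂ) * (((j - lam 0)⁻¹ : ℝ) : ℂ) * 1 := by
      rw [← Complex.ofReal_zero, ← hsum, Complex.ofReal_tsum]
      refine tsum_congr fun j => ?_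
      push_cast
      rw [div_eq_mul_inv, mul_one]
    rw [h0]
    refine tendsto_tsum_of_dominated_convergence
      (bound := fun j : ℤ => (C * (1 + |lam 0|)) * (W j * (|(j : ℝ)| + 1)⁻¹)) (hWs.mul_left _) ?_ ?_
    · intro j
      refine Tendsto.const_mul _ ?_
      rw [tendsto_iff_norm_sub_tendsto_zero]
      have hb : ∀ᶠ y : ℝ in cocompact ℝ,
          ‖(Complex.I * y - lam 0) * (Complex.I * y - j)⁻¹ - 1‖ ≤ ‖((j : ℂ) - lam 0)‖ * |y|⁻¹ := by
        filter_upwards [hbig] with y hy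
        have hy0 : y ≠ 0 := fun e => by rw [e, abs_zero] at hy; linarith
        have hne : Complex.I * y - (j : ℂ) ≠ 0 := sub_ne_zero.2 (imaginary_ne_int hy0 j)
        have e : (Complex.I * y - lam 0) * (Complex.I * y - j)⁻¹ - 1 =
            ((j : ℂ) - lam 0) * (Complex.I * y - j)⁻¹ := by
          field_simp
          ring
        rw [e, norm_mul, norm_inv]
        gcongr
        exact abs_le_norm_imaginary_sub y j
      refine squeeze_zero' (Eventually.of_forall fun y => norm_nonneg _) hb ?_
      have := (tendsto_inv_atTop_zero.comp hnorm).const_mul ‖((j : ℂ) - lam 0)‖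
      simpa using this
    · filter_upwards [hbig] with y hy j
      rw [norm_mul, norm_mul, norm_mul, Complex.norm_real, Complex.norm_real, Real.norm_eq_abs,
        Real.norm_eq_abs, abs_inv, norm_inv]
      have h1 : ‖Complex.I * y - lam 0‖ * ‖Complex.I * y - (j : ℂ)‖⁻¹ ≤ 1 + |lam 0| := by
        have h2 := abs_le_norm_imaginary_sub y j
        rw [← div_eq_mul_inv, div_le_iff₀ (by linarith)]
        have h3 : ‖Complex.I * y - lam 0‖ ≤ |y| + |lam 0| := by
          refine (norm_sub_le _ _).trans ?_
          simp
        nlinarith [abs_nonneg (lam 0)]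
      calc _ ≤ W j * (C * (|(j : ℝ)| + 1)⁻¹) * (1 + |lam 0|) := by
            refine mul_le_mul (mul_le_mul (hrW j) (hCm j) (by positivity) (hW0 j)) h1
              (by positivity) ?_
            have := hW0 j
            positivity
        _ = _ := by ring
  rw [Asymptotics.isLittleO_iff]
  intro c hc
  have hev := (tendsto_zero_iff_norm_tendsto_zero.1 hlim).eventually (gt_mem_nhds hc)
  filter_upwards [hev, hbig] with y h1 hy
  rw [canonicalProduct_imaginary hδ hε hdist hlam hN hW hWs hy, norm_mul]
  have e : (Complex.I * y - lam 0) * ∑' j : ℤ, (resLim lam j : ℂ) *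
      ((((j - lam 0)⁻¹ : ℝ) : ℂ) * (Complex.I * y - j)⁻¹) =
      ∑' j : ℤ, (resLim lam j : ℂ) * (((j - lam 0)⁻¹ : ℝ) : ℂ) *
      ((Complex.I * y - lam 0) * (Complex.I * y - j)⁻¹) := by
    rw [← tsum_mul_left]
    refine tsum_congr fun j => ?_
    ring
  rw [e]
  have hsin : ‖Complex.sin (Real.pi * (Complex.I * y)) / Real.pi‖ ≤ Real.exp (Real.pi * |y|) := by
    have hpi := Real.pi_gt_three
    rw [norm_div, Complex.norm_real, Real.norm_eq_abs, abs_of_pos Real.pi_pos]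
    have h2 : ‖Complex.sin (Real.pi * (Complex.I * y))‖ ≤ Real.exp (Real.pi * |y|) := by
      rw [Complex.sin, norm_div, norm_mul, Complex.norm_I, mul_one, Complex.norm_ofNat,
        div_le_iff₀ (by norm_num)]
      refine (norm_sub_le _ _).trans ?_
      rw [Complex.norm_exp, Complex.norm_exp]
      have h3 : (-(Real.pi * (Complex.I * y)) * Complex.I : ℂ).re = Real.pi * y := by
        simp
      have h4 : ((Real.pi * (Complex.I * y)) * Complex.I : ℂ).re = -(Real.pi * y) := by
        simp
      rw [h3, h4]
      have h5 : Real.exp (Real.pi * y) ≤ Real.exp (Real.pi * |y|) := by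
        gcongr
        exact le_abs_self y
      have h6 : Real.exp (-(Real.pi * y)) ≤ Real.exp (Real.pi * |y|) := by
        gcongr
        rw [← mul_neg]
        gcongr
        exact neg_le_abs y
      linarith
    exact (div_le_self (norm_nonneg _) (by linarith)).trans h2
  rw [Real.norm_of_nonneg (Real.exp_pos _).le, mul_comm c]
  gcongr

end

end SpectralSynthesis

/-! ### Harmonic sums over windows and over blocks. -/

namespace SpectralSynthesis

open Filter Topology

section Harmonic

/-- The harmonic numbers as reals. -/
noncomputable def har (n : ℕ) : ℝ := ∑ i ∈ Finset.range n, 1 / ((i : ℝ) + 1)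

theorem har_zero : har 0 = 0 := by simp [har]

theorem har_succ (n : ℕ) : har (n + 1) = har n + 1 / ((n : ℝ) + 1) := by
  rw [har, Finset.sum_range_succ, ← har]

theorem har_mono : Monotone har := monotone_nat_of_le_succ fun n => by
  rw [har_succ]
  have : 0 ≤ 1 / ((n : ℝ) + 1) := by positivity
  linarith

theorem har_eq_harmonic (n : ℕ) : har n = ((harmonic n : ℚ) : ℝ) := by
  simp [har, harmonic, one_div]

theorem log_add_one_le_har (n : ℕ) : Real.log ((n : ℝ) + 1) ≤ har n := by
  rw [har_eq_harmonic]
  exact_mod_cast log_add_one_le_harmonic n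

theorem har_le_one_add_log (n : ℕ) : har n ≤ 1 + Real.log n := by
  rw [har_eq_harmonic]
  exact harmonic_le_one_add_log n

theorem har_add_sub_le (m k : ℕ) (hm : 0 < m) : har (m + k) - har m ≤ k / m := by
  induction k with
  | zero => simp
  | succ k ih =>
    rw [← add_assoc, har_succ]
    have hm' : (0 : ℝ) < m := by exact_mod_cast hm
    have : 1 / (((m + k : ℕ) : ℝ) + 1) ≤ 1 / m := by
      refine one_div_le_one_div_of_le hm' ?_
      push_cast
      have : (0 : ℝ) ≤ k := by positivity
      linarith
    push_cast at this ⊢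
    rw [add_div]
    linarith

theorem har_le_har_pred_add_one (n : ℕ) : har n ≤ har (n - 1) + 1 := by
  cases n with
  | zero => simp [har_zero]
  | succ n =>
    rw [har_succ, Nat.add_sub_cancel]
    have : 1 / ((n : ℝ) + 1) ≤ 1 := by
      rw [div_le_one (by positivity)]
      have : (0 : ℝ) ≤ n := by positivity
      linarith
    linarith

/-- The harmonic numbers extended to the integers with `harInt m - harInt (m - 1) = 1 / m`. -/
noncomputable def harInt (m : ℤ) : ℝ := if 0 ≤ m then har m.toNat else har (-m - 1).toNat

theorem harInt_natCast (m : ℕ) : harInt m = har m := by simp [harInt]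

theorem harInt_of_nonneg {m : ℤ} (h : 0 ≤ m) : harInt m = har m.natAbs := by
  obtain ⟨k, rfl⟩ := Int.eq_ofNat_of_zero_le h
  simp [harInt]

theorem harInt_of_neg {m : ℤ} (h : m < 0) : harInt m = har (m.natAbs - 1) := by
  rw [harInt, if_neg (by omega)]
  congr 1
  omega

/-- This includes `m = 0`: `harInt 0 = harInt (-1)` agrees with `1 / 0 = 0`. So sums of `1 / (n -
j)` telescope also over intervals that contain `j`, whose term counts as 0. -/
theorem harInt_sub (m : ℤ) : harInt m - harInt (m - 1) = 1 / (m : ℝ) := by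
  rcases lt_trichotomy m 0 with h | h | h
  · rw [harInt_of_neg h, harInt_of_neg (by omega)]
    obtain ⟨k, hk⟩ : ∃ k : ℕ, m = -((k : ℤ) + 1) := ⟨m.natAbs - 1, by omega⟩
    have h1 : m.natAbs - 1 = k := by omega
    have h2 : (m - 1).natAbs - 1 = k + 1 := by omega
    rw [h1, h2, har_succ, hk]
    push_cast
    rw [one_div, one_div, inv_neg]
    ring
  · subst h
    rw [harInt_of_nonneg le_rfl, harInt_of_neg (by omega)]
    simp
  · rw [harInt_of_nonneg h.le, harInt_of_nonneg (by omega)]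
    obtain ⟨k, hk⟩ : ∃ k : ℕ, m = (k : ℤ) + 1 := ⟨m.natAbs - 1, by omega⟩
    have h1 : m.natAbs = k + 1 := by omega
    have h2 : (m - 1).natAbs = k := by omega
    rw [h1, h2, har_succ, hk]
    push_cast
    ring

theorem sum_Icc_one_div_sub (a b j : ℤ) (hab : a - 1 ≤ b) :
    ∑ n ∈ Finset.Icc a b, 1 / ((n : ℝ) - j) = harInt (b - j) - harInt (a - 1 - j) := by
  induction b, hab using Int.leInduction with
  | base => simp
  | succ b hb ih =>
    have h : Finset.Icc a (b + 1) = insert (b + 1) (Finset.Icc a b) := by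
      ext i
      simp only [Finset.mem_insert, Finset.mem_Icc]
      omega
    rw [h, Finset.sum_insert (by simp), ih]
    have := harInt_sub (b + 1 - j)
    push_cast at this ⊢
    rw [← this]
    have e : b + 1 - j - 1 = b - j := by ring
    rw [e]
    ring

theorem sum_Icc_one_div (a b : ℤ) (hab : a - 1 ≤ b) :
    ∑ n ∈ Finset.Icc a b, 1 / (n : ℝ) = harInt b - harInt (a - 1) := by
  simpa using sum_Icc_one_div_sub a b 0 hab

end Harmonic

/-- The kernel `1 / (n - j) - 1 / n`. -/
noncomputable def ker (j n : ℤ) : ℝ := 1 / ((n : ℝ) - j) - 1 / (n : ℝ)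

theorem ker_eq {j n : ℤ} (hn : n ≠ 0) (hj : n ≠ j) :
    ker j n = (j : ℝ) / (n * (n - j)) := by
  have h1 : (n : ℝ) ≠ 0 := by exact_mod_cast hn
  have h2 : (n : ℝ) - j ≠ 0 := sub_ne_zero.2 (by exact_mod_cast hj)
  rw [ker]
  field_simp
  ring

/-- For `N` large compared with `|j|` this is about `-2 log |j|`, the source of the decay
`|j|^{-2α}` of the residues. -/
theorem sum_win_sign_mul_ker (N : ℕ) (j : ℤ) (hj : j ≠ 0) (hjN : j ∈ win N) :
    ∑ n ∈ win N, ((Int.sign n : ℤ) : ℝ) * ker j n =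
      har (N - j.natAbs) + har (N + j.natAbs) - 2 * har N - har j.natAbs - har (j.natAbs - 1) := by
  rw [mem_win] at hjN
  have hsplit : win N = insert 0 (Finset.Icc (1 : ℤ) N ∪ Finset.Icc (-(N : ℤ)) (-1)) := by
    ext i
    simp only [win, Finset.mem_insert, Finset.mem_union, Finset.mem_Icc]
    omega
  have hdisj : Disjoint (Finset.Icc (1 : ℤ) N) (Finset.Icc (-(N : ℤ)) (-1)) := by
    rw [Finset.disjoint_left]
    intro i hi
    simp only [Finset.mem_Icc] at hi ⊢
    omega
  have hpos : ∑ n ∈ Finset.Icc (1 : ℤ) N, ((Int.sign n : ℤ) : ℝ) * ker j n =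
      harInt (N - j) - harInt (-j) - har N := by
    have h1 : ∀ n ∈ Finset.Icc (1 : ℤ) N, ((Int.sign n : ℤ) : ℝ) * ker j n =
        1 / ((n : ℝ) - j) - 1 / (n : ℝ) := by
      intro n hn
      rw [Int.sign_eq_one_of_pos (by simp at hn; omega), Int.cast_one, one_mul, ker]
    rw [Finset.sum_congr rfl h1, Finset.sum_sub_distrib, sum_Icc_one_div_sub _ _ _ (by omega),
      sum_Icc_one_div _ _ (by omega), harInt_natCast]
    simp [harInt, har_zero]
  have hneg : ∑ n ∈ Finset.Icc (-(N : ℤ)) (-1), ((Int.sign n : ℤ) : ℝ) * ker j n =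
      harInt (-(N : ℤ) - 1 - j) - harInt (-1 - j) - har N := by
    have h1 : ∀ n ∈ Finset.Icc (-(N : ℤ)) (-1), ((Int.sign n : ℤ) : ℝ) * ker j n =
        1 / (n : ℝ) - 1 / ((n : ℝ) - j) := by
      intro n hn
      rw [Int.sign_eq_neg_one_of_neg (by simp at hn; omega), ker]
      push_cast
      ring
    rw [Finset.sum_congr rfl h1, Finset.sum_sub_distrib, sum_Icc_one_div_sub _ _ _ (by omega),
      sum_Icc_one_div _ _ (by omega)]
    have e1 : harInt (-1) = 0 := by
      rw [harInt_of_neg (by omega)]; simp [har_zero]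
    have e2 : harInt (-(N : ℤ) - 1) = har N := by
      rw [harInt_of_neg (by omega)]; congr 1; omega
    rw [e1, e2]
    ring
  rw [hsplit, Finset.sum_insert (by simp), Finset.sum_union hdisj, hpos, hneg]
  have hjN' : j.natAbs ≤ N := by
    rw [Int.abs_eq_natAbs] at hjN
    exact_mod_cast hjN
  simp only [Int.sign_zero, Int.cast_zero, zero_mul, zero_add]
  rcases lt_or_gt_of_ne hj with h | h
  · rw [harInt_of_nonneg (m := N - j) (by omega), harInt_of_nonneg (m := -j) (by omega),
      harInt_of_neg (m := -(N : ℤ) - 1 - j) (by omega), harInt_of_nonneg (m := -1 - j) (by omega)]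
    have e1 : ((N : ℤ) - j).natAbs = N + j.natAbs := by omega
    have e2 : (-j).natAbs = j.natAbs := by omega
    have e3 : (-(N : ℤ) - 1 - j).natAbs - 1 = N - j.natAbs := by omega
    have e4 : (-1 - j).natAbs = j.natAbs - 1 := by omega
    rw [e1, e2, e3, e4]
    ring
  · rw [harInt_of_nonneg (m := N - j) (by omega), harInt_of_neg (m := -j) (by omega),
      harInt_of_neg (m := -(N : ℤ) - 1 - j) (by omega), harInt_of_neg (m := -1 - j) (by omega)]
    have e1 : ((N : ℤ) - j).natAbs = N - j.natAbs := by omega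
    have e2 : (-j).natAbs - 1 = j.natAbs - 1 := by omega
    have e3 : (-(N : ℤ) - 1 - j).natAbs - 1 = N + j.natAbs := by omega
    have e4 : (-1 - j).natAbs - 1 = j.natAbs := by omega
    rw [e1, e2, e3, e4]
    ring

theorem sum_win_sign_mul_ker_le (N : ℕ) (j : ℤ) (hj : j ≠ 0) (hjN : j ∈ win N) :
    ∑ n ∈ win N, ((Int.sign n : ℤ) : ℝ) * ker j n ≤ 2 - 2 * har j.natAbs := by
  rw [sum_win_sign_mul_ker N j hj hjN]
  rw [mem_win, Int.abs_eq_natAbs] at hjN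
  have hjN' : j.natAbs ≤ N := by exact_mod_cast hjN
  have h0 : 0 < j.natAbs := Int.natAbs_pos.2 hj
  have h1 := har_mono (Nat.sub_le N j.natAbs)
  have h2 := har_add_sub_le N j.natAbs (by omega)
  have h3 : ((j.natAbs : ℕ) : ℝ) / N ≤ 1 := by
    rw [div_le_one (by exact_mod_cast (by omega : 0 < N))]
    exact_mod_cast hjN'
  have h4 := har_le_har_pred_add_one j.natAbs
  linarith

/-- Away from the ends of the window `har (N - |j|)` is within 1 of `har N`; near the ends only the
upper bound survives. -/
theorem le_sum_win_sign_mul_ker (N : ℕ) (j : ℤ) (hj : j ≠ 0) (hjN : 2 * j.natAbs ≤ N) :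
    -2 * har j.natAbs - 1 ≤ ∑ n ∈ win N, ((Int.sign n : ℤ) : ℝ) * ker j n := by
  have h0 : 0 < j.natAbs := Int.natAbs_pos.2 hj
  rw [sum_win_sign_mul_ker N j hj (by rw [mem_win, Int.abs_eq_natAbs]; omega)]
  have h1 := har_mono (Nat.le_add_right N j.natAbs)
  have h2 := har_add_sub_le (N - j.natAbs) j.natAbs (by omega)
  rw [Nat.sub_add_cancel (by omega)] at h2
  have h3 : ((j.natAbs : ℕ) : ℝ) / ((N - j.natAbs : ℕ) : ℝ) ≤ 1 := by
    rw [div_le_one (by exact_mod_cast (by omega : 0 < N - j.natAbs))]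
    exact_mod_cast (by omega : j.natAbs ≤ N - j.natAbs)
  have h4 := har_mono (Nat.sub_le j.natAbs 1)
  linarith

/-- Minus the sum of the kernel over the block `[c, 2c]`. -/
noncomputable def blockSum (c : ℕ) (j : ℤ) : ℝ := -∑ n ∈ Finset.Icc (c : ℤ) (2 * c), ker j n

section Block

variable {c : ℕ}

theorem card_block (hc : 0 < c) : (Finset.Icc (c : ℤ) (2 * c)).card = c + 1 := by
  rw [Int.card_Icc]
  omega

theorem har_block (hc : 0 < c) : har (2 * c) - har (c - 1) ≤ 2 := by
  have h1 := har_add_sub_le c c hc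
  rw [← two_mul, div_self (by exact_mod_cast hc.ne')] at h1
  linarith [har_le_har_pred_add_one c]

theorem blockSum_nonpos {j : ℤ} (hj0 : 0 < j) (hj : j < c) : blockSum c j ≤ 0 := by
  rw [blockSum, neg_nonpos]
  refine Finset.sum_nonneg fun n hn => ?_
  rw [Finset.mem_Icc] at hn
  rw [ker_eq (by omega) (by omega)]
  have h1 : (0 : ℝ) < j := by exact_mod_cast hj0
  have h2 : (j : ℝ) < n := by exact_mod_cast (by omega : j < n)
  exact div_nonneg h1.le (mul_nonneg (by linarith) (by linarith))

theorem neg_le_blockSum {j : ℤ} (hj0 : 0 < j) (hj : 2 * j ≤ c) :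
    -(4 * ((j : ℝ) / c)) ≤ blockSum c j := by
  have hc : 0 < c := by omega
  rw [blockSum, neg_le_neg_iff]
  have hcR : (0 : ℝ) < c := by exact_mod_cast hc
  have h1 : (0 : ℝ) < j := by exact_mod_cast hj0
  have hjc : 2 * (j : ℝ) ≤ c := by exact_mod_cast hj
  have hterm : ∀ n ∈ Finset.Icc (c : ℤ) (2 * c), ker j n ≤ 2 * (j : ℝ) / c ^ 2 := by
    intro n hn
    rw [Finset.mem_Icc] at hn
    rw [ker_eq (by omega) (by omega)]
    have h2 : (c : ℝ) ≤ n := by exact_mod_cast hn.1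
    rw [div_le_div_iff₀ (mul_pos (by linarith) (by linarith)) (by positivity)]
    have h3 : (c : ℝ) ^ 2 ≤ 2 * (n * (n - j)) := by nlinarith
    nlinarith
  refine (Finset.sum_le_card_nsmul _ _ _ hterm).trans ?_
  rw [card_block hc, nsmul_eq_mul, mul_div_assoc', div_le_iff₀ (by positivity)]
  have hc1 : (1 : ℝ) ≤ c := by exact_mod_cast hc
  have e : 4 * ((j : ℝ) / c) * c ^ 2 = 4 * j * c := by field_simp
  rw [e]
  push_cast
  nlinarith

theorem blockSum_le_of_large {j : ℤ} (hc : 0 < c) (hj : 4 * (c : ℤ) ≤ j) : blockSum c j ≤ 3 := by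
  have hcR : (0 : ℝ) < c := by exact_mod_cast hc
  rw [blockSum, ← Finset.sum_neg_distrib]
  have hterm : ∀ n ∈ Finset.Icc (c : ℤ) (2 * c), -ker j n ≤ 3 / (2 * c) := by
    intro n hn
    rw [Finset.mem_Icc] at hn
    have h2 : (c : ℝ) ≤ n := by exact_mod_cast hn.1
    have h3 : (n : ℝ) ≤ 2 * c := by exact_mod_cast hn.2
    have h4 : 4 * (c : ℝ) ≤ j := by exact_mod_cast hj
    have e1 : -ker j n = 1 / ((j : ℝ) - n) + 1 / n := by
      rw [ker, ← neg_sub (j : ℝ), one_div, one_div, one_div, inv_neg]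
      ring
    have e2 : 1 / ((j : ℝ) - n) ≤ 1 / (2 * c) := one_div_le_one_div_of_le (by positivity) (by linarith)
    have e3 : 1 / (n : ℝ) ≤ 1 / c := one_div_le_one_div_of_le hcR h2
    have e4 : 3 / (2 * (c : ℝ)) = 1 / (2 * c) + 1 / c := by field_simp; norm_num
    linarith
  refine (Finset.sum_le_card_nsmul _ _ _ hterm).trans ?_
  rw [card_block hc, nsmul_eq_mul, mul_div_assoc', div_le_iff₀ (by positivity)]
  have hc1 : (1 : ℝ) ≤ c := by exact_mod_cast hc
  push_cast
  nlinarith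

theorem blockSum_le_of_neg {j : ℤ} (hc : 0 < c) (hj : j < 0) :
    blockSum c j ≤ 2 ∧ blockSum c j ≤ 2 * (((j.natAbs : ℕ) : ℝ) / c) := by
  have hcR : (0 : ℝ) < c := by exact_mod_cast hc
  have hc1 : (1 : ℝ) ≤ c := by exact_mod_cast hc
  rw [blockSum, ← Finset.sum_neg_distrib]
  obtain ⟨i, rfl⟩ : ∃ i : ℕ, j = -(i : ℤ) := ⟨j.natAbs, by omega⟩
  have hi : (0 : ℝ) < i := by exact_mod_cast (by omega : 0 < i)
  have e0 : ∀ n ∈ Finset.Icc (c : ℤ) (2 * c), -ker (-(i : ℤ)) n = i / ((n : ℝ) * (n + i)) := by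
    intro n hn
    rw [Finset.mem_Icc] at hn
    rw [ker_eq (by omega) (by omega)]
    push_cast
    rw [neg_div, neg_neg, sub_neg_eq_add]
  constructor
  · have hterm : ∀ n ∈ Finset.Icc (c : ℤ) (2 * c), -ker (-(i : ℤ)) n ≤ 1 / c := by
      intro n hn
      rw [e0 n hn]
      rw [Finset.mem_Icc] at hn
      have h2 : (c : ℝ) ≤ n := by exact_mod_cast hn.1
      rw [div_le_div_iff₀ (mul_pos (by linarith) (by linarith)) hcR]
      nlinarith
    refine (Finset.sum_le_card_nsmul _ _ _ hterm).trans ?_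
    rw [card_block hc, nsmul_eq_mul, mul_div_assoc', div_le_iff₀ (by positivity)]
    push_cast
    linarith
  · have hterm : ∀ n ∈ Finset.Icc (c : ℤ) (2 * c), -ker (-(i : ℤ)) n ≤ i / (c : ℝ) ^ 2 := by
      intro n hn
      rw [e0 n hn]
      rw [Finset.mem_Icc] at hn
      have h2 : (c : ℝ) ≤ n := by exact_mod_cast hn.1
      refine div_le_div_of_nonneg_left hi.le (by positivity) ?_
      nlinarith
    refine (Finset.sum_le_card_nsmul _ _ _ hterm).trans ?_
    rw [card_block hc, nsmul_eq_mul, mul_div_assoc', div_le_iff₀ (by positivity), Int.natAbs_neg,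
      Int.natAbs_natCast]
    have e : 2 * ((i : ℝ) / c) * c ^ 2 = 2 * i * c := by field_simp
    rw [e]
    push_cast
    nlinarith

/-- The logarithm of the distance to the left end minus that of the distance to the right end: very
negative near `c`, very positive near `2 * c`, which therefore becomes a peak of the residues. -/
theorem blockSum_eq (hc : 0 < c) (j : ℤ) :
    blockSum c j = harInt (c - 1 - j) - harInt (2 * c - j) + (har (2 * c) - har (c - 1)) := by
  have h1 : ∀ n ∈ Finset.Icc (c : ℤ) (2 * c), ker j n = 1 / ((n : ℝ) - j) - 1 / (n : ℝ) :=
    fun n _ => rfl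
  rw [blockSum, Finset.sum_congr rfl h1, Finset.sum_sub_distrib,
    sum_Icc_one_div_sub _ _ _ (by omega), sum_Icc_one_div _ _ (by omega)]
  have e1 : harInt (2 * (c : ℤ)) = har (2 * c) := by
    rw [harInt_of_nonneg (by omega)]; exact congrArg har (by omega)
  have e2 : harInt ((c : ℤ) - 1) = har (c - 1) := by
    rw [harInt_of_nonneg (by omega)]; exact congrArg har (by omega)
  rw [e1, e2]
  ring

theorem blockSum_le_of_zone {j : ℤ} (hc : 0 < c) (h1 : (c : ℤ) ≤ j) (h2 : j < 4 * c) :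
    blockSum c j ≤ har (4 * c) - har (j - 2 * c).natAbs + 3 := by
  rw [blockSum_eq hc, harInt_of_neg (m := c - 1 - j) (by omega)]
  have h3 := har_block hc
  have h4 : har (((c : ℤ) - 1 - j).natAbs - 1) ≤ har (4 * c) := har_mono (by omega)
  rcases le_or_gt j (2 * c) with h | h
  · rw [harInt_of_nonneg (m := 2 * c - j) (by omega)]
    have e : (2 * (c : ℤ) - j).natAbs = (j - 2 * c).natAbs := by omega
    rw [e]
    linarith
  · rw [harInt_of_neg (m := 2 * c - j) (by omega)]
    have e : (2 * (c : ℤ) - j).natAbs = (j - 2 * c).natAbs := by omega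
    rw [e]
    linarith [har_le_har_pred_add_one (j - 2 * (c : ℤ)).natAbs]

/-- At the right end the second logarithm is `harInt 0 = 0`, so all of `har c` remains to compensate
the decay of the outward deviations. -/
theorem le_blockSum_center (hc : 0 < c) : har c ≤ blockSum c (2 * c) := by
  rw [blockSum_eq hc, sub_self, harInt_of_neg (by omega), harInt_of_nonneg le_rfl]
  have e : ((c : ℤ) - 1 - 2 * c).natAbs - 1 = c := by omega
  rw [e]
  have := har_mono (by omega : c - 1 ≤ 2 * c)
  simp only [Int.natAbs_zero, har_zero]
  linarith

theorem blockSum_nonneg {j : ℤ} (hj : 2 * (c : ℤ) < j) : 0 ≤ blockSum c j := by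
  rw [blockSum, ← Finset.sum_neg_distrib]
  refine Finset.sum_nonneg fun n hn => ?_
  rw [Finset.mem_Icc] at hn
  have h2 : (0 : ℝ) ≤ n := by exact_mod_cast (by omega : 0 ≤ n)
  have h3 : (n : ℝ) < j := by exact_mod_cast (by omega : n < j)
  have e1 : -ker j n = 1 / ((j : ℝ) - n) + 1 / n := by
    rw [ker, ← neg_sub (j : ℝ), one_div, one_div, one_div, inv_neg]
    ring
  rw [e1]
  have : 0 < (j : ℝ) - n := by linarith
  positivity

end Block

end SpectralSynthesis

/-! ### The frequencies and the exponents of the residues. -/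

namespace SpectralSynthesis

open Filter Topology

/-- The parameters of the construction. -/
structure Params where
  α : ℝ
  β : ℝ
  E : ℕ
  half_lt : 1 / 2 < α
  lt : α < 3 / 4
  beta_ne : ∀ m : ℤ, β ≠ m
  -- These two conditions keep `λ_0 = β` apart from all the frequencies `n ± α`.
  beta_add : ∀ m : ℤ, β + α ≠ m
  beta_sub : ∀ m : ℤ, β - α ≠ m
  four_le : 4 ≤ E
  -- Each block to the left of a point costs at most a factor `e^6` in the residue there; under this
  -- condition `k + 1` such factors are at most `x_k ^ ε`.
  exp_le : Real.exp 6 ≤ (E : ℝ) ^ (α - 1 / 2)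
  beta_le : |β| + 1 ≤ E

namespace Params

variable (P : Params)

/-- The excess of the deviation over `1/2`. -/
noncomputable def ε : ℝ := P.α - 1 / 2

/-- The scales. -/
def x (k : ℕ) : ℕ := P.E ^ (k + 1)

/-- The left end points of the blocks. -/
def c (k : ℕ) : ℕ := P.x k ^ 4

theorem eps_pos : 0 < P.ε := by
  have := P.half_lt
  rw [ε]; linarith

theorem eps_lt : P.ε < 1 / 4 := by
  have := P.lt
  rw [ε]; linarith

theorem two_alpha : 2 * P.α = 1 + 2 * P.ε := by rw [ε]; ring

theorem x_succ (k : ℕ) : P.x (k + 1) = P.E * P.x k := by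
  rw [x, x, pow_succ, mul_comm]

theorem four_le_x (k : ℕ) : 4 ≤ P.x k := by
  rw [x]
  exact P.four_le.trans (Nat.le_self_pow (by omega) _)

theorem x_pos (k : ℕ) : 0 < P.x k := by have := P.four_le_x k; omega

theorem c_pos (k : ℕ) : 0 < P.c k := pow_pos (P.x_pos k) 4

theorem E_le_x (k : ℕ) : P.E ≤ P.x k := Nat.le_self_pow (by omega) _

theorem x_le_c (k : ℕ) : P.x k ≤ P.c k := Nat.le_self_pow (by omega) _

theorem x_strictMono : StrictMono P.x := strictMono_nat_of_lt_succ fun k => by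
  rw [x_succ]
  nlinarith [P.four_le, P.x_pos k]

theorem c_succ (k : ℕ) : 16 * P.c k ≤ P.c (k + 1) := by
  rw [c, c, x_succ, mul_pow]
  refine Nat.mul_le_mul_right _ ?_
  calc 16 ≤ 4 ^ 4 := by norm_num
    _ ≤ _ := Nat.pow_le_pow_left P.four_le 4

theorem c_strictMono : StrictMono P.c := strictMono_nat_of_lt_succ fun k => by
  have := P.c_succ k
  have := P.c_pos k
  omega

theorem c_le_of_lt {k l : ℕ} (h : k < l) : 16 * P.c k ≤ P.c l :=
  (P.c_succ k).trans (P.c_strictMono.monotone h)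

theorem lt_of_c_lt {k l : ℕ} (h : P.c k < 16 * P.c l) : k ≤ l := by
  by_contra hkl
  have := P.c_le_of_lt (not_le.1 hkl)
  omega

open Classical in
/-- The deviations of the frequencies at nonzero integers (and `0` at `0`). -/
noncomputable def D (n : ℤ) : ℝ :=
  if n = 0 then 0 else
    if n < 0 ∨ ∃ k, (P.c k : ℤ) ≤ n ∧ n ≤ 2 * P.c k then -P.α else P.α

/-- The frequencies. -/
noncomputable def lam (n : ℤ) : ℝ := if n = 0 then P.β else n + P.D n

theorem lam_zero : P.lam 0 = P.β := by simp [lam]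

theorem lam_of_ne {n : ℤ} (hn : n ≠ 0) : P.lam n = n + P.D n := by simp [lam, hn]

theorem D_zero : P.D 0 = 0 := by simp [D]

theorem D_eq_or {n : ℤ} (hn : n ≠ 0) : P.D n = -P.α ∨ P.D n = P.α := by
  simp only [D, hn, if_false]
  split_ifs
  · exact Or.inl rfl
  · exact Or.inr rfl

theorem D_of_notMem {n : ℤ} (hn : 0 < n) (h : ∀ k, ¬ ((P.c k : ℤ) ≤ n ∧ n ≤ 2 * P.c k)) :
    P.D n = P.α := by
  rw [D, if_neg hn.ne', if_neg]
  rintro (h1 | ⟨k, hk⟩)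
  · omega
  · exact h k hk

theorem abs_D {n : ℤ} (hn : n ≠ 0) : |P.D n| = P.α := by
  have := P.half_lt
  rcases P.D_eq_or hn with h | h <;> rw [h]
  · rw [abs_neg, abs_of_pos (by linarith)]
  · rw [abs_of_pos (by linarith)]

theorem abs_D_le (n : ℤ) : |P.D n| ≤ 3 / 4 := by
  by_cases hn : n = 0
  · rw [hn, D_zero]; norm_num
  · rw [P.abs_D hn]; exact P.lt.le

theorem alpha_int (m : ℤ) : 1 / 4 ≤ |P.α - m| ∧ 1 / 4 ≤ |-P.α - m| := by
  have h1 := P.half_lt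
  have h2 := P.lt
  constructor
  · rcases le_or_gt m 0 with h | h
    · have : (m : ℝ) ≤ 0 := by exact_mod_cast h
      exact le_trans (by linarith) (le_abs_self _)
    · have : (1 : ℝ) ≤ m := by exact_mod_cast h
      exact le_trans (by linarith) (neg_le_abs _)
  · rcases le_or_gt m (-1) with h | h
    · have : (m : ℝ) ≤ -1 := by exact_mod_cast h
      exact le_trans (by linarith) (le_abs_self _)
    · have : (0 : ℝ) ≤ m := by exact_mod_cast (by omega : 0 ≤ m)
      exact le_trans (by linarith) (neg_le_abs _)

theorem exists_dist : ∃ e > 0, ∀ n m : ℤ, e ≤ |P.lam n - m| := by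
  obtain ⟨C, hC, h⟩ := abs_int_add_one_le_mul P.β P.beta_ne
  refine ⟨min (1 / 4) (1 / C), by positivity, fun n m => ?_⟩
  by_cases hn : n = 0
  · rw [hn, lam_zero, abs_sub_comm]
    refine (min_le_right _ _).trans ?_
    rw [div_le_iff₀ hC, mul_comm]
    linarith [h m, abs_nonneg (m : ℝ)]
  · rw [P.lam_of_ne hn]
    refine (min_le_left _ _).trans ?_
    have h1 := P.alpha_int (m - n)
    push_cast at h1
    rcases P.D_eq_or hn with e | e <;> rw [e]
    · rw [show (n : ℝ) + -P.α - m = -P.α - (m - n) by ring]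
      exact h1.2
    · rw [show (n : ℝ) + P.α - m = P.α - (m - n) by ring]
      exact h1.1

theorem lam_ne_int (n m : ℤ) : P.lam n ≠ m := by
  obtain ⟨e, he, h⟩ := P.exists_dist
  intro hnm
  have := h n m
  rw [hnm, sub_self, abs_zero] at this
  linarith

theorem lam_injective : Function.Injective P.lam := by
  have hα := P.half_lt
  have hα' := P.lt
  have hmix : ∀ n m : ℤ, (n : ℝ) + P.α ≠ m + -P.α := by
    intro n m h
    have h1 : 2 * P.α = ((m - n : ℤ) : ℝ) := by push_cast; linarith
    have h2 : (1 : ℝ) < ((m - n : ℤ) : ℝ) := by linarith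
    have h3 : ((m - n : ℤ) : ℝ) < 2 := by linarith
    have h4 : 1 < m - n := by exact_mod_cast h2
    have h5 : m - n < 2 := by exact_mod_cast h3
    omega
  have hβ : ∀ n : ℤ, n ≠ 0 → P.lam n ≠ P.β := by
    intro n hn h
    rw [P.lam_of_ne hn] at h
    rcases P.D_eq_or hn with e | e <;> rw [e] at h
    · exact P.beta_add n (by linarith)
    · exact P.beta_sub n (by linarith)
  intro n m h
  by_cases hn : n = 0
  · by_contra hm
    rw [hn, lam_zero] at h
    exact hβ m (fun e => hm (by rw [hn, e])) h.symm
  by_cases hm : m = 0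
  · rw [hm, lam_zero] at h
    exact absurd h (hβ n hn)
  rw [P.lam_of_ne hn, P.lam_of_ne hm] at h
  rcases P.D_eq_or hn with e | e <;> rcases P.D_eq_or hm with e' | e' <;> rw [e, e'] at h
  · exact_mod_cast add_right_cancel h
  · exact absurd h.symm (hmix m n)
  · exact absurd h (hmix n m)
  · exact_mod_cast add_right_cancel h

theorem abs_lam_sub_le (n : ℤ) : |P.lam n - n| ≤ max P.α |P.β| := by
  by_cases hn : n = 0
  · rw [hn, lam_zero]; simp
  · rw [P.lam_of_ne hn, add_sub_cancel_left, P.abs_D hn]; exact le_max_left _ _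

/-- The truncation levels. -/
def lev (K : ℕ) : ℕ := 4 * P.c K

theorem lev_tendsto : Tendsto P.lev atTop atTop := by
  refine tendsto_atTop_mono (fun K => ?_) P.c_strictMono.tendsto_atTop
  rw [lev]; omega

/-- The level `4 * c K` lies between block `K` and the next one, so no block is cut. The blocks are
disjoint, so at most one indicator is nonzero. -/
theorem D_eq {K : ℕ} {n : ℤ} (hn : n ∈ win (P.lev K)) :
    P.D n = P.α * ((Int.sign n : ℤ) : ℝ) - 2 * P.α * ∑ k ∈ Finset.range (K + 1),
      if n ∈ Finset.Icc (P.c k : ℤ) (2 * P.c k) then (1 : ℝ) else 0 := by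
  rw [win, lev, Finset.mem_Icc] at hn
  rcases lt_trichotomy n 0 with h | h | h
  · rw [Finset.sum_eq_zero, Int.sign_eq_neg_one_of_neg h]
    · rw [D, if_neg h.ne, if_pos (Or.inl h)]
      push_cast
      ring
    · intro k _
      have := P.c_pos k
      rw [if_neg]
      rw [Finset.mem_Icc]
      omega
  · subst h
    rw [Finset.sum_eq_zero]
    · simp [D_zero]
    · intro k _
      have := P.c_pos k
      rw [if_neg]
      rw [Finset.mem_Icc]
      omega
  · rw [Int.sign_eq_one_of_pos h]
    by_cases hb : ∃ k, (P.c k : ℤ) ≤ n ∧ n ≤ 2 * P.c k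
    · rw [D, if_neg h.ne', if_pos (Or.inr hb)]
      obtain ⟨k, hk⟩ := hb
      have hkK : k ≤ K := P.lt_of_c_lt (by push_cast at hn; omega)
      rw [Finset.sum_eq_single k]
      · rw [if_pos (Finset.mem_Icc.2 hk)]
        push_cast
        ring
      · intro l _ hlk
        rw [if_neg]
        rw [Finset.mem_Icc]
        rintro ⟨h1, h2⟩
        have h3 := P.lt_of_c_lt (k := k) (l := l) (by omega)
        have h4 := P.lt_of_c_lt (k := l) (l := k) (by omega)
        omega
      · intro hk'
        exact absurd (Finset.mem_range.2 (by omega)) hk'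
    · rw [P.D_of_notMem h fun k hk => hb ⟨k, hk⟩, Finset.sum_eq_zero]
      · push_cast
        ring
      · intro k _
        rw [if_neg]
        intro hk
        exact hb ⟨k, Finset.mem_Icc.1 hk⟩

theorem block_subset {K k : ℕ} (hk : k ∈ Finset.range (K + 1)) :
    Finset.Icc (P.c k : ℤ) (2 * P.c k) ⊆ win (P.lev K) := by
  intro n hn
  rw [Finset.mem_Icc] at hn
  rw [win, lev, Finset.mem_Icc]
  have h1 : P.c k ≤ P.c K := P.c_strictMono.monotone (by rw [Finset.mem_range] at hk; omega)
  have := P.c_pos k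
  push_cast
  omega

theorem sum_D_mul (K : ℕ) (f : ℤ → ℝ) :
    ∑ n ∈ win (P.lev K), P.D n * f n = P.α * ∑ n ∈ win (P.lev K), ((Int.sign n : ℤ) : ℝ) * f n +
      2 * P.α * ∑ k ∈ Finset.range (K + 1), -∑ n ∈ Finset.Icc (P.c k : ℤ) (2 * P.c k), f n := by
  have h1 : ∀ k ∈ Finset.range (K + 1), ∑ n ∈ Finset.Icc (P.c k : ℤ) (2 * P.c k), f n =
      ∑ n ∈ win (P.lev K), (if n ∈ Finset.Icc (P.c k : ℤ) (2 * P.c k) then (1 : ℝ) else 0) * f n := by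
    intro k hk
    simp only [ite_mul, one_mul, zero_mul]
    rw [Finset.sum_ite_mem, Finset.inter_eq_right.2 (P.block_subset hk)]
  rw [Finset.sum_neg_distrib, Finset.sum_congr rfl h1, Finset.sum_comm, Finset.mul_sum, mul_neg,
    Finset.mul_sum, ← sub_eq_add_neg, ← Finset.sum_sub_distrib]
  refine Finset.sum_congr rfl fun n hn => ?_
  rw [P.D_eq hn, ← Finset.sum_mul]
  ring

/-- The exponent that governs the size of the residue at `j`. -/
noncomputable def T (K : ℕ) (j : ℤ) : ℝ := ∑ n ∈ win (P.lev K), P.D n * ker j n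

theorem T_eq (K : ℕ) (j : ℤ) :
    P.T K j = P.α * ∑ n ∈ win (P.lev K), ((Int.sign n : ℤ) : ℝ) * ker j n +
      2 * P.α * ∑ k ∈ Finset.range (K + 1), blockSum (P.c k) j :=
  P.sum_D_mul K (ker j)

theorem sum_ratio_le (i M : ℕ) :
    ∑ k ∈ Finset.range M, (if i < P.c k then (i : ℝ) / P.c k else 0) ≤ 2 := by
  -- A geometric series; the induction carries the remainder `2 * (i / c M)` that is still
  -- available.
  have key : ∀ M, ∑ k ∈ Finset.range M, (if i < P.c k then (i : ℝ) / P.c k else 0) ≤ 2 ∧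
      (i < P.c M → ∑ k ∈ Finset.range M, (if i < P.c k then (i : ℝ) / P.c k else 0) ≤
        2 - 2 * ((i : ℝ) / P.c M)) := by
    intro M
    induction M with
    | zero =>
      refine ⟨by simp, fun h => ?_⟩
      have h0 : (0 : ℝ) < P.c 0 := by exact_mod_cast P.c_pos 0
      have : (i : ℝ) / P.c 0 ≤ 1 := by
        rw [div_le_one h0]
        exact_mod_cast h.le
      simp only [Finset.range_zero, Finset.sum_empty]
      linarith
    | succ M ih =>
      have h1 : (0 : ℝ) < P.c (M + 1) := by exact_mod_cast P.c_pos (M + 1)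
      by_cases h : i < P.c M
      · have h0 : (0 : ℝ) < P.c M := by exact_mod_cast P.c_pos M
        have h2 : (i : ℝ) / P.c (M + 1) ≤ (i : ℝ) / P.c M / 2 := by
          rw [div_div]
          refine div_le_div_of_nonneg_left (by positivity) (by positivity) ?_
          have := P.c_succ M
          have : P.c M * 2 ≤ P.c (M + 1) := by omega
          exact_mod_cast this
        have h3 : 0 ≤ (i : ℝ) / P.c M := by positivity
        have h4 := ih.2 h
        rw [Finset.sum_range_succ, if_pos h]
        exact ⟨by linarith, fun _ => by linarith⟩
      · have hz : ∑ k ∈ Finset.range (M + 1), (if i < P.c k then (i : ℝ) / P.c k else 0) = 0 := by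
          refine Finset.sum_eq_zero fun k hk => if_neg ?_
          have := P.c_strictMono.monotone (by rw [Finset.mem_range] at hk; omega : k ≤ M)
          omega
        rw [hz]
        refine ⟨by norm_num, fun h2 => ?_⟩
        have : (i : ℝ) / P.c (M + 1) ≤ 1 := by
          rw [div_le_one h1]
          exact_mod_cast h2.le
        linarith
  exact (key M).1

/-- In the zone `har |j|` and `har (4 * c k)` differ by a constant, so the gain from block `k`
cancels the general decay and only the distance to the center counts. Earlier blocks cost at most 3
each before the factor `2α < 3 / 2`, later ones nothing. -/
theorem T_le_zone {K k : ℕ} {j : ℤ} (hj : j ∈ win (P.lev K)) (h1 : (P.c k : ℤ) ≤ j)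
    (h2 : j < 4 * P.c k) :
    P.T K j ≤ 6 * k - 2 * P.α * har (j - 2 * P.c k).natAbs + 12 := by
  have hα := P.half_lt
  have hα' := P.lt
  have hc := P.c_pos k
  have hj0 : j ≠ 0 := by omega
  have hb := sum_win_sign_mul_ker_le (P.lev K) j hj0 hj
  have hsum : ∑ l ∈ Finset.range (K + 1), blockSum (P.c l) j ≤
      3 * k + (har (4 * P.c k) - har (j - 2 * P.c k).natAbs + 3) := by
    have hkK : k ∈ Finset.range (K + 1) := by
      rw [win, lev, Finset.mem_Icc] at hj
      have := P.lt_of_c_lt (k := k) (l := K) (by push_cast at hj; omega)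
      rw [Finset.mem_range]; omega
    have hterm : ∀ l ∈ (Finset.range (K + 1)).erase k,
        blockSum (P.c l) j ≤ if l < k then 3 else 0 := by
      intro l hl
      obtain ⟨hlk, -⟩ := Finset.mem_erase.1 hl
      split_ifs with h
      · have := P.c_le_of_lt h
        exact blockSum_le_of_large (P.c_pos l) (by omega)
      · have := P.c_le_of_lt (by omega : k < l)
        exact blockSum_nonpos (by omega) (by omega)
    rw [← Finset.add_sum_erase _ _ hkK, add_comm]
    refine add_le_add ((Finset.sum_le_sum hterm).trans ?_) (blockSum_le_of_zone hc h1 h2)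
    rw [← Finset.sum_filter, Finset.sum_const, nsmul_eq_mul, mul_comm]
    gcongr
    calc _ ≤ (Finset.range k).card := Finset.card_le_card fun l hl => by
          rw [Finset.mem_filter] at hl
          exact Finset.mem_range.2 hl.2
      _ = k := Finset.card_range k
  have hH : har (4 * P.c k) - har j.natAbs ≤ 3 := by
    have h3 := har_add_sub_le (P.c k) (3 * P.c k) hc
    have h4 : har (P.c k) ≤ har j.natAbs := har_mono (by omega)
    have e : P.c k + 3 * P.c k = 4 * P.c k := by ring
    rw [e] at h3
    have hcR : (P.c k : ℝ) ≠ 0 := by exact_mod_cast hc.ne'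
    have e2 : ((3 * P.c k : ℕ) : ℝ) / P.c k = 3 := by push_cast; field_simp
    rw [e2] at h3
    linarith
  rw [T_eq]
  have hk0 : (0 : ℝ) ≤ k := by positivity
  have s1 := mul_le_mul_of_nonneg_left hb (by linarith : 0 ≤ P.α)
  have s2 := mul_le_mul_of_nonneg_left hsum (by linarith : 0 ≤ 2 * P.α)
  have s3 := mul_le_mul_of_nonneg_left hH (by linarith : 0 ≤ 2 * P.α)
  nlinarith

/-- Off the zones no block is resonant: those with `c k ≤ |j|` cost at most 3 each, those farther
out a geometric sum. -/
theorem T_le_off {K : ℕ} {j : ℤ} (hj : j ∈ win (P.lev K)) (hj0 : j ≠ 0)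
    (hoff : ∀ k, ¬ ((P.c k : ℤ) ≤ j ∧ j < 4 * P.c k)) :
    P.T K j ≤ 6 * (((Finset.range (K + 1)).filter fun k => P.c k ≤ j.natAbs).card : ℝ) -
      2 * P.α * har j.natAbs + 12 := by
  have hα := P.half_lt
  have hα' := P.lt
  set κ := ((Finset.range (K + 1)).filter fun k => P.c k ≤ j.natAbs).card with hκ
  have hb := sum_win_sign_mul_ker_le (P.lev K) j hj0 hj
  have hsum : ∑ l ∈ Finset.range (K + 1), blockSum (P.c l) j ≤ 3 * κ + 4 := by
    have hterm : ∀ l ∈ Finset.range (K + 1), blockSum (P.c l) j ≤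
        (if P.c l ≤ j.natAbs then 3 else 0) +
        2 * (if j.natAbs < P.c l then ((j.natAbs : ℕ) : ℝ) / P.c l else 0) := by
      intro l _
      have hl := P.c_pos l
      by_cases h : P.c l ≤ j.natAbs
      · rw [if_pos h, if_neg (by omega)]
        rcases lt_or_gt_of_ne hj0 with h0 | h0
        · linarith [(blockSum_le_of_neg (P.c_pos l) h0).1]
        · have h3 : 4 * (P.c l : ℤ) ≤ j := by
            by_contra h4
            exact hoff l ⟨by omega, by omega⟩
          linarith [blockSum_le_of_large hl h3]
      · rw [if_neg h, if_pos (by omega)]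
        rcases lt_or_gt_of_ne hj0 with h0 | h0
        · linarith [(blockSum_le_of_neg (P.c_pos l) h0).2]
        · have := blockSum_nonpos (c := P.c l) (j := j) h0 (by omega)
          have : 0 ≤ ((j.natAbs : ℕ) : ℝ) / P.c l := by positivity
          linarith
    refine (Finset.sum_le_sum hterm).trans ?_
    rw [Finset.sum_add_distrib, ← Finset.mul_sum, ← Finset.sum_filter, Finset.sum_const,
      nsmul_eq_mul, ← hκ]
    linarith [P.sum_ratio_le j.natAbs (K + 1)]
  rw [T_eq]
  have hk0 : (0 : ℝ) ≤ κ := by positivity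
  have s1 := mul_le_mul_of_nonneg_left hb (by linarith : 0 ≤ P.α)
  have s2 := mul_le_mul_of_nonneg_left hsum (by linarith : 0 ≤ 2 * P.α)
  nlinarith

/-- At the center the two logarithms cancel, earlier blocks contribute nonnegative terms, and later
blocks cost a geometric sum. Hence the bound is uniform in `k` and `K`. -/
theorem le_T_center {K k : ℕ} (hkK : k ≤ K) : -16 ≤ P.T K (2 * P.c k) := by
  have hα := P.half_lt
  have hα' := P.lt
  have hc := P.c_pos k
  have hcK : P.c k ≤ P.c K := P.c_strictMono.monotone hkK
  have hnat : (2 * (P.c k : ℤ)).natAbs = 2 * P.c k := by omega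
  have hb := le_sum_win_sign_mul_ker (P.lev K) (2 * P.c k) (by omega) (by rw [hnat, lev]; omega)
  rw [hnat] at hb
  have hsum : har (P.c k) - 8 ≤ ∑ l ∈ Finset.range (K + 1), blockSum (P.c l) (2 * P.c k) := by
    have hkK' : k ∈ Finset.range (K + 1) := Finset.mem_range.2 (by omega)
    have hterm : ∀ l ∈ (Finset.range (K + 1)).erase k,
        -(4 * (if 2 * P.c k < P.c l then ((2 * P.c k : ℕ) : ℝ) / P.c l else 0)) ≤
          blockSum (P.c l) (2 * P.c k) := by
      intro l hl
      obtain ⟨hlk, -⟩ := Finset.mem_erase.1 hl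
      rcases lt_or_gt_of_ne hlk with h | h
      · have := P.c_le_of_lt h
        rw [if_neg (by omega)]
        have := blockSum_nonneg (c := P.c l) (j := 2 * P.c k) (by omega)
        linarith
      · have := P.c_le_of_lt h
        rw [if_pos (by omega)]
        have h3 := neg_le_blockSum (c := P.c l) (j := 2 * P.c k) (by omega) (by omega)
        push_cast at h3 ⊢
        exact h3
    rw [← Finset.add_sum_erase _ _ hkK']
    have h1 := le_blockSum_center hc
    have h2 := Finset.sum_le_sum hterm
    rw [Finset.sum_neg_distrib, ← Finset.mul_sum] at h2
    have h3 : ∑ l ∈ (Finset.range (K + 1)).erase k,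
        (if 2 * P.c k < P.c l then ((2 * P.c k : ℕ) : ℝ) / P.c l else 0) ≤ 2 := by
      refine le_trans ?_ (P.sum_ratio_le (2 * P.c k) (K + 1))
      refine Finset.sum_le_sum_of_subset_of_nonneg (Finset.erase_subset _ _) fun i _ _ => ?_
      split_ifs <;> positivity
    linarith
  have hH : har (2 * P.c k) - har (P.c k) ≤ 1 := by
    have h3 := har_add_sub_le (P.c k) (P.c k) hc
    rwa [← two_mul, div_self (by exact_mod_cast hc.ne')] at h3
  rw [T_eq]
  have s1 := mul_le_mul_of_nonneg_left hb (by linarith : 0 ≤ P.α)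
  have s2 := mul_le_mul_of_nonneg_left hsum (by linarith : 0 ≤ 2 * P.α)
  have s3 := mul_le_mul_of_nonneg_left hH (by linarith : 0 ≤ 2 * P.α)
  nlinarith

end Params

end SpectralSynthesis

/-! ### Bounds for the residues and the leading coefficients. -/

namespace SpectralSynthesis

open Filter Topology

/-- The sum of the inverse squares of the nonzero integers. -/
noncomputable def sumInvSq : ℝ := ∑' n : ℤ, 1 / (n : ℝ) ^ 2

theorem sum_inv_sub_sq_le (s : Finset ℤ) (j : ℤ) :
    ∑ n ∈ s, 1 / ((n : ℝ) - j) ^ 2 ≤ sumInvSq := by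
  have h : Summable fun n : ℤ => 1 / (n : ℝ) ^ 2 := Real.summable_one_div_int_pow.2 (by norm_num)
  have e : ∑ n ∈ s, 1 / ((n : ℝ) - j) ^ 2 =
      ∑ n ∈ s.map (Equiv.subRight j).toEmbedding, 1 / (n : ℝ) ^ 2 := by
    rw [Finset.sum_map]
    refine Finset.sum_congr rfl fun n _ => ?_
    simp
  rw [e]
  exact h.sum_le_tsum _ fun n _ => by positivity

theorem sumInvSq_nonneg : 0 ≤ sumInvSq := tsum_nonneg fun n => by positivity

theorem sum_win_inv_abs (N : ℕ) : ∑ n ∈ win N, 1 / |(n : ℝ)| = 2 * har N := by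
  induction N with
  | zero => simp [win, har_zero]
  | succ N ih =>
    have h : win (N + 1) = insert ((N : ℤ) + 1) (insert (-((N : ℤ) + 1)) (win N)) := by
      ext i
      simp only [win, Finset.mem_insert, Finset.mem_Icc]
      push_cast
      omega
    rw [h, Finset.sum_insert, Finset.sum_insert, ih, har_succ]
    · push_cast
      rw [abs_neg, abs_of_pos (by positivity)]
      ring
    · simp only [win, Finset.mem_Icc]; omega
    · simp only [win, Finset.mem_insert, Finset.mem_Icc]; omega

/-- `(1 + w) (1 - w + 4w²) = 1 + w² (3 + 4w)`, and `3 + 4w ≥ 0` is what the bound `3 / 4` provides.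
This is why `α < 3 / 4` is imposed. -/
theorem inv_one_add_le_exp {w : ℝ} (hw : |w| ≤ 3 / 4) :
    (1 + w)⁻¹ ≤ Real.exp (-w + 4 * w ^ 2) := by
  have h := abs_le.1 hw
  have h1 : 0 < 1 + w := by linarith
  refine le_trans ?_ (Real.add_one_le_exp _)
  rw [inv_le_iff_one_le_mul₀ h1]
  nlinarith [mul_nonneg (sq_nonneg w) (by linarith : 0 ≤ 3 + 4 * w)]

theorem exp_le_one_add {w : ℝ} (hw : |w| ≤ 3 / 4) : Real.exp (w - 4 * w ^ 2) ≤ 1 + w := by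
  have h := abs_le.1 hw
  have h1 : 0 < 1 + w := by linarith
  have h2 := inv_one_add_le_exp hw
  rw [inv_le_comm₀ h1 (Real.exp_pos _), ← Real.exp_neg] at h2
  rwa [neg_add, neg_neg, ← sub_eq_add_neg] at h2

theorem abs_div_int_le {d : ℝ} (hd : |d| ≤ 3 / 4) {m : ℤ} (hm : m ≠ 0) : |d / (m : ℝ)| ≤ 3 / 4 := by
  have h1 : (1 : ℝ) ≤ |(m : ℝ)| := by exact_mod_cast Int.one_le_abs hm
  rw [abs_div]
  exact (div_le_self (abs_nonneg _) h1).trans hd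

theorem div_sq_le {d : ℝ} (hd : |d| ≤ 3 / 4) (y : ℝ) : (d / y) ^ 2 ≤ 1 / y ^ 2 := by
  rw [div_pow]
  refine div_le_div_of_nonneg_right ?_ (sq_nonneg _)
  rw [← sq_abs]
  nlinarith [abs_nonneg d]

namespace Params

variable (P : Params)

theorem beta_abs_pos : 0 < |P.β| := abs_pos.2 (by simpa using P.beta_ne 0)

theorem abs_div_D {n : ℤ} (hn : n ≠ 0) : |P.D n / (n : ℝ)| ≤ 3 / 4 :=
  abs_div_int_le (P.abs_D_le n) hn

theorem abs_leadCoeff (N : ℕ) :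
    |leadCoeff P.lam N| = |P.β|⁻¹ * ∏ n ∈ (win N).erase 0, (1 + P.D n / (n : ℝ))⁻¹ := by
  rw [leadCoeff, abs_mul, Finset.abs_prod, lam_zero, abs_div, abs_neg, abs_one, one_div]
  congr 1
  refine Finset.prod_congr rfl fun n hn => ?_
  have hn0 := (Finset.mem_erase.1 hn).1
  have hn1 : (n : ℝ) ≠ 0 := by exact_mod_cast hn0
  have h := abs_le.1 (P.abs_div_D hn0)
  rw [P.lam_of_ne hn0, show (n : ℝ) + P.D n = n * (1 + P.D n / n) by field_simp,
    ← div_div, div_self hn1, one_div, abs_inv, abs_of_pos (by linarith)]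

theorem abs_leadCoeff_le (N : ℕ) :
    |leadCoeff P.lam N| ≤
      |P.β|⁻¹ * Real.exp (-(∑ n ∈ win N, P.D n * (1 / (n : ℝ))) + 4 * sumInvSq) := by
  rw [abs_leadCoeff]
  refine mul_le_mul_of_nonneg_left ?_ (by positivity)
  refine (Finset.prod_le_prod (fun n hn => ?_) fun n hn =>
    inv_one_add_le_exp (P.abs_div_D (Finset.mem_erase.1 hn).1)).trans ?_
  · have h := abs_le.1 (P.abs_div_D (Finset.mem_erase.1 hn).1)
    exact inv_nonneg.2 (by linarith)
  rw [← Real.exp_sum, Real.exp_le_exp, Finset.sum_add_distrib, ← Finset.mul_sum]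
  refine add_le_add ?_ (mul_le_mul_of_nonneg_left ?_ (by norm_num))
  · rw [Finset.sum_neg_distrib, Finset.sum_erase]
    · exact le_of_eq (by simp only [mul_one_div])
    · simp
  · refine (Finset.sum_le_sum fun n _ => div_sq_le (P.abs_D_le n) (n : ℝ)).trans ?_
    simpa using sum_inv_sub_sq_le ((win N).erase 0) 0

theorem abs_leadCoeff_inv_le (N : ℕ) :
    |(leadCoeff P.lam N)⁻¹| ≤ |P.β| * Real.exp (2 * har N) := by
  rw [abs_inv, abs_leadCoeff, mul_inv, inv_inv, ← Finset.prod_inv_distrib]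
  refine mul_le_mul_of_nonneg_left ?_ (by positivity)
  refine (Finset.prod_le_prod (fun n hn => ?_) fun n hn => ?_).trans (b :=
    ∏ n ∈ (win N).erase 0, Real.exp (1 / |(n : ℝ)|)) ?_
  · have h := abs_le.1 (P.abs_div_D (Finset.mem_erase.1 hn).1)
    rw [inv_inv]; linarith
  · rw [inv_inv, add_comm]
    refine (Real.add_one_le_exp _).trans (Real.exp_le_exp.2 ((le_abs_self _).trans ?_))
    rw [abs_div]
    exact div_le_div_of_nonneg_right ((P.abs_D_le n).trans (by norm_num)) (abs_nonneg _)
  · rw [← Real.exp_sum, Real.exp_le_exp, ← sum_win_inv_abs, Finset.sum_erase]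
    simp

/-- The indices 0 and `j` are split off, because the deviation at 0 need not be small and `n - j`
vanishes at `j`. The logarithm of what remains is `∑ D n * ker j n` up to a bounded sum of squares.
-/
theorem abs_res_eq {N : ℕ} {j : ℤ} (hj0 : j ≠ 0) (hj : j ∈ win N) :
    |res P.lam N j| = |(j : ℝ) - P.β| * |P.D j| / (|P.β| * |P.lam j|) *
      ∏ n ∈ ((win N).erase 0).erase j, ((1 + P.D n / ((n : ℝ) - j)) * (1 + P.D n / (n : ℝ))⁻¹) := by
  have hj' : j ∈ (win N).erase 0 := Finset.mem_erase.2 ⟨hj0, hj⟩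
  have h0' : (0 : ℤ) ∈ (win N).erase j := Finset.mem_erase.2 ⟨hj0.symm, zero_mem_win N⟩
  have hjR : (j : ℝ) ≠ 0 := by exact_mod_cast hj0
  have hβ := P.beta_abs_pos
  have hlam : P.lam j ≠ 0 := by simpa using P.lam_ne_int j 0
  rw [res, leadCoeff, ← Finset.mul_prod_erase _ _ hj', ← Finset.mul_prod_erase _ _ h0',
    ← Finset.mul_prod_erase _ _ (zero_mem_win N), ← Finset.mul_prod_erase _ _ hj',
    Finset.erase_right_comm (a := j) (b := 0)]
  have e1 : (j : ℝ) - P.lam j = -P.D j := by rw [P.lam_of_ne hj0]; ring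
  rw [e1, lam_zero]
  simp only [abs_mul, Finset.abs_prod, abs_div, abs_neg, abs_one, abs_inv, Int.cast_zero, sub_zero]
  have hprod : ∏ n ∈ ((win N).erase 0).erase j,
      ((1 + P.D n / ((n : ℝ) - j)) * (1 + P.D n / (n : ℝ))⁻¹) =
      (∏ n ∈ ((win N).erase 0).erase j, |(n : ℝ)| / |P.lam n|) *
      (∏ n ∈ ((win N).erase 0).erase j, |(j : ℝ) - P.lam n|) *
      ∏ n ∈ ((win N).erase 0).erase j, |(j : ℝ) - n|⁻¹ := by
    rw [← Finset.prod_mul_distrib, ← Finset.prod_mul_distrib]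
    refine Finset.prod_congr rfl fun n hn => ?_
    obtain ⟨hnj, hn⟩ := Finset.mem_erase.1 hn
    have hn0 := (Finset.mem_erase.1 hn).1
    have hn1 : (n : ℝ) ≠ 0 := by exact_mod_cast hn0
    have hnj1 : (n : ℝ) - j ≠ 0 := sub_ne_zero.2 (by exact_mod_cast hnj)
    have h1 := abs_le.1 (P.abs_div_D hn0)
    have h2 := abs_le.1 (abs_div_int_le (P.abs_D_le n) (sub_ne_zero.2 hnj))
    push_cast at h2
    have e2 : (j : ℝ) - P.lam n = -((n - j) * (1 + P.D n / (n - j))) := by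
      rw [P.lam_of_ne hn0]; field_simp; ring
    rw [e2, P.lam_of_ne hn0, show (n : ℝ) + P.D n = n * (1 + P.D n / n) by field_simp,
      abs_neg, abs_mul, abs_mul, abs_of_pos (by linarith : 0 < 1 + P.D n / (n : ℝ)),
      abs_of_pos (by linarith : 0 < 1 + P.D n / ((n : ℝ) - j)), abs_sub_comm (j : ℝ)]
    have h3 : |(n : ℝ)| ≠ 0 := abs_ne_zero.2 hn1
    have h4 : |(n : ℝ) - j| ≠ 0 := abs_ne_zero.2 hnj1
    have h5 : 1 + P.D n / (n : ℝ) ≠ 0 := by linarith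
    generalize 1 + P.D n / (n : ℝ) = A at *
    generalize 1 + P.D n / ((n : ℝ) - j) = B at *
    field_simp
  rw [hprod]
  have h3 : |(j : ℝ)| ≠ 0 := abs_ne_zero.2 hjR
  have h4 : |P.lam j| ≠ 0 := abs_ne_zero.2 hlam
  field_simp

/-- `T` contains the term `n = j`, where the kernel is `-1 / j` because `1 / 0 = 0`; the term `n =
0` vanishes with `D 0`. -/
theorem sum_erase_ker {K : ℕ} {j : ℤ} (hj0 : j ≠ 0) (hj : j ∈ win (P.lev K)) :
    ∑ n ∈ ((win (P.lev K)).erase 0).erase j, P.D n * ker j n = P.T K j + P.D j / (j : ℝ) := by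
  have h1 := Finset.add_sum_erase _ (fun n => P.D n * ker j n)
    (Finset.mem_erase.2 ⟨hj0, hj⟩ : j ∈ (win (P.lev K)).erase 0)
  have h2 : ∑ n ∈ (win (P.lev K)).erase 0, P.D n * ker j n = P.T K j := by
    rw [T, Finset.sum_erase]
    rw [D_zero, zero_mul]
  have h3 : ker j j = -(1 / (j : ℝ)) := by simp [ker]
  rw [h2, h3] at h1
  rw [← h1]
  ring

/-- The constant in the upper bound for the residues. -/
noncomputable def C : ℝ := 3 * (1 + |P.β|) / |P.β| * Real.exp (13 + 4 * sumInvSq)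

theorem C_pos : 0 < P.C := by
  have := P.beta_abs_pos
  rw [C]; positivity

/-- The constant in the lower bound for the residues at the centers. -/
noncomputable def c₀ : ℝ := 1 / (8 * |P.β|) * Real.exp (-17 - 4 * sumInvSq)

theorem c₀_pos : 0 < P.c₀ := by
  have := P.beta_abs_pos
  rw [c₀]; positivity

theorem abs_D_div_le {j : ℤ} (hj0 : j ≠ 0) : |P.D j / (j : ℝ)| ≤ 1 :=
  (P.abs_div_D hj0).trans (by norm_num)

theorem le_abs_lam {j : ℤ} (hj0 : j ≠ 0) : |(j : ℝ)| / 4 ≤ |P.lam j| := by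
  have h1 : (1 : ℝ) ≤ |(j : ℝ)| := by exact_mod_cast Int.one_le_abs hj0
  have h2 := P.abs_D_le j
  have h3 := abs_sub_abs_le_abs_sub (j : ℝ) (-P.D j)
  rw [abs_neg, sub_neg_eq_add] at h3
  rw [P.lam_of_ne hj0]
  linarith

theorem abs_lam_le {j : ℤ} (hj0 : j ≠ 0) : |P.lam j| ≤ 2 * |(j : ℝ)| := by
  have h1 : (1 : ℝ) ≤ |(j : ℝ)| := by exact_mod_cast Int.one_le_abs hj0
  have h2 := P.abs_D_le j
  rw [P.lam_of_ne hj0]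
  linarith [abs_add_le (j : ℝ) (P.D j)]

/-- The 12 is the constant of `T_le_zone` and `T_le_off`, moved into `C`; the remaining 1 and `4 *
sumInvSq` in `C` pay for `D j / j` and for the squares. -/
theorem abs_res_le {K : ℕ} {j : ℤ} (hj0 : j ≠ 0) (hj : j ∈ win (P.lev K)) :
    |res P.lam (P.lev K) j| ≤ P.C * Real.exp (P.T K j - 12) := by
  rw [P.abs_res_eq hj0 hj]
  have hβ := P.beta_abs_pos
  have hj1 : (1 : ℝ) ≤ |(j : ℝ)| := by exact_mod_cast Int.one_le_abs hj0
  have h1 : |(j : ℝ) - P.β| * |P.D j| / (|P.β| * |P.lam j|) ≤ 3 * (1 + |P.β|) / |P.β| := by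
    have h2 := P.le_abs_lam hj0
    have h3 := P.abs_D_le j
    have h4 : |(j : ℝ) - P.β| ≤ |(j : ℝ)| * (1 + |P.β|) := by
      nlinarith [abs_sub (j : ℝ) P.β]
    rw [div_le_div_iff₀ (mul_pos hβ (by linarith)) hβ]
    calc |(j : ℝ) - P.β| * |P.D j| * |P.β|
        ≤ (|(j : ℝ)| * (1 + |P.β|)) * (3 / 4) * |P.β| := by gcongr
      _ = 3 * (1 + |P.β|) * (|P.β| * (|(j : ℝ)| / 4)) := by ring
      _ ≤ _ := by gcongr
  have h2 : ∏ n ∈ ((win (P.lev K)).erase 0).erase j,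
      ((1 + P.D n / ((n : ℝ) - j)) * (1 + P.D n / (n : ℝ))⁻¹) ≤
      Real.exp (P.T K j + 1 + 4 * sumInvSq) := by
    have hs : ∑ n ∈ ((win (P.lev K)).erase 0).erase j, 4 * (P.D n / (n : ℝ)) ^ 2 ≤ 4 * sumInvSq := by
      rw [← Finset.mul_sum]
      refine mul_le_mul_of_nonneg_left ?_ (by norm_num)
      refine (Finset.sum_le_sum fun n _ => div_sq_le (P.abs_D_le n) (n : ℝ)).trans ?_
      simpa using sum_inv_sub_sq_le (((win (P.lev K)).erase 0).erase j) 0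
    have hD := (abs_le.1 (P.abs_D_div_le hj0)).2
    refine (Finset.prod_le_prod (g := fun n => Real.exp (P.D n * ker j n + 4 * (P.D n / (n : ℝ)) ^ 2))
      (fun n hn => ?_) fun n hn => ?_).trans ?_
    · obtain ⟨hnj, hn⟩ := Finset.mem_erase.1 hn
      have h1 := abs_le.1 (P.abs_div_D (Finset.mem_erase.1 hn).1)
      have h2 := abs_le.1 (abs_div_int_le (P.abs_D_le n) (sub_ne_zero.2 hnj))
      push_cast at h2
      exact mul_nonneg (by linarith) (inv_nonneg.2 (by linarith))
    · obtain ⟨hnj, hn⟩ := Finset.mem_erase.1 hn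
      have h1 := inv_one_add_le_exp (P.abs_div_D (Finset.mem_erase.1 hn).1)
      have h2 := abs_le.1 (P.abs_div_D (Finset.mem_erase.1 hn).1)
      have h3 := Real.add_one_le_exp (P.D n / ((n : ℝ) - j))
      refine (mul_le_mul (by linarith) h1 (inv_nonneg.2 (by linarith))
        (Real.exp_pos (P.D n / ((n : ℝ) - j))).le).trans_eq ?_
      rw [← Real.exp_add, ker]
      congr 1
      ring
    · rw [← Real.exp_sum, Real.exp_le_exp, Finset.sum_add_distrib, P.sum_erase_ker hj0 hj]
      linarith
  calc _ ≤ 3 * (1 + |P.β|) / |P.β| * Real.exp (P.T K j + 1 + 4 * sumInvSq) := by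
        refine mul_le_mul h1 h2 (Finset.prod_nonneg fun n hn => ?_) (by positivity)
        obtain ⟨hnj, hn⟩ := Finset.mem_erase.1 hn
        have h1 := abs_le.1 (P.abs_div_D (Finset.mem_erase.1 hn).1)
        have h2 := abs_le.1 (abs_div_int_le (P.abs_D_le n) (sub_ne_zero.2 hnj))
        push_cast at h2
        exact mul_nonneg (by linarith) (inv_nonneg.2 (by linarith))
    _ = _ := by
        rw [C, mul_assoc, ← Real.exp_add]
        congr 2
        ring

theorem le_abs_res_center {K k : ℕ} (hk : k ≤ K) :
    P.c₀ ≤ |res P.lam (P.lev K) (2 * P.c k)| := by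
  have hc := P.c_pos k
  have hcK : P.c k ≤ P.c K := P.c_strictMono.monotone hk
  set j : ℤ := 2 * P.c k with hjdef
  have hj0 : j ≠ 0 := by omega
  have hj : j ∈ win (P.lev K) := by
    rw [win, lev, Finset.mem_Icc]; push_cast; omega
  have hT := P.le_T_center hk
  rw [← hjdef] at hT
  rw [P.abs_res_eq hj0 hj]
  have hβ := P.beta_abs_pos
  have hj1 : (1 : ℝ) ≤ |(j : ℝ)| := by exact_mod_cast Int.one_le_abs hj0
  have hj2 : 2 * |P.β| ≤ |(j : ℝ)| := by
    have h1 : P.E ≤ P.c k := (P.E_le_x k).trans (P.x_le_c k)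
    have h2 : (P.E : ℝ) ≤ P.c k := by exact_mod_cast h1
    have h3 := P.beta_le
    rw [hjdef]
    push_cast
    rw [abs_of_nonneg (a := 2 * (P.c k : ℝ)) (by positivity)]
    linarith
  have h1 : 1 / (8 * |P.β|) ≤ |(j : ℝ) - P.β| * |P.D j| / (|P.β| * |P.lam j|) := by
    have h2 := P.le_abs_lam hj0
    have h2' := P.abs_lam_le hj0
    have h3 : 1 / 2 ≤ |P.D j| := by rw [P.abs_D hj0]; exact P.half_lt.le
    have h4 : |(j : ℝ)| / 2 ≤ |(j : ℝ) - P.β| := by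
      linarith [abs_sub_abs_le_abs_sub (j : ℝ) P.β]
    rw [div_le_div_iff₀ (by positivity) (mul_pos hβ (by linarith))]
    calc 1 * (|P.β| * |P.lam j|) ≤ |P.β| * (2 * |(j : ℝ)|) := by
          rw [one_mul]; gcongr
      _ = (|(j : ℝ)| / 2) * (1 / 2) * (8 * |P.β|) := by ring
      _ ≤ _ := by gcongr
  have h2 : Real.exp (-17 - 4 * sumInvSq) ≤ ∏ n ∈ ((win (P.lev K)).erase 0).erase j,
      ((1 + P.D n / ((n : ℝ) - j)) * (1 + P.D n / (n : ℝ))⁻¹) := by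
    have hs : ∑ n ∈ ((win (P.lev K)).erase 0).erase j, 4 * (P.D n / ((n : ℝ) - j)) ^ 2 ≤
        4 * sumInvSq := by
      rw [← Finset.mul_sum]
      refine mul_le_mul_of_nonneg_left ?_ (by norm_num)
      exact (Finset.sum_le_sum fun n _ => div_sq_le (P.abs_D_le n) ((n : ℝ) - j)).trans
        (sum_inv_sub_sq_le _ j)
    have hD := (abs_le.1 (P.abs_D_div_le hj0)).1
    refine le_trans ?_ (Finset.prod_le_prod
      (f := fun n => Real.exp (P.D n * ker j n - 4 * (P.D n / ((n : ℝ) - j)) ^ 2))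
      (fun n hn => (Real.exp_pos _).le) fun n hn => ?_)
    · rw [← Real.exp_sum, Real.exp_le_exp, Finset.sum_sub_distrib, P.sum_erase_ker hj0 hj]
      linarith
    · obtain ⟨hnj, hn⟩ := Finset.mem_erase.1 hn
      have h1 := abs_div_int_le (P.abs_D_le n) (sub_ne_zero.2 hnj)
      push_cast at h1
      have h2 := exp_le_one_add h1
      have h3 := abs_le.1 (P.abs_div_D (Finset.mem_erase.1 hn).1)
      have h4 := Real.add_one_le_exp (P.D n / (n : ℝ))
      have h5 : Real.exp (-(P.D n / (n : ℝ))) ≤ (1 + P.D n / (n : ℝ))⁻¹ := by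
        rw [Real.exp_neg]
        exact inv_anti₀ (by linarith) (by linarith)
      refine le_trans (le_of_eq ?_)
        (mul_le_mul h2 h5 (Real.exp_pos _).le ((Real.exp_pos _).le.trans h2))
      rw [← Real.exp_add, ker]
      congr 1
      ring
  rw [c₀]
  exact mul_le_mul h1 h2 (Real.exp_pos _).le ((by positivity : (0:ℝ) ≤ 1 / (8 * |P.β|)).trans h1)

theorem le_sum_D_div (K : ℕ) :
    2 * P.α * har (P.lev K) - 4 * P.α * (K + 1) ≤ ∑ n ∈ win (P.lev K), P.D n * (1 / (n : ℝ)) := by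
  have hα := P.half_lt
  rw [P.sum_D_mul K fun n => 1 / (n : ℝ)]
  have h1 : ∑ n ∈ win (P.lev K), ((Int.sign n : ℤ) : ℝ) * (1 / (n : ℝ)) = 2 * har (P.lev K) := by
    rw [← sum_win_inv_abs]
    refine Finset.sum_congr rfl fun n _ => ?_
    rcases lt_trichotomy n 0 with h | h | h
    · have : (n : ℝ) < 0 := by exact_mod_cast h
      rw [Int.sign_eq_neg_one_of_neg h, abs_of_neg this, one_div, one_div, inv_neg]
      push_cast; ring
    · simp [h]
    · have : (0 : ℝ) < n := by exact_mod_cast h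
      rw [Int.sign_eq_one_of_pos h, abs_of_pos this]
      push_cast; ring
  have h2 : -(2 * ((K : ℝ) + 1)) ≤
      ∑ k ∈ Finset.range (K + 1), -∑ n ∈ Finset.Icc (P.c k : ℤ) (2 * P.c k), 1 / (n : ℝ) := by
    rw [Finset.sum_neg_distrib, neg_le_neg_iff]
    refine (Finset.sum_le_card_nsmul _ _ 2 fun k _ => ?_).trans_eq (by simp; ring)
    have hc := P.c_pos k
    rw [sum_Icc_one_div _ _ (by omega), harInt_of_nonneg (by omega), harInt_of_nonneg (by omega)]
    have e1 : (2 * (P.c k : ℤ)).natAbs = 2 * P.c k := by omega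
    have e2 : ((P.c k : ℤ) - 1).natAbs = P.c k - 1 := by omega
    rw [e1, e2]
    exact har_block hc
  rw [h1]
  nlinarith

theorem log_lev_ge (K : ℕ) : 5 * ((K : ℝ) + 1) ≤ Real.log (P.lev K) := by
  have h1 : (4 : ℕ) ^ (4 * (K + 1)) ≤ P.lev K := by
    rw [lev, c, x, ← pow_mul, mul_comm 4 (K + 1)]
    have := Nat.pow_le_pow_left P.four_le ((K + 1) * 4)
    omega
  have h2 : ((4 : ℝ)) ^ (4 * (K + 1)) ≤ P.lev K := by exact_mod_cast h1
  have h3 := Real.log_le_log (by positivity) h2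
  rw [Real.log_pow] at h3
  have h4 : (5 : ℝ) / 4 ≤ Real.log 4 := by
    rw [show (4 : ℝ) = 2 ^ 2 by norm_num, Real.log_pow]
    have := Real.log_two_gt_d9
    push_cast; linarith
  push_cast at h3
  have : (0 : ℝ) ≤ K := by positivity
  nlinarith

/-- The outward deviations give a bound of order `lev ^ (-2α)`, while the `K + 1` blocks lose only
`exp (4α (K + 1))`. Since `log lev ≥ 5 (K + 1)`, the decay wins. -/
theorem tendsto_leadCoeff : Tendsto (fun K => leadCoeff P.lam (P.lev K)) atTop (𝓝 0) := by
  have hα := P.half_lt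
  have hα' := P.lt
  have hβ := P.beta_abs_pos
  have h : ∀ K : ℕ, ‖leadCoeff P.lam (P.lev K)‖ ≤
      |P.β|⁻¹ * Real.exp (4 * sumInvSq) * Real.exp (-(K : ℝ)) := by
    intro K
    rw [Real.norm_eq_abs, mul_assoc, ← Real.exp_add]
    refine (P.abs_leadCoeff_le _).trans (mul_le_mul_of_nonneg_left ?_ (by positivity))
    rw [Real.exp_le_exp]
    have h1 := P.le_sum_D_div K
    have h2 := P.log_lev_ge K
    have h3 := log_add_one_le_har (P.lev K)
    have hl : (0 : ℝ) < P.lev K := by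
      have := P.c_pos K
      have : 0 < P.lev K := by rw [lev]; omega
      exact_mod_cast this
    have h4 : Real.log (P.lev K) ≤ Real.log ((P.lev K : ℝ) + 1) :=
      Real.log_le_log hl (by linarith)
    have : (0 : ℝ) ≤ K := by positivity
    nlinarith
  refine squeeze_zero_norm h ?_
  rw [show (0 : ℝ) = |P.β|⁻¹ * Real.exp (4 * sumInvSq) * 0 by ring]
  refine Tendsto.const_mul _ (Real.tendsto_exp_neg_atTop_nhds_zero.comp tendsto_natCast_atTop_atTop)

theorem exp_two_har_le {n : ℕ} (hn : 0 < n) : Real.exp (2 * har n) ≤ Real.exp 2 * (n : ℝ) ^ 2 := by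
  have h := har_le_one_add_log n
  have hn' : (0 : ℝ) < n := by exact_mod_cast hn
  calc Real.exp (2 * har n) ≤ Real.exp (2 + 2 * Real.log n) := Real.exp_le_exp.2 (by linarith)
    _ = Real.exp 2 * (n : ℝ) ^ 2 := by
      rw [Real.exp_add, two_mul (Real.log _), Real.exp_add, Real.exp_log hn', sq]

theorem prod_div_le {N : ℕ} (hN : 2 * |P.β| ≤ N) {n : ℤ} (hn : n ∉ win N) :
    ∏ i ∈ win N, (|(n : ℝ) - i| / |(n : ℝ) - P.lam i|) ≤
      8 * Real.exp (2 + 4 * sumInvSq) * |(n : ℝ)| ^ 2 := by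
  have hβ := P.beta_abs_pos
  rw [mem_win, not_le] at hn
  have hn0 : n ≠ 0 := by rintro rfl; simp at hn; omega
  have hnR : (N : ℝ) ≤ |(n : ℝ)| := by exact_mod_cast hn.le
  have hn1 : (1 : ℝ) ≤ |(n : ℝ)| := by exact_mod_cast Int.one_le_abs hn0
  rw [← Finset.mul_prod_erase _ _ (zero_mem_win N), lam_zero, Int.cast_zero, sub_zero]
  have h0 : |(n : ℝ)| / |(n : ℝ) - P.β| ≤ 2 := by
    have h4 : |(n : ℝ)| / 2 ≤ |(n : ℝ) - P.β| := by
      linarith [abs_sub_abs_le_abs_sub (n : ℝ) P.β]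
    rw [div_le_iff₀ (by linarith)]
    linarith
  have hne : ∀ i ∈ win N, n - i ≠ 0 := by
    intro i hi
    rw [mem_win] at hi
    intro h
    rw [sub_eq_zero.1 h] at hn
    omega
  have hfac : ∀ i ∈ (win N).erase 0, |(n : ℝ) - i| / |(n : ℝ) - P.lam i| ≤
      Real.exp (1 / |(i : ℝ) - n| + 4 * (1 / ((i : ℝ) - n) ^ 2)) := by
    intro i hi
    obtain ⟨hi0, hi⟩ := Finset.mem_erase.1 hi
    have h1 := hne i hi
    have h2 : (n : ℝ) - i ≠ 0 := by exact_mod_cast h1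
    have h3 : |-P.D i / ((n : ℝ) - i)| ≤ 3 / 4 := by
      have := abs_div_int_le (d := -P.D i) (by rw [abs_neg]; exact P.abs_D_le i) h1
      push_cast at this
      exact this
    have h4 := abs_le.1 h3
    have e : |(n : ℝ) - i| / |(n : ℝ) - P.lam i| = (1 + -P.D i / ((n : ℝ) - i))⁻¹ := by
      rw [P.lam_of_ne hi0, show (n : ℝ) - (i + P.D i) = (n - i) * (1 + -P.D i / (n - i)) by
        field_simp; ring, abs_mul, ← div_div, div_self (abs_ne_zero.2 h2), one_div,
        abs_of_pos (by linarith)]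
    rw [e]
    refine (inv_one_add_le_exp h3).trans (Real.exp_le_exp.2 (add_le_add ?_ ?_))
    · refine (neg_le_abs _).trans ?_
      rw [abs_div, abs_neg, abs_sub_comm (n : ℝ)]
      exact div_le_div_of_nonneg_right ((P.abs_D_le i).trans (by norm_num)) (abs_nonneg _)
    · refine mul_le_mul_of_nonneg_left ?_ (by norm_num)
      rw [← neg_sub (n : ℝ), neg_sq]
      exact div_sq_le (by rw [abs_neg]; exact P.abs_D_le i) _
  have hsum : ∑ i ∈ (win N).erase 0, 1 / |(i : ℝ) - n| ≤ 2 * har (2 * n.natAbs) := by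
    rw [← sum_win_inv_abs]
    have e : ∑ i ∈ (win N).erase 0, 1 / |(i : ℝ) - n| =
        ∑ m ∈ ((win N).erase 0).map (Equiv.subRight n).toEmbedding, 1 / |(m : ℝ)| := by
      rw [Finset.sum_map]
      refine Finset.sum_congr rfl fun i _ => ?_
      simp
    rw [e]
    refine Finset.sum_le_sum_of_subset_of_nonneg (fun m hm => ?_) fun _ _ _ => by positivity
    rw [Finset.mem_map] at hm
    obtain ⟨i, hi, rfl⟩ := hm
    have hi' := (Finset.mem_erase.1 hi).2
    rw [win, Finset.mem_Icc] at hi' ⊢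
    rw [Int.abs_eq_natAbs] at hn
    simp only [Equiv.coe_toEmbedding, Equiv.subRight_apply]
    omega
  have hnat : (0 : ℕ) < 2 * n.natAbs := by omega
  have hcast : ((2 * n.natAbs : ℕ) : ℝ) = 2 * |(n : ℝ)| := by
    push_cast
    rw [Nat.cast_natAbs]
    push_cast
    rfl
  calc |(n : ℝ)| / |(n : ℝ) - P.β| *
        ∏ i ∈ (win N).erase 0, |(n : ℝ) - i| / |(n : ℝ) - P.lam i|
      ≤ 2 * Real.exp (2 * har (2 * n.natAbs) + 4 * sumInvSq) := by
        refine mul_le_mul h0 ((Finset.prod_le_prod (fun i _ => by positivity) hfac).trans ?_)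
          (Finset.prod_nonneg fun i _ => by positivity) (by norm_num)
        rw [← Real.exp_sum, Real.exp_le_exp, Finset.sum_add_distrib, ← Finset.mul_sum]
        exact add_le_add hsum (mul_le_mul_of_nonneg_left (sum_inv_sub_sq_le _ n) (by norm_num))
    _ = 2 * (Real.exp (2 * har (2 * n.natAbs)) * Real.exp (4 * sumInvSq)) := by rw [Real.exp_add]
    _ ≤ 2 * ((Real.exp 2 * ((2 * n.natAbs : ℕ) : ℝ) ^ 2) * Real.exp (4 * sumInvSq)) := by
        gcongr
        exact exp_two_har_le hnat
    _ = 8 * Real.exp (2 + 4 * sumInvSq) * |(n : ℝ)| ^ 2 := by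
        rw [hcast, Real.exp_add]; ring

theorem two_beta_le_lev (K : ℕ) : 2 * |P.β| ≤ P.lev K := by
  have h1 : P.E ≤ P.c K := (P.E_le_x K).trans (P.x_le_c K)
  have h2 : (P.E : ℝ) ≤ P.c K := by exact_mod_cast h1
  have h3 := P.beta_le
  rw [lev]
  push_cast
  linarith [P.beta_abs_pos]

/-- Any polynomial growth suffices for completeness. Here two powers come from the leading
coefficient and two from the product. -/
theorem leadCoeff_inv_mul_prod_le (K : ℕ) (n : ℤ) (hn : n ∉ win (P.lev K)) :
    |(leadCoeff P.lam (P.lev K))⁻¹| *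
      ∏ i ∈ win (P.lev K), (|(n : ℝ) - i| / |(n : ℝ) - P.lam i|) ≤
      |P.β| * Real.exp 2 * (8 * Real.exp (2 + 4 * sumInvSq)) * |(n : ℝ)| ^ 4 := by
  have h1 := P.abs_leadCoeff_inv_le (P.lev K)
  have hl : 0 < P.lev K := by
    have := P.c_pos K
    rw [lev]; omega
  have h2 := exp_two_har_le hl
  have h3 := P.prod_div_le (P.two_beta_le_lev K) hn
  have hnR : (P.lev K : ℝ) ≤ |(n : ℝ)| := by
    rw [mem_win, not_le] at hn
    exact_mod_cast hn.le
  calc _ ≤ (|P.β| * (Real.exp 2 * |(n : ℝ)| ^ 2)) *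
        (8 * Real.exp (2 + 4 * sumInvSq) * |(n : ℝ)| ^ 2) := by
        refine mul_le_mul (h1.trans ?_) h3 (Finset.prod_nonneg fun i _ => by positivity)
          (by positivity)
        refine mul_le_mul_of_nonneg_left (h2.trans ?_) (abs_nonneg _)
        gcongr
    _ = _ := by ring

end Params

end SpectralSynthesis

/-! ### A summable majorant of the residues. -/

namespace SpectralSynthesis

open Filter Topology

section Summability

theorem summable_abs_add_one_rpow {s : ℝ} (hs : 1 < s) :
    Summable fun j : ℤ => (|(j : ℝ)| + 1) ^ (-s) := by
  refine Summable.of_norm_bounded_eventually (Real.summable_abs_int_rpow hs) ?_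
  rw [eventually_cofinite]
  refine (Set.finite_singleton (0 : ℤ)).subset fun j hj => ?_
  by_contra hj0
  refine hj ?_
  have h : 0 < |(j : ℝ)| := abs_pos.2 (by exact_mod_cast hj0)
  rw [Real.norm_of_nonneg (by positivity)]
  exact Real.rpow_le_rpow_of_nonpos h (by linarith) (by linarith)

/-- The bump `(|n| + 1)⁻²`. -/
noncomputable def bump (n : ℤ) : ℝ := ((|(n : ℝ)| + 1)⁻¹) ^ 2

theorem bump_nonneg (n : ℤ) : 0 ≤ bump n := sq_nonneg _

theorem summable_bump_sub (p : ℤ) : Summable fun j : ℤ => bump (j - p) :=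
  ((Equiv.subRight p).summable_iff (f := bump)).2 summable_inv_abs_add_one_sq

theorem tsum_bump_sub (p : ℤ) : ∑' j : ℤ, bump (j - p) = ∑' j, bump j :=
  (Equiv.subRight p).tsum_eq bump

theorem summable_mul_bump {e : ℕ → ℝ} (he : Summable e) (he0 : ∀ k, 0 ≤ e k) (p : ℕ → ℤ) :
    Summable fun z : ℕ × ℤ => e z.1 * bump (z.2 - p z.1) := by
  rw [summable_prod_of_nonneg fun z => mul_nonneg (he0 _) (bump_nonneg _)]
  constructor
  · intro k
    exact (summable_bump_sub (p k)).mul_left (e k)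
  · simp only [tsum_mul_left, tsum_bump_sub]
    exact he.mul_right _

/-- A function on the integers is summable if it is dominated by a summable function off a
sequence of zones, and by an additional summable family of functions in the zones. -/
theorem summable_of_zones {Z : ℕ → ℤ → Prop} {f g : ℤ → ℝ} {B : ℕ → ℤ → ℝ}
    (hg : Summable g) (hB : Summable fun z : ℕ × ℤ => B z.1 z.2) (hB0 : ∀ k j, 0 ≤ B k j)
    (hzone : ∀ k j, Z k j → |f j| ≤ B k j + g j) (hoff : ∀ j, (∀ k, ¬ Z k j) → |f j| ≤ g j) :
    Summable f := by
  have hB' := hB.prod_symm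
  have h1 : ∀ j, Summable fun k => B k j := fun j => hB'.prod_factor j
  have h2 : Summable fun j => ∑' k, B k j := hB'.prod
  refine Summable.of_norm_bounded (h2.add hg) fun j => ?_
  rw [Real.norm_eq_abs]
  by_cases h : ∃ k, Z k j
  · obtain ⟨k, hk⟩ := h
    refine (hzone k j hk).trans (add_le_add_left ?_ _)
    exact (h1 j).le_tsum k fun i _ => hB0 i j
  · refine (hoff j fun k hk => h ⟨k, hk⟩).trans ?_
    exact le_add_of_nonneg_left (tsum_nonneg fun k => hB0 k j)

theorem summable_sq_of_nonneg {ι : Type*} {f : ι → ℝ} (hf : Summable f) (h0 : ∀ i, 0 ≤ f i) :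
    Summable fun i => f i ^ 2 := by
  refine Summable.of_norm_bounded_eventually hf ?_
  filter_upwards [hf.tendsto_cofinite_zero.eventually (gt_mem_nhds one_pos)] with i hi
  rw [Real.norm_of_nonneg (sq_nonneg _), sq]
  exact mul_le_of_le_one_left (h0 i) hi.le

end Summability

namespace Params

variable (P : Params)

theorem x_cast_pos (k : ℕ) : (0 : ℝ) < P.x k := by exact_mod_cast P.x_pos k

theorem four_le_x_cast (k : ℕ) : (4 : ℝ) ≤ P.x k := by exact_mod_cast P.four_le_x k

theorem one_le_x (k : ℕ) : (1 : ℝ) ≤ P.x k := by linarith [P.four_le_x_cast k]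

theorem c_cast (k : ℕ) : (P.c k : ℝ) = (P.x k : ℝ) ^ 4 := by rw [c]; push_cast; rfl

theorem x_rpow (k : ℕ) (s : ℝ) : (P.x k : ℝ) ^ s = ((P.E : ℝ) ^ s) ^ (k + 1) := by
  rw [x]
  push_cast
  rw [← Real.rpow_natCast, ← Real.rpow_mul (by positivity), mul_comm,
    Real.rpow_mul (by positivity), Real.rpow_natCast]

theorem summable_x_rpow {s : ℝ} (hs : 0 < s) : Summable fun k => (P.x k : ℝ) ^ (-s) := by
  simp only [x_rpow]
  have hE : (1 : ℝ) < P.E := by exact_mod_cast (by have := P.four_le; omega : 1 < P.E)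
  exact (summable_nat_add_iff 1).2 (summable_geometric_of_lt_one (by positivity)
    (Real.rpow_lt_one_of_one_lt_of_neg hE (by linarith)))

theorem summable_x_inv : Summable fun k => (P.x k : ℝ)⁻¹ := by
  simpa only [Real.rpow_neg_one] using P.summable_x_rpow one_pos

theorem inv_x_le (k : ℕ) : (P.x k : ℝ)⁻¹ ≤ (1 / 4) * (1 / 4) ^ k := by
  have h : ((4 : ℝ)) ^ (k + 1) ≤ P.x k := by
    rw [x]
    exact_mod_cast Nat.pow_le_pow_left P.four_le (k + 1)
  calc (P.x k : ℝ)⁻¹ ≤ (4 ^ (k + 1))⁻¹ := inv_anti₀ (by positivity) h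
    _ = _ := by rw [pow_succ, mul_inv, ← inv_pow, mul_comm]; norm_num

theorem tsum_x_inv_le : ∑' k, (P.x k : ℝ)⁻¹ ≤ 1 / 3 := by
  have h := (summable_geometric_of_lt_one (r := (1 / 4 : ℝ)) (by norm_num)
    (by norm_num)).mul_left (1 / 4)
  refine (P.summable_x_inv.tsum_le_tsum P.inv_x_le h).trans ?_
  rw [tsum_mul_left, tsum_geometric_of_lt_one (by norm_num) (by norm_num)]
  norm_num

theorem summable_x_inv_sq : Summable fun k => ((P.x k : ℝ)⁻¹) ^ 2 :=
  summable_sq_of_nonneg P.summable_x_inv fun k => by positivity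

theorem tsum_x_inv_sq_le : ∑' k, ((P.x k : ℝ)⁻¹) ^ 2 ≤ 1 / 12 := by
  have h : ∀ k, ((P.x k : ℝ)⁻¹) ^ 2 ≤ 1 / 4 * (P.x k : ℝ)⁻¹ := fun k => by
    rw [sq]
    refine mul_le_mul_of_nonneg_right ?_ (by positivity)
    rw [one_div]
    exact inv_anti₀ (by norm_num) (P.four_le_x_cast k)
  refine (P.summable_x_inv_sq.tsum_le_tsum h (P.summable_x_inv.mul_left _)).trans ?_
  rw [tsum_mul_left]
  linarith [P.tsum_x_inv_le]

theorem exp_le_x_rpow (k : ℕ) : Real.exp (6 * (k + 1)) ≤ (P.x k : ℝ) ^ P.ε := by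
  have e : Real.exp (6 * (k + 1)) = Real.exp 6 ^ (k + 1) := by
    rw [← Real.exp_nat_mul]
    push_cast
    rw [mul_comm]
  rw [x_rpow, e]
  exact pow_le_pow_left₀ (Real.exp_pos _).le P.exp_le _

/-- The zone around the `k`-th center. -/
def Zone (k : ℕ) (j : ℤ) : Prop := (P.c k : ℤ) ≤ j ∧ j < 4 * P.c k

theorem zone_unique {k l : ℕ} {j : ℤ} (hk : P.Zone k j) (hl : P.Zone l j) : k = l := by
  have h1 := P.lt_of_c_lt (k := k) (l := l) (by have := hk.1; have := hl.2; omega)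
  have h2 := P.lt_of_c_lt (k := l) (l := k) (by have := hl.1; have := hk.2; omega)
  omega

/-- The bound for the residues in a zone. -/
noncomputable def zoneBound (k : ℕ) (j : ℤ) : ℝ :=
  P.C * ((P.x k : ℝ) ^ P.ε * (|(j : ℝ) - 2 * P.c k| + 1) ^ (-(1 + 2 * P.ε)))

/-- The bound for the residues off the zones. -/
noncomputable def offBound (j : ℤ) : ℝ := P.C * (|(j : ℝ)| + 1) ^ (-(1 + P.ε))

open Classical in
/-- The bound for the residues. -/
noncomputable def W (j : ℤ) : ℝ :=
  if h : ∃ k, P.Zone k j then P.zoneBound h.choose j else P.offBound j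

theorem W_of_zone {k : ℕ} {j : ℤ} (h : P.Zone k j) : P.W j = P.zoneBound k j := by
  have h' : ∃ k, P.Zone k j := ⟨k, h⟩
  rw [W, dif_pos h', P.zone_unique h'.choose_spec h]

theorem W_of_off {j : ℤ} (h : ∀ k, ¬ P.Zone k j) : P.W j = P.offBound j := by
  rw [W, dif_neg (by push Not; exact h)]

theorem zoneBound_nonneg (k : ℕ) (j : ℤ) : 0 ≤ P.zoneBound k j := by
  have := P.C_pos
  rw [zoneBound]; positivity

theorem offBound_nonneg (j : ℤ) : 0 ≤ P.offBound j := by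
  have := P.C_pos
  rw [offBound]; positivity

theorem W_nonneg (j : ℤ) : 0 ≤ P.W j := by
  rw [W]
  split_ifs
  · exact P.zoneBound_nonneg _ _
  · exact P.offBound_nonneg _

theorem one_le_C : 1 ≤ P.C := by
  have hβ := P.beta_abs_pos
  have h1 : 1 ≤ 3 * (1 + |P.β|) / |P.β| := by rw [le_div_iff₀ hβ]; linarith
  have h2 : 1 ≤ Real.exp (13 + 4 * sumInvSq) := Real.one_le_exp (by linarith [sumInvSq_nonneg])
  rw [C]
  nlinarith

theorem exp_neg_har_le (n : ℕ) {s : ℝ} (hs : 0 ≤ s) :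
    Real.exp (-(s * har n)) ≤ ((n : ℝ) + 1) ^ (-s) := by
  rw [Real.rpow_def_of_pos (by positivity), Real.exp_le_exp]
  nlinarith [log_add_one_le_har n]

theorem res_zero (N : ℕ) : res P.lam N 0 = 1 := by
  rw [res_eq (fun n => by simpa using P.lam_ne_int n 0), derivInv_zero]
  simp

/-- If `m + 1` blocks start at or below `n`, then `x m ≤ n`, and `exp (6 (m + 1)) ≤ x m ^ ε`. Half
of the excess `2ε` in the decay exponent is spent on this. -/
theorem card_filter_le (K : ℕ) (n : ℕ) :
    Real.exp (6 * (((Finset.range (K + 1)).filter fun k => P.c k ≤ n).card : ℝ)) ≤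
      ((n : ℝ) + 1) ^ P.ε := by
  have hε := P.eps_pos
  set S := (Finset.range (K + 1)).filter fun k => P.c k ≤ n with hS
  rcases Nat.eq_zero_or_pos S.card with h | h
  · rw [h]
    simp only [Nat.cast_zero, mul_zero, Real.exp_zero]
    exact Real.one_le_rpow (by linarith [Nat.cast_nonneg (α := ℝ) n]) hε.le
  · obtain ⟨m, hm⟩ : ∃ m, S.card = m + 1 := ⟨S.card - 1, by omega⟩
    obtain ⟨k, hk, hmk⟩ : ∃ k ∈ S, m ≤ k := by
      by_contra hcon
      push Not at hcon
      have : S ⊆ Finset.range m := fun k hk => Finset.mem_range.2 (hcon k hk)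
      have := Finset.card_le_card this
      rw [Finset.card_range] at this
      omega
    have h1 : P.x m ≤ n := (P.x_strictMono.monotone hmk).trans
      ((P.x_le_c k).trans (Finset.mem_filter.1 hk).2)
    have h2 : (P.x m : ℝ) ≤ n := by exact_mod_cast h1
    rw [hm]
    push_cast
    exact (P.exp_le_x_rpow m).trans (Real.rpow_le_rpow (by positivity) (by linarith) hε.le)

/-- The majorant does not depend on the level, so it dominates all the limits along `lev`. -/
theorem abs_res_le_W (K : ℕ) (j : ℤ) (hj : j ∈ win (P.lev K)) :
    |res P.lam (P.lev K) j| ≤ P.W j := by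
  have hC := P.C_pos
  have hε := P.eps_pos
  have h2α := P.two_alpha
  by_cases h : ∃ k, P.Zone k j
  · obtain ⟨k, hk⟩ := h
    have hk' := hk
    obtain ⟨h1, h2⟩ := hk'
    have hj0 : j ≠ 0 := by have := P.c_pos k; omega
    rw [P.W_of_zone hk, zoneBound]
    refine (P.abs_res_le hj0 hj).trans (mul_le_mul_of_nonneg_left ?_ hC.le)
    have hT := P.T_le_zone hj h1 h2
    have e : (((j - 2 * P.c k).natAbs : ℕ) : ℝ) = |(j : ℝ) - 2 * P.c k| := by
      rw [Nat.cast_natAbs]; push_cast; rfl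
    have h3 := exp_neg_har_le (j - 2 * P.c k).natAbs (s := 1 + 2 * P.ε) (by linarith)
    rw [e] at h3
    refine le_trans ?_ (mul_le_mul (P.exp_le_x_rpow k) h3 (Real.exp_pos _).le (by positivity))
    rw [← Real.exp_add, Real.exp_le_exp, ← h2α]
    linarith
  · push Not at h
    rw [P.W_of_off h, offBound]
    by_cases hj0 : j = 0
    · rw [hj0, res_zero]
      simpa using P.one_le_C
    refine (P.abs_res_le hj0 hj).trans (mul_le_mul_of_nonneg_left ?_ hC.le)
    have hT := P.T_le_off hj hj0 h
    have e : ((j.natAbs : ℕ) : ℝ) = |(j : ℝ)| := by rw [Nat.cast_natAbs]; push_cast; rfl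
    have h3 := exp_neg_har_le j.natAbs (s := 1 + 2 * P.ε) (by linarith)
    have h4 := P.card_filter_le K j.natAbs
    rw [e] at h3 h4
    have h5 : (|(j : ℝ)| + 1) ^ (-(1 + P.ε)) =
        (|(j : ℝ)| + 1) ^ P.ε * (|(j : ℝ)| + 1) ^ (-(1 + 2 * P.ε)) := by
      rw [← Real.rpow_add (by positivity)]
      congr 1
      ring
    rw [h5]
    refine le_trans ?_ (mul_le_mul h4 h3 (Real.exp_pos _).le (by positivity))
    rw [← Real.exp_add, Real.exp_le_exp, ← h2α]
    linarith

/-- The limits of the residues. -/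
noncomputable def r (j : ℤ) : ℝ := resLim P.lam j

theorem tendsto_res_lev (j : ℤ) :
    Tendsto (fun K => res P.lam (P.lev K) j) atTop (𝓝 (P.r j)) := by
  obtain ⟨e, he, hd⟩ := P.exists_dist
  exact (tendsto_res P.abs_lam_sub_le he hd j).comp P.lev_tendsto

theorem abs_r_le (j : ℤ) : |P.r j| ≤ P.W j := by
  refine le_of_tendsto (P.tendsto_res_lev j).abs ?_
  filter_upwards [eventually_mem_win P.lev_tendsto j] with K hK using P.abs_res_le_W K j hK

theorem r_ne_zero (j : ℤ) : P.r j ≠ 0 := by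
  obtain ⟨e, he, hd⟩ := P.exists_dist
  exact resLim_ne_zero P.abs_lam_sub_le he hd j

theorem r_zero : P.r 0 = 1 := resLim_zero

theorem le_abs_r_center (k : ℕ) : P.c₀ ≤ |P.r (2 * P.c k)| := by
  refine ge_of_tendsto (P.tendsto_res_lev _).abs ?_
  filter_upwards [eventually_ge_atTop k] with K hK using P.le_abs_res_center hK

theorem x_rpow_eps_le (k : ℕ) : (P.x k : ℝ) ^ P.ε ≤ P.x k := by
  refine (Real.rpow_le_rpow_of_exponent_le (P.one_le_x k) (?_ : P.ε ≤ 1)).trans_eq (Real.rpow_one _)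
  linarith [P.eps_lt]

theorem rpow_neg_le_inv {y s : ℝ} (hy : 1 ≤ y) (hs : 1 ≤ s) : y ^ (-s) ≤ y⁻¹ := by
  rw [← Real.rpow_neg_one]
  exact Real.rpow_le_rpow_of_exponent_le hy (by linarith)

theorem zoneBound_le (k : ℕ) (j : ℤ) :
    P.zoneBound k j ≤ P.C * (P.x k * (|(j : ℝ) - 2 * P.c k| + 1)⁻¹) := by
  have hC := P.C_pos
  rw [zoneBound]
  refine mul_le_mul_of_nonneg_left (mul_le_mul (P.x_rpow_eps_le k) ?_ (by positivity)
    (by positivity)) hC.le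
  exact rpow_neg_le_inv (by linarith [abs_nonneg ((j : ℝ) - 2 * P.c k)]) (by linarith [P.eps_pos])

theorem offBound_le (j : ℤ) : P.offBound j ≤ P.C * (|(j : ℝ)| + 1)⁻¹ := by
  have hC := P.C_pos
  rw [offBound]
  exact mul_le_mul_of_nonneg_left (rpow_neg_le_inv (by linarith [abs_nonneg (j : ℝ)])
    (by linarith [P.eps_pos])) hC.le

theorem bump_center (k : ℕ) (j : ℤ) :
    bump (j - 2 * P.c k) = ((|(j : ℝ) - 2 * P.c k| + 1)⁻¹) ^ 2 := by
  rw [bump]; push_cast; rfl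

theorem c_le_abs {k : ℕ} {j : ℤ} (h : P.Zone k j) : (P.x k : ℝ) ^ 4 ≤ |(j : ℝ)| := by
  rw [← P.c_cast]
  refine le_trans ?_ (le_abs_self _)
  exact_mod_cast h.1

theorem summable_W_mul : Summable fun j : ℤ => P.W j * (|(j : ℝ)| + 1)⁻¹ := by
  have hC := P.C_pos
  have hB := summable_mul_bump P.summable_x_inv (fun k => by positivity) fun k => 2 * P.c k
  refine summable_of_zones (Z := P.Zone)
    (B := fun k j => P.C * ((P.x k : ℝ)⁻¹ * bump (j - 2 * P.c k)))
    (((summable_abs_add_one_rpow (s := 5 / 4) (by norm_num)).mul_left P.C).add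
      (summable_inv_abs_add_one_sq.mul_left P.C)) (hB.mul_left P.C)
    (fun k j => mul_nonneg hC.le (mul_nonneg (by positivity) (bump_nonneg _))) ?_ ?_
  · intro k j hk
    have hx := P.x_cast_pos k
    rw [abs_of_nonneg (mul_nonneg (P.W_nonneg j) (by positivity)), P.W_of_zone hk, bump_center]
    have h1 := P.zoneBound_le k j
    set q := (|(j : ℝ) - 2 * P.c k| + 1)⁻¹ with hq
    set t := (|(j : ℝ)| + 1)⁻¹ with ht
    have hq0 : 0 < q := by positivity
    have ht0 : 0 < t := by positivity
    have h2 : (P.x k : ℝ) ^ 3 ≤ (|(j : ℝ)| + 1) ^ (3 / 4 : ℝ) := by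
      have e : (P.x k : ℝ) ^ 3 = ((P.x k : ℝ) ^ 4) ^ (3 / 4 : ℝ) := by
        rw [← Real.rpow_natCast _ 4, ← Real.rpow_mul hx.le, ← Real.rpow_natCast]
        norm_num
      rw [e]
      exact Real.rpow_le_rpow (by positivity) (by linarith [P.c_le_abs hk]) (by norm_num)
    have h3 : (|(j : ℝ)| + 1) ^ (-(5 / 4) : ℝ) = (|(j : ℝ)| + 1) ^ (3 / 4 : ℝ) * t ^ 2 := by
      rw [ht, inv_pow, ← Real.rpow_natCast, ← Real.rpow_neg (by positivity),
        ← Real.rpow_add (by positivity)]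
      norm_num
    -- Completing the square. The first term is summable over all zones; in the second, `x ^ 4 ≤
    -- |j|` turns `x ^ 3 * t ^ 2` into at most `(|j| + 1) ^ (-5/4)`.
    have h4 : P.x k * q * t ≤ (P.x k : ℝ)⁻¹ * q ^ 2 + (P.x k : ℝ) ^ 3 * t ^ 2 := by
      have e : (P.x k : ℝ)⁻¹ * q ^ 2 + (P.x k : ℝ) ^ 3 * t ^ 2 - P.x k * q * t =
          (P.x k : ℝ)⁻¹ * ((q - (P.x k : ℝ) ^ 2 * t) ^ 2 + (P.x k : ℝ) ^ 2 * q * t) := by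
        field_simp; ring
      have : 0 ≤ (P.x k : ℝ)⁻¹ * ((q - (P.x k : ℝ) ^ 2 * t) ^ 2 + (P.x k : ℝ) ^ 2 * q * t) := by
        positivity
      linarith
    calc P.zoneBound k j * t ≤ P.C * (P.x k * q) * t := by gcongr
      _ = P.C * (P.x k * q * t) := by ring
      _ ≤ P.C * ((P.x k : ℝ)⁻¹ * q ^ 2 + (|(j : ℝ)| + 1) ^ (3 / 4 : ℝ) * t ^ 2) := by
          refine mul_le_mul_of_nonneg_left (h4.trans ?_) hC.le
          gcongr
      _ = P.C * ((P.x k : ℝ)⁻¹ * q ^ 2) + P.C * (|(j : ℝ)| + 1) ^ (-(5 / 4) : ℝ) := by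
          rw [h3]; ring
      _ ≤ _ := by
          have : 0 ≤ P.C * t ^ 2 := by positivity
          linarith
  · intro j hj
    rw [abs_of_nonneg (mul_nonneg (P.W_nonneg j) (by positivity)), P.W_of_off hj]
    have h1 := mul_le_mul_of_nonneg_right (P.offBound_le j)
      (by positivity : 0 ≤ (|(j : ℝ)| + 1)⁻¹)
    have : 0 ≤ P.C * (|(j : ℝ)| + 1) ^ (-(5 / 4) : ℝ) := by positivity
    rw [mul_assoc, ← sq] at h1
    linarith

theorem residueData : ResidueData P.lam P.r where
  notInt := P.lam_ne_int
  r_zero := P.r_zero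
  sq_summable m := by
    obtain ⟨C, hC, h⟩ := inv_sub_le (P.lam m) (P.lam_ne_int m)
    have hs := (summable_sq_of_nonneg P.summable_W_mul fun j =>
      mul_nonneg (P.W_nonneg j) (by positivity)).mul_left (C ^ 2)
    refine Summable.of_nonneg_of_le (fun j => sq_nonneg _) (fun j => ?_) hs
    rw [← mul_pow, ← sq_abs, abs_div, div_eq_mul_inv]
    refine pow_le_pow_left₀ (by positivity) ?_ 2
    calc |P.r j| * |(j : ℝ) - P.lam m|⁻¹ ≤ P.W j * (C * (|(j : ℝ)| + 1)⁻¹) :=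
          mul_le_mul (P.abs_r_le j) (h j) (by positivity) (P.W_nonneg j)
      _ = _ := by ring
  orth m n hnm := tsum_res_orth P.lam_ne_int P.lev_tendsto P.tendsto_res_lev P.abs_res_le_W
    P.summable_W_mul m n hnm
  unique x hx hx0 := eq_zero_of_cauchyTransform_eq_zero P.lam_ne_int P.lam_injective P.lev_tendsto
    P.tendsto_res_lev P.r_ne_zero P.leadCoeff_inv_mul_prod_le (fun k => 2 * P.c k)
    (fun k => by have := P.c_pos k; omega) (fun k => by have := P.c_succ k; omega)
    P.c₀_pos P.le_abs_r_center hx hx0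

theorem tsum_r_div (m : ℤ) : ∑' j : ℤ, P.r j / (j - P.lam m) = 0 :=
  tsum_res_div P.lam_ne_int P.lev_tendsto P.tendsto_res_lev P.abs_res_le_W P.summable_W_mul
    P.tendsto_leadCoeff m

end Params

end SpectralSynthesis

/-! ### The square summable vector orthogonal to the remaining exponentials. -/

namespace SpectralSynthesis

open Filter Topology

namespace Params

variable (P : Params)

/-- The indices whose frequencies are removed. -/
def idx (k : ℕ) : ℤ := 2 * P.c k + P.x k ^ 2

theorem sixteen_le_x_sq (k : ℕ) : 16 ≤ P.x k ^ 2 := by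
  have := P.four_le_x k
  nlinarith

theorem x_sq_le_c (k : ℕ) : 16 * P.x k ^ 2 ≤ P.c k := by
  rw [c, show P.x k ^ 4 = P.x k ^ 2 * P.x k ^ 2 by ring]
  exact Nat.mul_le_mul_right _ (P.sixteen_le_x_sq k)

theorem zone_idx (k : ℕ) : P.Zone k (P.idx k) := by
  have h1 : (16 * P.x k ^ 2 : ℤ) ≤ P.c k := by exact_mod_cast P.x_sq_le_c k
  have h2 : (16 : ℤ) ≤ P.x k ^ 2 := by exact_mod_cast P.sixteen_le_x_sq k
  rw [Zone, idx]
  constructor <;> linarith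

theorem zone_center (k : ℕ) : P.Zone k (2 * P.c k) := by
  have := P.c_pos k
  rw [Zone]
  omega

/-- The index lies to the right of its block, so its deviation is `+α`. The offset `x ^ 2` is large
compared with the scale `x` on which `r` peaks and small compared with `c = x ^ 4`; off the zone the
correction terms are thus `O(x ^ (-2))`. -/
theorem lam_idx (k : ℕ) :
    P.lam (P.idx k) = 2 * (P.x k : ℝ) ^ 4 + (P.x k : ℝ) ^ 2 + P.α := by
  have hz := P.zone_idx k
  have hc := P.c_pos k
  have hpos : 0 < P.idx k := by have := hz.1; omega
  rw [P.lam_of_ne hpos.ne', P.D_of_notMem hpos, idx, ← P.c_cast]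
  · push_cast; ring
  · rintro l ⟨h1, h2⟩
    have hl : l = k := P.zone_unique ⟨h1, by have := P.c_pos l; omega⟩ hz
    rw [hl, idx] at h2
    have h3 : (16 : ℤ) ≤ P.x k ^ 2 := by exact_mod_cast P.sixteen_le_x_sq k
    linarith

/-- The distances of the removed frequencies from the centers. -/
noncomputable def γ (k : ℕ) : ℝ := (P.x k : ℝ) ^ 2 + P.α

theorem γ_pos (k : ℕ) : 0 < P.γ k := by
  have := P.half_lt
  rw [γ]; positivity

theorem γ_eq (k : ℕ) : P.γ k = P.lam (P.idx k) - ((2 * P.c k : ℤ) : ℝ) := by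
  rw [γ, lam_idx]
  push_cast
  rw [P.c_cast]
  ring

theorem γ_le (k : ℕ) : P.γ k ≤ 2 * (P.x k : ℝ) ^ 2 := by
  have := P.lt
  have := P.one_le_x k
  rw [γ]
  nlinarith

theorem x_sq_le_x_pow (k : ℕ) : 16 * (P.x k : ℝ) ^ 2 ≤ (P.x k : ℝ) ^ 4 := by
  rw [← P.c_cast]
  exact_mod_cast P.x_sq_le_c k

theorem le_abs_sub_lam {k : ℕ} {j : ℤ} (h : ¬ P.Zone k j) :
    (P.x k : ℝ) ^ 4 ≤ |(j : ℝ) - P.lam (P.idx k)| := by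
  have h1 := P.x_sq_le_x_pow k
  have h2 := P.lt
  have h3 := P.half_lt
  have h4 := P.one_le_x k
  rw [Zone, not_and_or, not_le, not_lt] at h
  rw [lam_idx]
  rcases h with h | h
  · have h5 : (j : ℝ) ≤ (P.x k : ℝ) ^ 4 := by
      rw [← P.c_cast]; exact_mod_cast h.le
    refine le_trans ?_ (neg_le_abs _)
    nlinarith
  · have h5 : 4 * (P.x k : ℝ) ^ 4 ≤ j := by
      rw [← P.c_cast]; exact_mod_cast h
    refine le_trans ?_ (le_abs_self _)
    nlinarith

theorem abs_term_le {k : ℕ} {j : ℤ} (h : ¬ P.Zone k j) :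
    |P.γ k / (j - P.lam (P.idx k))| ≤ 2 * ((P.x k : ℝ)⁻¹) ^ 2 := by
  have hx := P.x_cast_pos k
  have h1 := P.le_abs_sub_lam h
  rw [abs_div, abs_of_pos (P.γ_pos k), div_le_iff₀ (lt_of_lt_of_le (by positivity) h1)]
  refine (P.γ_le k).trans ?_
  calc 2 * (P.x k : ℝ) ^ 2 = 2 * ((P.x k : ℝ)⁻¹) ^ 2 * (P.x k : ℝ) ^ 4 := by field_simp
    _ ≤ _ := by gcongr

theorem summable_terms (j : ℤ) : Summable fun k => |P.γ k / (j - P.lam (P.idx k))| := by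
  refine Summable.of_norm_bounded_eventually (P.summable_x_inv_sq.mul_left 2) ?_
  rw [eventually_cofinite]
  have hs : {k | P.Zone k j}.Subsingleton := fun k hk l hl => P.zone_unique hk hl
  refine hs.finite.subset fun k hk => ?_
  by_contra hz
  refine hk ?_
  rw [norm_abs_eq_norm, Real.norm_eq_abs]
  exact P.abs_term_le hz

/-- The product form is summable over `i` and keeps a factor `1 / x k`, whose square makes up for
squared residues of total size `O(x k)` in the zone. -/
theorem abs_term_le_of_zone {k i : ℕ} {j : ℤ} (hk : P.Zone k j) (hik : i ≠ k) :
    |P.γ i / (j - P.lam (P.idx i))| ≤ 4 * (P.x k : ℝ)⁻¹ * (P.x i : ℝ)⁻¹ := by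
  have hx := P.x_cast_pos k
  have hxi := P.x_cast_pos i
  rcases lt_or_gt_of_ne hik with h | h
  · have hlt : (P.x i : ℝ) ≤ P.x k := by exact_mod_cast (P.x_strictMono h).le
    have h1 : 16 * (P.x i : ℝ) ^ 4 ≤ (P.x k : ℝ) ^ 4 := by
      rw [← P.c_cast, ← P.c_cast]
      exact_mod_cast P.c_le_of_lt h
    have h2 : (P.x k : ℝ) ^ 4 ≤ j := by
      rw [← P.c_cast]; exact_mod_cast hk.1
    have h3 : (P.x k : ℝ) ^ 4 / 2 ≤ |(j : ℝ) - P.lam (P.idx i)| := by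
      refine le_trans ?_ (le_abs_self _)
      rw [lam_idx]
      have := P.x_sq_le_x_pow i
      have := P.lt
      have := P.one_le_x i
      nlinarith
    rw [abs_div, abs_of_pos (P.γ_pos i), div_le_iff₀ (lt_of_lt_of_le (by positivity) h3)]
    refine (P.γ_le i).trans ?_
    have h4 : (P.x i : ℝ) ^ 3 ≤ (P.x k : ℝ) ^ 3 := by gcongr
    calc 2 * (P.x i : ℝ) ^ 2 = 2 * (P.x i : ℝ)⁻¹ * (P.x i : ℝ) ^ 3 := by field_simp
      _ ≤ 2 * (P.x i : ℝ)⁻¹ * (P.x k : ℝ) ^ 3 := by gcongr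
      _ = 4 * (P.x k : ℝ)⁻¹ * (P.x i : ℝ)⁻¹ * ((P.x k : ℝ) ^ 4 / 2) := by field_simp; ring
      _ ≤ _ := by gcongr
  · have hlt : (P.x k : ℝ) ≤ P.x i := by exact_mod_cast (P.x_strictMono h).le
    have h1 := P.abs_term_le (k := i) (j := j) fun hz => hik (P.zone_unique hz hk)
    refine h1.trans ?_
    have h2 : (P.x i : ℝ)⁻¹ ≤ (P.x k : ℝ)⁻¹ := inv_anti₀ hx hlt
    have h3 : 0 < (P.x i : ℝ)⁻¹ := by positivity
    nlinarith

theorem tsum_off_diagonal_le {k : ℕ} {j : ℤ} (hk : P.Zone k j) :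
    ∑' i, (if i = k then 0 else |P.γ i / (j - P.lam (P.idx i))|) ≤ 2 * (P.x k : ℝ)⁻¹ := by
  have hx := P.x_cast_pos k
  have hle : ∀ i, (if i = k then 0 else |P.γ i / (j - P.lam (P.idx i))|) ≤
      4 * (P.x k : ℝ)⁻¹ * (P.x i : ℝ)⁻¹ := by
    intro i
    split_ifs with h
    · positivity
    · exact P.abs_term_le_of_zone hk h
  have hs := P.summable_x_inv.mul_left (4 * (P.x k : ℝ)⁻¹)
  refine ((Summable.of_nonneg_of_le (fun i => ?_) hle hs).tsum_le_tsum hle hs).trans ?_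
  · split_ifs <;> positivity
  · rw [tsum_mul_left]
    have h1 := P.tsum_x_inv_le
    have h2 : 0 < (P.x k : ℝ)⁻¹ := by positivity
    nlinarith

/-- The multiplier of the residues. -/
noncomputable def V (j : ℤ) : ℝ := 1 + ∑' k, P.γ k / (j - P.lam (P.idx k))

theorem abs_V_le_of_off {j : ℤ} (h : ∀ k, ¬ P.Zone k j) : |P.V j| ≤ 2 := by
  have hs : Summable fun k => ‖P.γ k / (j - P.lam (P.idx k))‖ := by
    simp only [Real.norm_eq_abs]
    exact P.summable_terms j
  have h1 := norm_tsum_le_tsum_norm hs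
  simp only [Real.norm_eq_abs] at h1
  have h2 := (P.summable_terms j).tsum_le_tsum (fun k => P.abs_term_le (h k))
    (P.summable_x_inv_sq.mul_left 2)
  rw [tsum_mul_left] at h2
  have h3 := P.tsum_x_inv_sq_le
  rw [V]
  refine (abs_add_le _ _).trans ?_
  rw [abs_one]
  linarith

/-- The choice of `γ k` gives `1 + γ k / (j - λ) = (j - 2 * c k) / (j - λ)`, which vanishes at the
center. -/
theorem abs_V_le_of_zone {k : ℕ} {j : ℤ} (h : P.Zone k j) :
    |P.V j| ≤ |(j : ℝ) - 2 * P.c k| / |(j : ℝ) - P.lam (P.idx k)| + 2 * (P.x k : ℝ)⁻¹ := by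
  have hs : Summable fun k => P.γ k / (j - P.lam (P.idx k)) := (P.summable_terms j).of_abs
  have hne : (j : ℝ) - P.lam (P.idx k) ≠ 0 := sub_ne_zero.2 (P.lam_ne_int _ j).symm
  have e : 1 + P.γ k / (j - P.lam (P.idx k)) =
      ((j : ℝ) - 2 * P.c k) / (j - P.lam (P.idx k)) := by
    rw [P.γ_eq]
    field_simp
    push_cast
    ring
  rw [V, hs.tsum_eq_add_tsum_ite k, ← add_assoc, e]
  refine (abs_add_le _ _).trans ?_
  rw [abs_div]
  refine add_le_add_right ?_ _
  have hs' : Summable fun i => ‖if i = k then 0 else P.γ i / (j - P.lam (P.idx i))‖ := by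
    refine Summable.of_nonneg_of_le (fun i => norm_nonneg _) (fun i => ?_) (P.summable_terms j)
    split_ifs
    · simp
    · rw [Real.norm_eq_abs]
  have h1 := norm_tsum_le_tsum_norm hs'
  rw [Real.norm_eq_abs] at h1
  refine h1.trans (le_trans (le_of_eq ?_) (P.tsum_off_diagonal_le h))
  refine tsum_congr fun i => ?_
  split_ifs
  · simp
  · rw [Real.norm_eq_abs]

theorem inv_abs_sub_lam_le (k : ℕ) (j : ℤ) :
    |(j : ℝ) - P.lam (P.idx k)|⁻¹ ≤ 8 * (|((j - P.idx k : ℤ) : ℝ)| + 1)⁻¹ := by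
  have hα := P.half_lt
  have hα' := P.lt
  have e : (j : ℝ) - P.lam (P.idx k) = ((j - P.idx k : ℤ) : ℝ) - P.α := by
    rw [P.lam_idx, idx]
    push_cast
    rw [P.c_cast]
    ring
  rw [e]
  generalize j - P.idx k = t
  have h1 : |(t : ℝ)| + 1 ≤ 8 * |(t : ℝ) - P.α| := by
    rcases le_or_gt t 0 with h | h
    · have h2 : (t : ℝ) ≤ 0 := by exact_mod_cast h
      rw [abs_of_nonpos h2, abs_of_nonpos (by linarith)]
      linarith
    · have h2 : (1 : ℝ) ≤ t := by exact_mod_cast h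
      rw [abs_of_pos (by linarith), abs_of_pos (by linarith)]
      linarith
  rw [← div_eq_mul_inv, le_div_iff₀ (by positivity), ← div_eq_inv_mul, div_le_iff₀]
  · exact h1
  · have := abs_nonneg (t : ℝ)
    linarith

theorem zoneBound_sq (k : ℕ) (j : ℤ) :
    P.zoneBound k j ^ 2 = P.C ^ 2 * ((P.x k : ℝ) ^ (2 * P.ε) *
      (|(j : ℝ) - 2 * P.c k| + 1) ^ (-(4 * P.ε)) * bump (j - 2 * P.c k)) := by
  have hx := P.x_cast_pos k
  rw [zoneBound, mul_pow, mul_pow, bump_center, inv_pow]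
  have hq : 0 < |(j : ℝ) - 2 * P.c k| + 1 := by positivity
  generalize |(j : ℝ) - 2 * P.c k| + 1 = q at hq
  have e1 : ((P.x k : ℝ) ^ P.ε) ^ 2 = (P.x k : ℝ) ^ (2 * P.ε) := by
    rw [← Real.rpow_natCast, ← Real.rpow_mul hx.le]; congr 1; push_cast; ring
  have e2 : (q ^ (-(1 + 2 * P.ε))) ^ 2 = q ^ (-(4 * P.ε)) * (q ^ 2)⁻¹ := by
    rw [← Real.rpow_natCast, ← Real.rpow_mul hq.le, ← Real.rpow_natCast, ← Real.rpow_neg hq.le,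
      ← Real.rpow_add hq]
    congr 1
    push_cast
    ring
  rw [e1, e2]
  ring

theorem zoneBound_sq_le (k : ℕ) (j : ℤ) :
    P.zoneBound k j ^ 2 ≤ P.C ^ 2 * (P.x k * bump (j - 2 * P.c k)) := by
  have hε := P.eps_pos
  have hε' := P.eps_lt
  have hx := P.x_cast_pos k
  rw [zoneBound_sq]
  refine mul_le_mul_of_nonneg_left (mul_le_mul_of_nonneg_right ?_ (bump_nonneg _)) (sq_nonneg _)
  have h1 : (P.x k : ℝ) ^ (2 * P.ε) ≤ P.x k :=
    (Real.rpow_le_rpow_of_exponent_le (P.one_le_x k) (by linarith)).trans_eq (Real.rpow_one _)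
  have h2 : (|(j : ℝ) - 2 * P.c k| + 1) ^ (-(4 * P.ε)) ≤ 1 :=
    Real.rpow_le_one_of_one_le_of_nonpos (by linarith [abs_nonneg ((j : ℝ) - 2 * P.c k)])
      (by linarith)
  calc _ ≤ (P.x k : ℝ) * 1 := mul_le_mul h1 h2 (by positivity) hx.le
    _ = _ := mul_one _

/-- Within `x` of the center the multiplier is `O(1 / x)`, which beats squared residues of size
`O(x)`. Farther away the residues supply `x ^ (2ε) * x ^ (-4ε)` and the multiplier leaves a peak of
unit width at `idx k`. The sum over `k` of the resulting `x ^ (-2ε)` is where `α > 1/2` is decisive.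
-/
theorem zoneBound_mul_sq_le {k : ℕ} (j : ℤ) :
    (P.zoneBound k j * (|(j : ℝ) - 2 * P.c k| / |(j : ℝ) - P.lam (P.idx k)|)) ^ 2 ≤
      P.C ^ 2 * (4 * ((P.x k : ℝ)⁻¹ * bump (j - 2 * P.c k)) +
        64 * ((P.x k : ℝ) ^ (-(2 * P.ε)) * bump (j - P.idx k))) := by
  have hε := P.eps_pos
  have hC := P.C_pos
  have hx := P.x_cast_pos k
  have hx1 := P.four_le_x_cast k
  have hb := bump_nonneg (j - 2 * P.c k)
  have hb' := bump_nonneg (j - P.idx k)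
  have hq0 := abs_nonneg ((j : ℝ) - 2 * P.c k)
  rw [mul_pow, div_pow]
  rcases le_or_gt (P.x k : ℝ) (|(j : ℝ) - 2 * P.c k| + 1) with h | h
  · rw [zoneBound_sq]
    have h1 : (P.x k : ℝ) ^ (2 * P.ε) * (|(j : ℝ) - 2 * P.c k| + 1) ^ (-(4 * P.ε)) ≤
        (P.x k : ℝ) ^ (-(2 * P.ε)) := by
      have h2 := Real.rpow_le_rpow_of_nonpos hx h (by linarith : -(4 * P.ε) ≤ 0)
      refine (mul_le_mul_of_nonneg_left h2 (by positivity)).trans_eq ?_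
      rw [← Real.rpow_add hx]
      congr 1
      ring
    have h2 : bump (j - 2 * P.c k) * |(j : ℝ) - 2 * P.c k| ^ 2 ≤ 1 := by
      rw [bump_center, ← mul_pow]
      refine pow_le_one₀ (by positivity) ?_
      rw [inv_mul_le_iff₀ (by positivity)]
      linarith
    have h3 : (|(j : ℝ) - P.lam (P.idx k)| ^ 2)⁻¹ ≤ 64 * bump (j - P.idx k) := by
      rw [← inv_pow, bump]
      refine (pow_le_pow_left₀ (by positivity) (P.inv_abs_sub_lam_le k j) 2).trans_eq ?_
      rw [mul_pow]; norm_num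
    calc _ = P.C ^ 2 * (((P.x k : ℝ) ^ (2 * P.ε) *
          (|(j : ℝ) - 2 * P.c k| + 1) ^ (-(4 * P.ε))) * (bump (j - 2 * P.c k) *
          |(j : ℝ) - 2 * P.c k| ^ 2) * (|(j : ℝ) - P.lam (P.idx k)| ^ 2)⁻¹) := by
          rw [div_eq_mul_inv]; ring
      _ ≤ P.C ^ 2 * ((P.x k : ℝ) ^ (-(2 * P.ε)) * 1 * (64 * bump (j - P.idx k))) := by
          gcongr
      _ ≤ _ := by
          refine mul_le_mul_of_nonneg_left ?_ (sq_nonneg _)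
          have : 0 ≤ 4 * ((P.x k : ℝ)⁻¹ * bump (j - 2 * P.c k)) := by positivity
          linarith
  · have h1 : (P.x k : ℝ) ^ 2 / 2 ≤ |(j : ℝ) - P.lam (P.idx k)| := by
      have e : (j : ℝ) - P.lam (P.idx k) = (j - 2 * P.c k) - P.γ k := by
        rw [P.γ_eq]; push_cast; ring
      rw [e, abs_sub_comm]
      have h2 := abs_sub_abs_le_abs_sub (P.γ k) ((j : ℝ) - 2 * P.c k)
      rw [abs_of_pos (P.γ_pos k), γ] at h2
      rw [γ]
      nlinarith [P.half_lt]
    have h2 := P.zoneBound_sq_le k j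
    have h3 : |(j : ℝ) - 2 * P.c k| ^ 2 / |(j : ℝ) - P.lam (P.idx k)| ^ 2 ≤
        4 * ((P.x k : ℝ)⁻¹) ^ 2 := by
      calc _ ≤ (P.x k : ℝ) ^ 2 / ((P.x k : ℝ) ^ 2 / 2) ^ 2 := by
            gcongr
            linarith
        _ = _ := by field_simp; norm_num
    calc _ ≤ (P.C ^ 2 * (P.x k * bump (j - 2 * P.c k))) * (4 * ((P.x k : ℝ)⁻¹) ^ 2) :=
          mul_le_mul h2 h3 (by positivity) (by positivity)
      _ = P.C ^ 2 * (4 * ((P.x k : ℝ)⁻¹ * bump (j - 2 * P.c k))) := by field_simp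
      _ ≤ _ := by
          refine mul_le_mul_of_nonneg_left ?_ (sq_nonneg _)
          have : 0 ≤ 64 * ((P.x k : ℝ) ^ (-(2 * P.ε)) * bump (j - P.idx k)) := by positivity
          linarith

theorem summable_r_mul_V_sq : Summable fun j => (P.r j * P.V j) ^ 2 := by
  have hC := P.C_pos
  have hB1 := summable_mul_bump P.summable_x_inv (fun k => by positivity) fun k => 2 * P.c k
  have hB2 := summable_mul_bump (P.summable_x_rpow (s := 2 * P.ε) (by linarith [P.eps_pos]))
    (fun k => by positivity) P.idx
  have hB := (hB1.mul_left (16 * P.C ^ 2)).add (hB2.mul_left (128 * P.C ^ 2))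
  refine summable_of_zones (Z := P.Zone)
    (B := fun k j => 16 * P.C ^ 2 * ((P.x k : ℝ)⁻¹ * bump (j - 2 * P.c k)) +
      128 * P.C ^ 2 * ((P.x k : ℝ) ^ (-(2 * P.ε)) * bump (j - P.idx k)))
    (summable_inv_abs_add_one_sq.mul_left (4 * P.C ^ 2)) hB (fun k j => ?_) ?_ ?_
  · have := bump_nonneg (j - 2 * P.c k)
    have := bump_nonneg (j - P.idx k)
    positivity
  · intro k j hk
    have hx := P.x_cast_pos k
    have hr := P.abs_r_le j
    rw [P.W_of_zone hk] at hr
    have hV := P.abs_V_le_of_zone hk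
    have h1 := P.zoneBound_mul_sq_le (k := k) j
    have h2 : (P.zoneBound k j * (2 * (P.x k : ℝ)⁻¹)) ^ 2 ≤
        P.C ^ 2 * (4 * ((P.x k : ℝ)⁻¹ * bump (j - 2 * P.c k))) := by
      rw [mul_pow]
      refine (mul_le_mul_of_nonneg_right (P.zoneBound_sq_le k j) (sq_nonneg _)).trans_eq ?_
      field_simp
      norm_num
    rw [abs_of_nonneg (sq_nonneg _), ← sq_abs, abs_mul]
    have h3 : |P.r j| * |P.V j| ≤
        P.zoneBound k j * (|(j : ℝ) - 2 * P.c k| / |(j : ℝ) - P.lam (P.idx k)|) +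
          P.zoneBound k j * (2 * (P.x k : ℝ)⁻¹) := by
      rw [← mul_add]
      exact mul_le_mul hr hV (abs_nonneg _) (P.zoneBound_nonneg k j)
    have h4 := pow_le_pow_left₀ (by positivity) h3 2
    have h5 : 0 ≤ 4 * P.C ^ 2 * ((|(j : ℝ)| + 1)⁻¹) ^ 2 := by positivity
    refine h4.trans ?_
    refine (add_sq_le).trans ?_
    linarith
  · intro j hj
    have hr := P.abs_r_le j
    rw [P.W_of_off hj] at hr
    have h3 : |P.r j| * |P.V j| ≤ (P.C * (|(j : ℝ)| + 1)⁻¹) * 2 :=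
      mul_le_mul (hr.trans (P.offBound_le j)) (P.abs_V_le_of_off hj) (abs_nonneg _) (by positivity)
    rw [abs_of_nonneg (sq_nonneg _), ← sq_abs, abs_mul]
    refine (pow_le_pow_left₀ (by positivity) h3 2).trans_eq ?_
    ring

/-- Absolute convergence for the exchange of sums in `tsum_r_mul_V`. In a zone the powers combine to
`x * x ^ (-4) * x ^ 2 = x ^ (-1)`, and the peaks at the center and at `idx k` are separated by `2us
≤ u² + s²`. -/
theorem summable_double (n : ℤ) : Summable fun z : ℕ × ℤ =>
    P.γ z.1 * (P.r z.2 / (z.2 - P.lam (P.idx z.1)) / (P.lam n - z.2)) := by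
  have hC := P.C_pos
  obtain ⟨A, hA, hAn⟩ := inv_sub_le (P.lam n) (P.lam_ne_int n)
  have hB0 := P.summable_x_inv_sq.mul_of_nonneg P.summable_W_mul
    (fun k => by positivity) (fun j => mul_nonneg (P.W_nonneg j) (by positivity))
  have hB1 := summable_mul_bump P.summable_x_inv (fun k => by positivity) fun k => 2 * P.c k
  have hB2 := summable_mul_bump P.summable_x_inv (fun k => by positivity) P.idx
  have hB := ((hB0.mul_left 2).add ((hB1.add hB2).mul_left (8 * P.C))).mul_left A
  refine Summable.of_norm_bounded hB fun z => ?_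
  obtain ⟨k, j⟩ := z
  simp only [Real.norm_eq_abs]
  have hx := P.x_cast_pos k
  have hb := bump_nonneg (j - 2 * P.c k)
  have hb' := bump_nonneg (j - P.idx k)
  have hW := P.W_nonneg j
  have e : |P.γ k * (P.r j / (j - P.lam (P.idx k)) / (P.lam n - j))| =
      |P.r j| * |(j : ℝ) - P.lam n|⁻¹ * |P.γ k / (j - P.lam (P.idx k))| := by
    simp only [abs_mul, abs_div, abs_sub_comm (P.lam n)]
    rw [div_eq_mul_inv, div_eq_mul_inv, div_eq_mul_inv]
    ring
  rw [e]
  have h1 : |P.r j| * |(j : ℝ) - P.lam n|⁻¹ ≤ A * (P.W j * (|(j : ℝ)| + 1)⁻¹) := by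
    refine (mul_le_mul (P.abs_r_le j) (hAn j) (by positivity) hW).trans_eq (by ring)
  by_cases hz : P.Zone k j
  · have h2 : |P.γ k / (j - P.lam (P.idx k))| ≤
        16 * (P.x k : ℝ) ^ 2 * (|((j - P.idx k : ℤ) : ℝ)| + 1)⁻¹ := by
      rw [abs_div, abs_of_pos (P.γ_pos k), div_eq_mul_inv]
      refine (mul_le_mul (P.γ_le k) (P.inv_abs_sub_lam_le k j) (by positivity)
        (by positivity)).trans_eq (by ring)
    have h3 : P.W j * (|(j : ℝ)| + 1)⁻¹ ≤
        P.C * (P.x k * (|(j : ℝ) - 2 * P.c k| + 1)⁻¹) * ((P.x k : ℝ) ^ 4)⁻¹ := by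
      rw [P.W_of_zone hz]
      refine mul_le_mul (P.zoneBound_le k j) (inv_anti₀ (by positivity) ?_) (by positivity)
        (by positivity)
      linarith [P.c_le_abs hz]
    have h0 : 0 ≤ A * (2 * (((P.x k : ℝ)⁻¹) ^ 2 * (P.W j * (|(j : ℝ)| + 1)⁻¹))) := by positivity
    rw [bump_center, bump] at *
    set u := (|(j : ℝ) - 2 * P.c k| + 1)⁻¹ with hu
    set s := (|((j - P.idx k : ℤ) : ℝ)| + 1)⁻¹ with hs
    have hu0 : 0 ≤ u := by positivity
    have hs0 : 0 ≤ s := by positivity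
    calc _ ≤ A * (P.C * (P.x k * u) * ((P.x k : ℝ) ^ 4)⁻¹) * (16 * (P.x k : ℝ) ^ 2 * s) :=
          mul_le_mul (h1.trans (mul_le_mul_of_nonneg_left h3 hA.le)) h2 (abs_nonneg _)
            (by positivity)
      _ = A * (8 * P.C * (P.x k : ℝ)⁻¹ * (2 * u * s)) := by field_simp; ring
      _ ≤ A * (8 * P.C * (P.x k : ℝ)⁻¹ * (u ^ 2 + s ^ 2)) := by
          gcongr
          exact two_mul_le_add_sq u s
      _ ≤ _ := by linarith
  · have h2 := P.abs_term_le hz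
    have h0 : 0 ≤ A * (8 * P.C * ((P.x k : ℝ)⁻¹ * bump (j - 2 * P.c k) +
      (P.x k : ℝ)⁻¹ * bump (j - P.idx k))) := by positivity
    calc _ ≤ A * (P.W j * (|(j : ℝ)| + 1)⁻¹) * (2 * ((P.x k : ℝ)⁻¹) ^ 2) :=
          mul_le_mul h1 h2 (abs_nonneg _) (by positivity)
      _ ≤ _ := by linarith

/-- Formally the vector is `r + ∑ γ k • u (idx k)`: the Cauchy transform of `r` vanishes at every
frequency, and that of `u (idx k)` at every frequency but the one with index `idx k`. -/
theorem tsum_r_mul_V {n : ℤ} (hn : n ∉ Set.range P.idx) :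
    ∑' j : ℤ, P.r j * P.V j / (P.lam n - j) = 0 := by
  have hd := P.summable_double n
  have h1 : ∑' j : ℤ, P.r j / (P.lam n - j) = 0 := by
    rw [← neg_eq_zero, ← tsum_neg, ← P.tsum_r_div n]
    refine tsum_congr fun j => ?_
    rw [← neg_sub (P.lam n), div_neg]
  have hs1 : Summable fun j : ℤ => P.r j / (P.lam n - j) := by
    obtain ⟨A, hA, hAn⟩ := inv_sub_le (P.lam n) (P.lam_ne_int n)
    refine Summable.of_norm_bounded (P.summable_W_mul.mul_left A) fun j => ?_
    rw [Real.norm_eq_abs, abs_div, div_eq_mul_inv, abs_sub_comm]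
    exact (mul_le_mul (P.abs_r_le j) (hAn j) (by positivity) (P.W_nonneg j)).trans_eq (by ring)
  have h2 : ∑' j : ℤ, ∑' k : ℕ, P.γ k * (P.r j / (j - P.lam (P.idx k)) / (P.lam n - j)) = 0 := by
    rw [Summable.tsum_comm
      (f := fun k (j : ℤ) => P.γ k * (P.r j / (j - P.lam (P.idx k)) / (P.lam n - j))) hd]
    refine (tsum_congr fun k => ?_).trans tsum_zero
    rw [tsum_mul_left, P.residueData.orth _ _ fun h => hn ⟨k, h.symm⟩, mul_zero]
  have e : ∀ j : ℤ, P.r j * P.V j / (P.lam n - j) = P.r j / (P.lam n - j) +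
      ∑' k : ℕ, P.γ k * (P.r j / (j - P.lam (P.idx k)) / (P.lam n - j)) := by
    intro j
    have e1 : ∀ k, P.γ k * (P.r j / (j - P.lam (P.idx k)) / (P.lam n - j)) =
        P.r j / (P.lam n - j) * (P.γ k / (j - P.lam (P.idx k))) := fun k => by
      simp only [div_eq_mul_inv]; ring
    simp only [e1]
    rw [tsum_mul_left, V]
    ring
  have hs2 : Summable fun j : ℤ =>
      ∑' k : ℕ, P.γ k * (P.r j / (j - P.lam (P.idx k)) / (P.lam n - j)) := hd.prod_symm.prod
  simp only [e]
  rw [hs1.tsum_add hs2, h1, h2, add_zero]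

theorem nonhereditarilyComplete : IsNonhereditarilyComplete (expSystem P.lam) := by
  obtain ⟨v, hv⟩ := exists_L2_of_summable_sq (fun j => P.r j * P.V j) P.summable_r_mul_V_sq
  refine P.residueData.not_hereditary P.idx v (fun n hn => ?_) fun u hu => ?_
  · exact inner_expSystem_eq_zero_of_real P.lam_ne_int n v _ hv (P.tsum_r_mul_V hn)
  · refine notMem_closure_of_diagonally_dominant P.idx (fun k => 2 * P.c k) P.γ P.γ_pos P.γ_eq
      P.c₀_pos P.le_abs_r_center P.r_zero P.summable_terms (fun i => ?_) ?_ v hv u hu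
    · refine (P.tsum_off_diagonal_le (P.zone_center i)).trans ?_
      have h1 : (P.x i : ℝ)⁻¹ ≤ 4⁻¹ := inv_anti₀ (by norm_num) (P.four_le_x_cast i)
      linarith
    · have hle : ∀ k, |P.γ k / (((0 : ℤ) : ℝ) - P.lam (P.idx k))| ≤ ((P.x k : ℝ)⁻¹) ^ 2 := by
        intro k
        have hx := P.x_cast_pos k
        have h3 := P.half_lt
        have h1 : 2 * (P.x k : ℝ) ^ 4 ≤ |((0 : ℤ) : ℝ) - P.lam (P.idx k)| := by
          rw [Int.cast_zero, zero_sub, abs_neg, lam_idx]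
          refine le_trans ?_ (le_abs_self _)
          nlinarith
        rw [abs_div, abs_of_pos (P.γ_pos k), div_le_iff₀ (lt_of_lt_of_le (by positivity) h1)]
        refine (P.γ_le k).trans ?_
        calc 2 * (P.x k : ℝ) ^ 2 = ((P.x k : ℝ)⁻¹) ^ 2 * (2 * (P.x k : ℝ) ^ 4) := by field_simp
          _ ≤ _ := by gcongr
      refine ((P.summable_terms 0).tsum_le_tsum hle P.summable_x_inv_sq).trans ?_
      linarith [P.tsum_x_inv_sq_le]

end Params

end SpectralSynthesis

/-! ### The lacunary intervals and the choice of the parameters. -/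

namespace SpectralSynthesis

open Filter Topology

theorem mem_Icc_ceil_floor {a b : ℝ} {n : ℤ} :
    n ∈ Finset.Icc ⌈a⌉ ⌊b⌋ ↔ a ≤ n ∧ (n : ℝ) ≤ b := by
  rw [Finset.mem_Icc, Int.ceil_le, Int.le_floor]

theorem card_Icc_ceil_floor_le {a b : ℝ} (hab : a ≤ b) :
    ((Finset.Icc ⌈a⌉ ⌊b⌋).card : ℝ) ≤ b - a + 1 := by
  rw [Int.card_Icc]
  rcases le_or_gt (⌊b⌋ + 1 - ⌈a⌉) 0 with h | h
  · rw [Int.toNat_of_nonpos h]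
    push_cast
    linarith
  · have e : (((⌊b⌋ + 1 - ⌈a⌉).toNat : ℕ) : ℝ) = ((⌊b⌋ + 1 - ⌈a⌉ : ℤ) : ℝ) := by
      exact_mod_cast Int.toNat_of_nonneg h.le
    rw [e]
    push_cast
    linarith [Int.floor_le b, Int.le_ceil a]

theorem sumSq_nonneg (G : ℂ → ℂ) (a b : ℝ) : 0 ≤ sumSq G a b :=
  Finset.sum_nonneg fun _ _ => sq_nonneg _

theorem sumSq_le_of_forall {G : ℂ → ℂ} {a b M : ℝ} (hab : a ≤ b) (hM : 0 ≤ M)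
    (h : ∀ n : ℤ, a ≤ n → (n : ℝ) ≤ b → ‖G n‖ ^ 2 ≤ M) : sumSq G a b ≤ (b - a + 1) * M := by
  refine (Finset.sum_le_card_nsmul _ _ M fun n hn => ?_).trans ?_
  · obtain ⟨h1, h2⟩ := mem_Icc_ceil_floor.1 hn
    exact h n h1 h2
  · rw [nsmul_eq_mul]
    exact mul_le_mul_of_nonneg_right (card_Icc_ceil_floor_le hab) hM

namespace Params

variable (P : Params)

/-- The generating function of the frequencies. -/
noncomputable def G : ℂ → ℂ := canonicalProduct P.lam

theorem norm_G (n : ℤ) : ‖P.G n‖ = |P.r n| := by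
  obtain ⟨e, he, hd⟩ := P.exists_dist
  exact (abs_resLim P.abs_lam_sub_le he hd n).symm

/-- The centers of the lacunary intervals. -/
noncomputable def ρ (k : ℕ) : ℝ := 2 * (P.x k : ℝ) ^ 4 + 1 / 2

/-- The radii of the lacunary intervals. -/
noncomputable def d (k : ℕ) : ℝ := (P.x k : ℝ) ^ 3

/-- The parameter `E` is large compared with the constants that depend on `β` only. -/
structure Large : Prop where
  ten_le : 10 ≤ P.E
  le_sqrt : 50 * (P.C ^ 2 * ∑' j, bump j) ≤ √(P.E : ℝ)
  one_le : 1 ≤ 2 * P.c₀ ^ 2 * P.E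

variable {P}

theorem norm_G_sq_le {k : ℕ} {n : ℤ} (h : P.Zone k n) : ‖P.G n‖ ^ 2 ≤ P.zoneBound k n ^ 2 := by
  rw [norm_G, ← P.W_of_zone h]
  exact pow_le_pow_left₀ (abs_nonneg _) (P.abs_r_le n) 2

theorem zone_of_abs_le {k : ℕ} {n : ℤ} (h : |(n : ℝ) - 2 * (P.x k : ℝ) ^ 4| < (P.x k : ℝ) ^ 4) :
    P.Zone k n := by
  rw [abs_lt, ← P.c_cast] at h
  constructor
  · have : (P.c k : ℝ) ≤ n := by linarith
    exact_mod_cast this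
  · have : (n : ℝ) < 4 * P.c k := by
      have : (0 : ℝ) < P.c k := by exact_mod_cast P.c_pos k
      linarith
    exact_mod_cast this

/-- At a distance of about `d k = x ^ 3` or more from the center, `x ^ (2ε) * (x ^ 3) ^ (-4ε) = x ^
(-10ε)`, which is summable over `k`. -/
theorem norm_G_sq_le_far {k : ℕ} {n : ℤ} (h : P.Zone k n)
    (hn : (P.x k : ℝ) ^ 3 ≤ |(n : ℝ) - 2 * (P.x k : ℝ) ^ 4| + 1) :
    ‖P.G n‖ ^ 2 ≤ P.C ^ 2 * ((P.x k : ℝ) ^ (-(10 * P.ε)) * bump (n - 2 * P.c k)) := by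
  have hx := P.x_cast_pos k
  have hε := P.eps_pos
  refine (norm_G_sq_le h).trans ?_
  rw [zoneBound_sq, P.c_cast]
  refine mul_le_mul_of_nonneg_left (mul_le_mul_of_nonneg_right ?_ (bump_nonneg _)) (sq_nonneg _)
  have h1 := Real.rpow_le_rpow_of_nonpos (by positivity) hn (by linarith : -(4 * P.ε) ≤ 0)
  refine (mul_le_mul_of_nonneg_left h1 (by positivity)).trans_eq ?_
  rw [← Real.rpow_natCast _ 3, ← Real.rpow_mul hx.le, ← Real.rpow_add hx]
  congr 1
  push_cast
  ring

theorem norm_G_sq_le_near {k : ℕ} {n : ℤ} (h : P.Zone k n) :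
    ‖P.G n‖ ^ 2 ≤ P.C ^ 2 * √(P.x k) * bump (n - 2 * P.c k) := by
  have hx := P.x_cast_pos k
  have hε := P.eps_pos
  have hε' := P.eps_lt
  refine (norm_G_sq_le h).trans ?_
  rw [zoneBound_sq, mul_assoc (P.C ^ 2)]
  refine mul_le_mul_of_nonneg_left (mul_le_mul_of_nonneg_right ?_ (bump_nonneg _)) (sq_nonneg _)
  have h1 : (P.x k : ℝ) ^ (2 * P.ε) ≤ √(P.x k) := by
    rw [Real.sqrt_eq_rpow]
    exact Real.rpow_le_rpow_of_exponent_le (P.one_le_x k) (by linarith)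
  have h2 : (|(n : ℝ) - 2 * P.c k| + 1) ^ (-(4 * P.ε)) ≤ 1 :=
    Real.rpow_le_one_of_one_le_of_nonpos (by linarith [abs_nonneg ((n : ℝ) - 2 * P.c k)])
      (by linarith)
  calc _ ≤ √(P.x k) * 1 := mul_le_mul h1 h2 (by positivity) (by positivity)
    _ = _ := mul_one _

theorem Large.ten_le_x (hP : P.Large) (k : ℕ) : (10 : ℝ) ≤ P.x k := by
  exact_mod_cast hP.ten_le.trans (P.E_le_x k)

theorem Large.d_le (hP : P.Large) (k : ℕ) : 10 * P.d k ≤ (P.x k : ℝ) ^ 4 := by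
  have h := hP.ten_le_x k
  rw [d, pow_succ _ 3, mul_comm]
  exact mul_le_mul_of_nonneg_left h (by positivity)

theorem Large.thousand_le_d (hP : P.Large) (k : ℕ) : 1000 ≤ P.d k := by
  have h := hP.ten_le_x k
  calc (1000 : ℝ) = 10 ^ 3 := by norm_num
    _ ≤ _ := by rw [d]; gcongr

theorem Large.gVal_le (hP : P.Large) (k : ℕ) : gVal P.G (P.ρ k) (P.d k) ≤ P.x k / 50 := by
  have hd := hP.d_le k
  have hd' := hP.thousand_le_d k
  have h1 : gVal P.G (P.ρ k) (P.d k) ≤ P.C ^ 2 * √(P.x k) * ∑' j, bump j := by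
    rw [gVal, sumSq, ← tsum_bump_sub (2 * P.c k), ← tsum_mul_left]
    refine (Finset.sum_le_sum fun n hn => ?_).trans
      (((summable_bump_sub (2 * P.c k)).mul_left _).sum_le_tsum _ fun n _ =>
        mul_nonneg (by positivity) (bump_nonneg _))
    obtain ⟨h1, h2⟩ := mem_Icc_ceil_floor.1 hn
    refine norm_G_sq_le_near (zone_of_abs_le ?_)
    rw [ρ] at h1 h2
    rw [abs_lt]
    constructor <;> linarith
  have h2 := hP.le_sqrt
  have h3 : √(P.E : ℝ) ≤ √(P.x k) := Real.sqrt_le_sqrt (by exact_mod_cast P.E_le_x k)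
  have h4 : √(P.x k : ℝ) * √(P.x k) = P.x k := Real.mul_self_sqrt (by positivity)
  have h5 := mul_le_mul_of_nonneg_right (h2.trans h3) (Real.sqrt_nonneg (P.x k))
  rw [h4] at h5
  linarith

theorem Large.le_gVal (hP : P.Large) (k : ℕ) : P.c₀ ^ 2 ≤ gVal P.G (P.ρ k) (P.d k) := by
  have hd' := hP.thousand_le_d k
  rw [gVal, sumSq]
  have hmem : (2 * P.c k : ℤ) ∈ Finset.Icc ⌈P.ρ k - P.d k⌉ ⌊P.ρ k + P.d k⌋ := by
    rw [mem_Icc_ceil_floor]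
    push_cast
    rw [ρ, P.c_cast]
    constructor <;> linarith
  refine le_trans ?_ (Finset.single_le_sum (f := fun n : ℤ => ‖P.G n‖ ^ 2)
    (fun n _ => sq_nonneg _) hmem)
  simp only [norm_G]
  exact pow_le_pow_left₀ P.c₀_pos.le (P.le_abs_r_center k) 2

theorem Large.sVal_le (hP : P.Large) (k : ℕ) : sVal P.G (P.ρ k) (P.d k) ≤ P.ρ k / 10 := by
  have hx := P.x_cast_pos k
  have h1 := hP.gVal_le k
  have hρ : 0 < P.ρ k := by rw [ρ]; positivity
  rw [sVal]
  refine Real.sqrt_le_iff.2 ⟨by positivity, ?_⟩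
  calc P.d k * gVal P.G (P.ρ k) (P.d k) * P.ρ k
      ≤ (P.x k : ℝ) ^ 3 * (P.x k / 50) * P.ρ k := by
        rw [d] at h1 ⊢
        gcongr
    _ = (P.x k : ℝ) ^ 4 / 50 * P.ρ k := by ring
    _ ≤ P.ρ k / 100 * P.ρ k := by
        refine mul_le_mul_of_nonneg_right ?_ hρ.le
        rw [ρ]; linarith
    _ = _ := by ring

/-- The value at the center keeps `g_k ≥ c₀ ^ 2`, so `s_k` is at least of order `x ^ (7/2)`, more
than `d k = x ^ 3`. Hence the far estimate holds on `J_k`. -/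
theorem Large.d_le_sVal (hP : P.Large) (k : ℕ) : P.d k ≤ sVal P.G (P.ρ k) (P.d k) := by
  have hx := P.x_cast_pos k
  have h1 := hP.le_gVal k
  have hc := P.c₀_pos
  rw [sVal]
  refine Real.le_sqrt_of_sq_le ?_
  have h2 : 1 ≤ 2 * P.c₀ ^ 2 * P.x k := by
    refine hP.one_le.trans ?_
    have : (P.E : ℝ) ≤ P.x k := by exact_mod_cast P.E_le_x k
    gcongr
  calc P.d k ^ 2 = (P.x k : ℝ) ^ 6 * 1 := by rw [d]; ring
    _ ≤ (P.x k : ℝ) ^ 6 * (2 * P.c₀ ^ 2 * P.x k) := by gcongr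
    _ = P.d k * P.c₀ ^ 2 * (2 * (P.x k : ℝ) ^ 4) := by rw [d]; ring
    _ ≤ _ := by
        refine mul_le_mul (mul_le_mul_of_nonneg_left h1 (by rw [d]; positivity)) ?_
          (by positivity) (mul_nonneg (by rw [d]; positivity) ((sq_nonneg _).trans h1))
        rw [ρ]; linarith

/-- `J_k` contains about `2s` integers, at each of which `|G|²` is at most a constant times `x ^
(-10ε) / s ^ 2`. The powers of `s` cancel against the factor `s`. -/
theorem Large.sVal_mul_jVal_le (hP : P.Large) (k : ℕ) :
    sVal P.G (P.ρ k) (P.d k) * jVal P.G (P.ρ k) (P.d k) ≤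
      4 * P.C ^ 2 * (P.x k : ℝ) ^ (-(10 * P.ε)) := by
  have hx := P.x_cast_pos k
  have hd := hP.d_le k
  have hd' := hP.thousand_le_d k
  have hs := hP.sVal_le k
  have hs' := hP.d_le_sVal k
  rw [jVal]
  set s := sVal P.G (P.ρ k) (P.d k) with hsdef
  have hs1 : 1 ≤ s := by linarith
  have hx4 : 10 ≤ (P.x k : ℝ) ^ 4 := by linarith
  set M := P.C ^ 2 * ((P.x k : ℝ) ^ (-(10 * P.ε)) * (s⁻¹) ^ 2) with hM
  have hM0 : 0 ≤ M := by positivity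
  have key : ∀ n : ℤ, s ≤ |(n : ℝ) - 2 * (P.x k : ℝ) ^ 4| + 1 →
      |(n : ℝ) - 2 * (P.x k : ℝ) ^ 4| < (P.x k : ℝ) ^ 4 → ‖P.G n‖ ^ 2 ≤ M := by
    intro n h1 h2
    refine (norm_G_sq_le_far (zone_of_abs_le h2) (hs'.trans h1)).trans ?_
    refine mul_le_mul_of_nonneg_left (mul_le_mul_of_nonneg_left ?_ (by positivity)) (sq_nonneg _)
    rw [bump_center, P.c_cast]
    refine pow_le_pow_left₀ (by positivity) (inv_anti₀ (by linarith) h1) 2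
  have hleft : sumSq P.G (P.ρ k - P.d k - 2 * s) (P.ρ k - P.d k - s) ≤ (s + 1) * M := by
    refine (sumSq_le_of_forall (by linarith) hM0 fun n h1 h2 => key n ?_ ?_).trans_eq (by ring)
    · rw [ρ] at h2
      have := neg_le_abs ((n : ℝ) - 2 * (P.x k : ℝ) ^ 4)
      linarith
    · rw [ρ] at h1 h2 hs
      rw [abs_lt]
      constructor <;> linarith
  have hright : sumSq P.G (P.ρ k + P.d k + s) (P.ρ k + P.d k + 2 * s) ≤ (s + 1) * M := by
    refine (sumSq_le_of_forall (by linarith) hM0 fun n h1 h2 => key n ?_ ?_).trans_eq (by ring)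
    · rw [ρ] at h1
      have := le_abs_self ((n : ℝ) - 2 * (P.x k : ℝ) ^ 4)
      linarith
    · rw [ρ] at h1 h2 hs
      rw [abs_lt]
      constructor <;> linarith
  calc _ ≤ s * (2 * (s * 2 * M)) := by
        refine mul_le_mul_of_nonneg_left ?_ (by linarith)
        have : (s + 1) * M ≤ s * 2 * M := mul_le_mul_of_nonneg_right (by linarith) hM0
        linarith
    _ = _ := by rw [hM]; field_simp; ring

variable (P) in
theorem summable_off : Summable
    (fun n : {n : ℤ // ∀ k, (n : ℝ) ∉ Set.Icc (P.ρ k - P.d k) (P.ρ k + P.d k)} =>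
      ‖P.G ((n : ℤ) : ℂ)‖ ^ 2) := by
  have hε := P.eps_pos
  let S : Set ℤ := {n : ℤ | ∀ k, (n : ℝ) ∉ Set.Icc (P.ρ k - P.d k) (P.ρ k + P.d k)}
  refine (summable_subtype_iff_indicator (s := S) (f := fun n : ℤ => ‖P.G (n : ℂ)‖ ^ 2)).2 ?_
  have hB := (summable_mul_bump (P.summable_x_rpow (s := 10 * P.ε) (by linarith))
    (fun k => by positivity) fun k => 2 * P.c k).mul_left (P.C ^ 2)
  refine summable_of_zones (Z := P.Zone)
    (B := fun k j => P.C ^ 2 * ((P.x k : ℝ) ^ (-(10 * P.ε)) * bump (j - 2 * P.c k)))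
    (summable_inv_abs_add_one_sq.mul_left (P.C ^ 2)) hB
    (fun k j => mul_nonneg (sq_nonneg _) (mul_nonneg (by positivity) (bump_nonneg _)))
    (fun k j hk => ?_) fun j hj => ?_
  · have h0 : 0 ≤ P.C ^ 2 * ((|(j : ℝ)| + 1)⁻¹) ^ 2 := by positivity
    by_cases hjS : j ∈ S
    · rw [Set.indicator_of_mem hjS, abs_of_nonneg (sq_nonneg _)]
      have h1 := hjS k
      rw [Set.mem_Icc, not_and_or, not_le, not_le, ρ] at h1
      have h2 := norm_G_sq_le_far hk (by
        have h3 := le_abs_self ((j : ℝ) - 2 * (P.x k : ℝ) ^ 4)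
        have h4 := neg_le_abs ((j : ℝ) - 2 * (P.x k : ℝ) ^ 4)
        change P.d k ≤ _
        rcases h1 with h1 | h1 <;> linarith)
      linarith
    · rw [Set.indicator_of_notMem hjS, abs_zero]
      have := bump_nonneg (j - 2 * P.c k)
      positivity
  · by_cases hjS : j ∈ S
    · rw [Set.indicator_of_mem hjS, abs_of_nonneg (sq_nonneg _), norm_G, ← mul_pow]
      have h1 := P.abs_r_le j
      rw [P.W_of_off hj] at h1
      exact pow_le_pow_left₀ (abs_nonneg _) (h1.trans (P.offBound_le j)) 2
    · rw [Set.indicator_of_notMem hjS, abs_zero]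
      positivity

theorem Large.intervalConditions (hP : P.Large) : IntervalConditions P.G P.ρ P.d where
  rho_pos k := by rw [ρ]; positivity
  lacunary k := by
    have h : 16 * (P.x k : ℝ) ^ 4 ≤ (P.x (k + 1) : ℝ) ^ 4 := by
      rw [← P.c_cast, ← P.c_cast]
      exact_mod_cast P.c_succ k
    have := pow_pos (P.x_cast_pos k) 4
    have := hP.d_le k
    have := hP.thousand_le_d k
    rw [ρ, ρ]
    linarith
  d_pos k := by linarith [hP.thousand_le_d k]
  d_le k := by
    have := hP.d_le k
    have := hP.thousand_le_d k
    rw [ρ]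
    linarith
  dist_rho k m := by
    have e : P.ρ k - m = ((2 * P.c k - m : ℤ) : ℝ) + 1 / 2 := by
      rw [ρ, ← P.c_cast]
      push_cast
      ring
    rw [e]
    generalize 2 * (P.c k : ℤ) - m = t
    rcases le_or_gt 0 t with h | h
    · have h1 : (0 : ℝ) ≤ t := by exact_mod_cast h
      exact le_trans (by linarith) (le_abs_self _)
    · have h1 : (t : ℝ) ≤ -1 := by exact_mod_cast (by omega : t ≤ -1)
      exact le_trans (by linarith) (neg_le_abs _)
  G_rho_ne k := by
    obtain ⟨e, he, hd⟩ := P.exists_dist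
    refine canonicalProduct_ne_zero P.abs_lam_sub_le he hd _ fun n hn => ?_
    have h1 : P.ρ k = P.lam n := by exact_mod_cast hn
    have hα := P.half_lt
    have hα' := P.lt
    by_cases h0 : n = 0
    · rw [h0, lam_zero, ρ, ← P.c_cast] at h1
      have h2 : (P.E : ℝ) ≤ P.c k := by exact_mod_cast (P.E_le_x k).trans (P.x_le_c k)
      have h3 := P.beta_le
      have h4 := le_abs_self P.β
      have h5 : (0 : ℝ) ≤ P.c k := by positivity
      linarith
    -- For `1/2 < α < 3/4` neither `α - 1/2` nor `-α - 1/2` is an integer: they lie in `(0, 1)` and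
    -- `(-2, -1)`.
    · have e : ((2 * P.c k - n : ℤ) : ℝ) = P.D n - 1 / 2 := by
        rw [ρ, ← P.c_cast, P.lam_of_ne h0] at h1
        push_cast
        linarith
      generalize 2 * (P.c k : ℤ) - n = t at e
      rcases P.D_eq_or h0 with h | h <;> rw [h] at e
      · have h3 : (t : ℝ) < ((-1 : ℤ) : ℝ) := by push_cast; linarith
        have h4 : ((-2 : ℤ) : ℝ) < t := by push_cast; linarith
        rw [Int.cast_lt] at h3 h4
        omega
      · have h3 : ((0 : ℤ) : ℝ) < t := by push_cast; linarith
        have h4 : (t : ℝ) < ((1 : ℤ) : ℝ) := by push_cast; linarith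
        rw [Int.cast_lt] at h3 h4
        omega
  summable_off := P.summable_off
  summable_J := by
    refine Summable.of_nonneg_of_le (fun k => ?_) hP.sVal_mul_jVal_le
      ((P.summable_x_rpow (s := 10 * P.ε) (by linarith [P.eps_pos])).mul_left _)
    exact mul_nonneg (Real.sqrt_nonneg _) (add_nonneg (sumSq_nonneg _ _ _) (sumSq_nonneg _ _ _))
  s_le := hP.sVal_le
  summable_log := by
    refine Summable.of_nonneg_of_le (fun k => ?_) (fun k => ?_) P.summable_x_inv
    · rw [d, ρ]; positivity
    · have hx := P.x_cast_pos k
      rw [d, ρ, div_le_iff₀ (by positivity)]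
      calc (P.x k : ℝ) ^ 3 = (P.x k : ℝ)⁻¹ * (P.x k : ℝ) ^ 4 := by field_simp
        _ ≤ _ := by
          have : 0 ≤ (P.x k : ℝ) ^ 4 := by positivity
          gcongr
          linarith

theorem Large.hypotheses (hP : P.Large) : Hypotheses P.G P.lam := by
  obtain ⟨e, he, hd⟩ := P.exists_dist
  refine ⟨P.residueData.isCompleteMinimal,
    isGeneratingFunction_canonicalProduct P.abs_lam_sub_le he hd,
    canonicalProduct_im P.abs_lam_sub_le he hd, ⟨e, he, hd⟩, ?_, ?_,
    P.ρ, P.d, hP.intervalConditions⟩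
  · set M := max P.α |P.β| with hM
    have hM0 : 0 ≤ M := (abs_nonneg _).trans (le_max_right _ _)
    refine ⟨2 * M + 2, by linarith, fun a b hab => ⟨⌈a + M⌉, ?_⟩⟩
    have h1 := abs_le.1 (P.abs_lam_sub_le ⌈a + M⌉)
    have h2 := Int.le_ceil (a + M)
    have h3 := Int.ceil_lt_add_one (a + M)
    rw [← hM] at h1
    constructor <;> linarith
  · exact canonicalProduct_isLittleO P.abs_lam_sub_le he hd P.lam_ne_int P.lev_tendsto
      P.abs_res_le_W P.abs_r_le P.summable_W_mul (P.tsum_r_div 0)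

/-- The constants `C` and `c₀` depend on `β` only, so `E` can be taken large after them. -/
theorem exists_large {α β : ℝ} (h1 : 1 / 2 < α) (h2 : α < 3 / 4) (hβ : ∀ m : ℤ, β ≠ m)
    (hadd : ∀ m : ℤ, β + α ≠ m) (hsub : ∀ m : ℤ, β - α ≠ m) :
    ∃ P : Params, P.α = α ∧ P.β = β ∧ P.Large := by
  set C := 3 * (1 + |β|) / |β| * Real.exp (13 + 4 * sumInvSq) with hC
  set c := 1 / (8 * |β|) * Real.exp (-17 - 4 * sumInvSq) with hc
  have hβ0 : 0 < |β| := abs_pos.2 (by simpa using hβ 0)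
  have hc0 : 0 < 2 * c ^ 2 := by positivity
  have t0 : Tendsto (fun E : ℕ => (E : ℝ)) atTop atTop := tendsto_natCast_atTop_atTop
  have t1 := (tendsto_rpow_atTop (by linarith : 0 < α - 1 / 2)).comp t0
  have t2 := Real.tendsto_sqrt_atTop.comp t0
  have t3 := t0.const_mul_atTop hc0
  obtain ⟨E, e1, e2, e3, e4, e5⟩ := ((eventually_ge_atTop 10).and
    ((t1.eventually_ge_atTop (Real.exp 6)).and
    ((t0.eventually_ge_atTop (|β| + 1)).and
    ((t2.eventually_ge_atTop (50 * (C ^ 2 * ∑' j, bump j))).and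
    (t3.eventually_ge_atTop 1))))).exists
  exact ⟨⟨α, β, E, h1, h2, hβ, hadd, hsub, by omega, e2, e3⟩, rfl, rfl, ⟨e1, e4, e5⟩⟩

end Params

theorem exists_avoiding_int {a b β : ℝ} (hab : a < b) :
    ∃ α, a < α ∧ α < b ∧ (∀ m : ℤ, β + α ≠ m) ∧ ∀ m : ℤ, β - α ≠ m := by
  have hcount : (Set.range (fun m : ℤ => (m : ℝ) - β) ∪
      Set.range fun m : ℤ => β - (m : ℝ)).Countable :=
    (Set.countable_range _).union (Set.countable_range _)
  obtain ⟨α, hα, h1, h2⟩ := (hcount.dense_compl ℝ).exists_between hab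
  refine ⟨α, h1, h2, fun m h => hα (Or.inl ⟨m, ?_⟩), fun m h => hα (Or.inr ⟨m, ?_⟩)⟩
  · change (m : ℝ) - β = α
    linarith
  · change β - (m : ℝ) = α
    linarith

/-- For every `δ > 1/2` there are a function and frequencies that satisfy the hypotheses, such that
the frequencies deviate from the integers by at most `δ`, and the exponential system is
nonhereditarily complete. -/
theorem exists_nonhereditarilyComplete {δ : ℝ} (hδ : 1 / 2 < δ) :
    ∃ (G : ℂ → ℂ) (lam : ℤ → ℝ), Hypotheses G lam ∧ (∀ n : ℤ, |lam n - n| ≤ δ) ∧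
      ((∀ m : ℤ, δ ≠ m) → IsLUB (Set.range fun n : ℤ => |lam n - n|) δ) ∧
      IsNonhereditarilyComplete (expSystem lam) := by
  -- The single frequency `λ_0 = β` realizes the supremum. It must not be an integer, so for
  -- integral `δ` it is replaced by `1 / 2` and the equality is given up.
  obtain ⟨β, hβ, hβδ, hβeq⟩ : ∃ β : ℝ, (∀ m : ℤ, β ≠ m) ∧ |β| ≤ δ ∧
      ((∀ m : ℤ, δ ≠ m) → |β| = δ) := by
    by_cases h : ∀ m : ℤ, δ ≠ m
    · have e : |δ| = δ := abs_of_pos (by linarith)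
      exact ⟨δ, h, e.le, fun _ => e⟩
    · refine ⟨1 / 2, fun m hm => ?_, ?_, fun h' => absurd h' h⟩
      · have h1 : ((0 : ℤ) : ℝ) < m := by rw [← hm]; norm_num
        have h2 : (m : ℝ) < ((1 : ℤ) : ℝ) := by rw [← hm]; norm_num
        rw [Int.cast_lt] at h1 h2
        omega
      · rw [abs_of_pos (by norm_num)]
        exact hδ.le
  obtain ⟨α, h1, h2, hadd, hsub⟩ := exists_avoiding_int (β := β)
    (lt_min hδ (by norm_num : (1 : ℝ) / 2 < 3 / 4))
  obtain ⟨P, hPα, hPβ, hP⟩ := Params.exists_large h1 (h2.trans_le (min_le_right _ _)) hβ hadd hsub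
  have hle : ∀ n : ℤ, |P.lam n - n| ≤ δ := fun n => by
    refine (P.abs_lam_sub_le n).trans (max_le ?_ ?_)
    · rw [hPα]; exact h2.le.trans (min_le_left _ _)
    · rw [hPβ]; exact hβδ
  refine ⟨P.G, P.lam, hP.hypotheses, hle, fun h => ⟨?_, fun b hb => ?_⟩,
    P.nonhereditarilyComplete⟩
  · rintro _ ⟨n, rfl⟩
    exact hle n
  · have h0 := hb ⟨0, rfl⟩
    simp only [P.lam_zero, hPβ, Int.cast_zero, sub_zero, hβeq h] at h0
    exact h0

theorem deltaCrit_le_half : deltaCrit ≤ ((1 / 2 : ℝ) : EReal) := by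
  by_contra hcon
  obtain ⟨δ, h1, h2⟩ := EReal.lt_iff_exists_real_btwn.1 (not_le.1 hcon)
  rw [EReal.coe_lt_coe_iff] at h1
  obtain ⟨G, lam, -, hle, -, hnon⟩ :=
    -- The midpoint turns the bound `≤` into the strict inequality required in `deltaCrit`.
    exists_nonhereditarilyComplete (δ := (1 / 2 + δ) / 2) (by linarith)
  refine absurd h2 (not_lt.2 (sInf_le ⟨δ, rfl, by linarith, lam, fun n => ?_, hnon⟩))
  exact (hle n).trans_lt (by linarith)

end SpectralSynthesis

theorem theorem2p4 :
    (∀ δ : ℝ, 1 / 2 < δ →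
      ∃ (G : ℂ → ℂ) (lam : ℤ → ℝ),
        SpectralSynthesis.Hypotheses G lam ∧
        (∀ n : ℤ, |lam n - n| ≤ δ) ∧
        ((∀ m : ℤ, δ ≠ m) → IsLUB (Set.range fun n : ℤ => |lam n - n|) δ) ∧
        SpectralSynthesis.IsNonhereditarilyComplete (SpectralSynthesis.expSystem lam)) ∧
    SpectralSynthesis.deltaCrit ≤ ((1 / 2 : ℝ) : EReal) :=
  ⟨fun _ hδ => SpectralSynthesis.exists_nonhereditarilyComplete hδ,
    SpectralSynthesis.deltaCrit_le_half⟩
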